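/- Setting. Let $\tilde{\mathcal T}_h$ be a finite conforming affine triangulation in $\mathbb R^2$ with polygonal domain $\tilde\Omega_h=\mathrm{int}\bigcup_{\tilde T}\overline{\tilde T}$, such that every triangle has at most two vertices on $\partial\tilde\Omega_h$; put $h_T=\mathrm{diam}(\tilde T)$. Let $\hat T$ be the triangle with vertices $(1,0),(0,1),(0,0)$ and $F_{\tilde T}:\hat T\to\tilde T$ the affine bijection given by an ordering of the vertices of $\tilde T$. Let $G$ be a map on $\overline{\tilde\Omega_h}$ (onto the curved domain to be approximated) that fixes all vertices of $\tilde{\mathcal T}_h$, and let $G_h$ be its piecewise quadratic nodal interpolant (nodes: the vertices and edge midpoints of $\tilde{\mathcal T}_h$). Assume that $G_h$ is the identity on interior edges (so only boundary edges may be curved), that $G_h$ is injective on $\overline{\tilde\Omega_h}$, and that $F_T:=G_h\circ F_{\tilde T}$ satisfies $\det DF_T>0$ on $\hat T$. Set $T=G_h(\tilde T)$, $\mathcal T_h=\{G_h(\tilde T):\tilde T\in\tilde{\mathcal T}_h\}$ and $\Omega_h=\mathrm{int}\bigcup_{T\in\mathcal T_h}\overline T$. Assume the following bounds for all $\tilde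 T$: $\tilde T$ contains a ball of radius $\rho_T>0$ with $h_T\le\sigma\rho_T$; $h_T\le h_0$; and $\|DG_h\|_{L^\infty(\tilde T)}\le\kappa$, $\|D^2G_h\|_{L^\infty(\tilde T)}\le\kappa$, $\|(DG_h)^{-1}\|_{L^\infty(\tilde T)}\le\kappa$. Spaces. Let $\hat T^{ct}$ be the split of $\hat T$ into three triangles obtained by joining its vertices to its barycenter, let $\mathcal N_{\hat T}$ be the set of its four vertices and six edge midpoints, and let $\hat{\boldsymbol V}$ be the space of continuous vector fields on $\hat T$ that are quadratic on each $\hat K\in\hat T^{ct}$. Let $$\tilde{\boldsymbol V}^h=\{\tilde{\boldsymbol v}\in \boldsymbol H^1_0(\tilde\Omega_h):\ \tilde{\boldsymbol v}\circ F_{\tilde T}\in\hat{\boldsymbol V}\ \ \forall \tilde T\in\tilde{\mathcal T}_h\}.$$ With $A_T=DF_T/\det(DF_T)$ let $\boldsymbol V(T)=\{\boldsymbol v:\ \boldsymbol v(F_T(\hat x))=A_T(\hat x)\hat{\boldsymbol v}(\hat x),\ \hat{\boldsymbol v}\in\hat{\boldsymbol V}\}$. For $\tilde{\boldsymbol v}\in\tilde{\boldsymbol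 V}^h$ let $\Psi\tilde{\boldsymbol v}$ be the field, defined elementwise, whose restriction to each $T$ is the member of $\boldsymbol V(T)$ with $(\Psi\tilde{\boldsymbol v})|_T(F_T(\hat a))=\tilde{\boldsymbol v}(F_{\tilde T}(\hat a))$ for all $\hat a\in\mathcal N_{\hat T}$, and let $\boldsymbol V^h=\Psi(\tilde{\boldsymbol V}^h)$. Claim. There is a constant $C>0$ depending only on $\sigma,\kappa,h_0$ such that, for every such triangulation, there is a linear operator $\boldsymbol E_h:\boldsymbol V^h\to\boldsymbol H^1_0(\Omega_h)$, given by the standard isoparametric quadratic Lagrange function $$(\boldsymbol E_h\boldsymbol v)|_T=\tilde{\boldsymbol v}\circ F_{\tilde T}\circ F_T^{-1}\qquad\text{for } \boldsymbol v=\Psi\tilde{\boldsymbol v},\ T\in\mathcal T_h,$$ such that for all $\boldsymbol v\in\boldsymbol V^h$ and all $T\in\mathcal T_h$ $$\|\boldsymbol v-\boldsymbol E_h\boldsymbol v\|_{L^2(T)}+h_T\|\nabla(\boldsymbol v-\boldsymbol E_h\boldsymbol v)\|_{L^2(T)}\le C\,h_T^2\,\|\nabla\boldsymbol v\|_{L^2(T)}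 .$$ -/

import Mathlib

open Set Filter Topology MeasureTheory
open scoped ENNReal ContDiff

noncomputable section

namespace IsoFEM

/-- The Euclidean plane. -/
abbrev Plane := EuclideanSpace ℝ (Fin 2)

/-! ### The space `H¹₀(U)` of vector fields -/

/-- The partial derivative in the coordinate direction `j`. -/
def partialD (j : Fin 2) (f : Plane → Plane) (x : Plane) : Plane :=
  fderiv ℝ f x (EuclideanSpace.single j 1)

/-- `u ∈ H¹₀(U)` with weak partial derivatives `g 0`, `g 1`: `u` belongs to the closure of the smooth
fields compactly supported in `U` with respect to the `H¹(U)` norm. -/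
def HasH10Grad (U : Set Plane) (u : Plane → Plane) (g : Fin 2 → Plane → Plane) : Prop :=
  MemLp u 2 (volume.restrict U) ∧ (∀ j, MemLp (g j) 2 (volume.restrict U)) ∧
  ∃ φ : ℕ → Plane → Plane,
    (∀ n, ContDiff ℝ ∞ (φ n) ∧ HasCompactSupport (φ n) ∧ tsupport (φ n) ⊆ U) ∧
    Tendsto (fun n => eLpNorm (u - φ n) 2 (volume.restrict U)) atTop (𝓝 0) ∧
    ∀ j, Tendsto (fun n => eLpNorm (g j - partialD j (φ n)) 2 (volume.restrict U)) atTop (𝓝 0)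

lemma continuous_partialD {f : Plane → Plane} (hf : ContDiff ℝ ∞ f) (j : Fin 2) :
    Continuous (partialD j f) :=
  (hf.continuous_fderiv (by simp)).clm_apply continuous_const

lemma HasH10Grad.add {U : Set Plane} {u u' : Plane → Plane} {g g' : Fin 2 → Plane → Plane}
    (h : HasH10Grad U u g) (h' : HasH10Grad U u' g') : HasH10Grad U (u + u') (g + g') := by
  obtain ⟨hu, hg, φ, hφ, h1, h2⟩ := h
  obtain ⟨hu', hg', φ', hφ', h1', h2'⟩ := h'
  have hd : ∀ n j, partialD j (φ n + φ' n) = partialD j (φ n) + partialD j (φ' n) := fun n j => by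
    ext1 x
    simp only [partialD, Pi.add_apply]
    rw [fderiv_add ((hφ n).1.differentiable (by simp) x) ((hφ' n).1.differentiable (by simp) x)]
    rfl
  refine ⟨hu.add hu', fun j => (hg j).add (hg' j), fun n => φ n + φ' n,
    fun n => ⟨(hφ n).1.add (hφ' n).1, (hφ n).2.1.add (hφ' n).2.1,
    (tsupport_add (φ n) (φ' n)).trans (union_subset (hφ n).2.2 (hφ' n).2.2)⟩, ?_, fun j => ?_⟩
  · refine tendsto_of_tendsto_of_tendsto_of_le_of_le tendsto_const_nhds
      (by simpa using h1.add h1') (fun n => zero_le) (fun n => ?_)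
    have e : u + u' - (φ n + φ' n) = (u - φ n) + (u' - φ' n) := by abel
    simp only [e]
    exact eLpNorm_add_le
      (hu.1.sub (hφ n).1.continuous.aestronglyMeasurable)
      (hu'.1.sub (hφ' n).1.continuous.aestronglyMeasurable) (by norm_num)
  · refine tendsto_of_tendsto_of_tendsto_of_le_of_le tendsto_const_nhds
      (by simpa using (h2 j).add (h2' j)) (fun n => zero_le) (fun n => ?_)
    have e : (g + g') j - partialD j (φ n + φ' n) =
        (g j - partialD j (φ n)) + (g' j - partialD j (φ' n)) := by
      rw [hd, Pi.add_apply]; abel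
    simp only [e]
    exact eLpNorm_add_le
      ((hg j).1.sub (continuous_partialD (hφ n).1 j).aestronglyMeasurable)
      ((hg' j).1.sub (continuous_partialD (hφ' n).1 j).aestronglyMeasurable) (by norm_num)

lemma HasH10Grad.smul {U : Set Plane} {u : Plane → Plane} {g : Fin 2 → Plane → Plane}
    (c : ℝ) (h : HasH10Grad U u g) : HasH10Grad U (c • u) (c • g) := by
  obtain ⟨hu, hg, φ, hφ, h1, h2⟩ := h
  have hd : ∀ n j, partialD j (c • φ n) = c • partialD j (φ n) := fun n j => by
    ext1 x
    simp only [partialD, Pi.smul_apply]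
    rw [fderiv_const_smul ((hφ n).1.differentiable (by simp) x) c]
    rfl
  have hc : ‖c‖ₑ ≠ ⊤ := by simp
  refine ⟨hu.const_smul c, fun j => (hg j).const_smul c, fun n => c • φ n,
    fun n => ⟨(hφ n).1.const_smul c,
    (hφ n).2.1.mono (Function.support_const_smul_subset c (φ n)),
    (closure_mono (Function.support_const_smul_subset c (φ n))).trans (hφ n).2.2⟩, ?_, fun j => ?_⟩
  · have e : ∀ n, eLpNorm (c • u - c • φ n) 2 (volume.restrict U) =
        ‖c‖ₑ * eLpNorm (u - φ n) 2 (volume.restrict U) := fun n => by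
      rw [← smul_sub, eLpNorm_const_smul]
    simp only [e]
    simpa using ENNReal.Tendsto.const_mul h1 (Or.inr hc)
  · have e : ∀ n, eLpNorm ((c • g) j - partialD j (c • φ n)) 2 (volume.restrict U) =
        ‖c‖ₑ * eLpNorm (g j - partialD j (φ n)) 2 (volume.restrict U) := fun n => by
      rw [hd, Pi.smul_apply, ← smul_sub, eLpNorm_const_smul]
    simp only [e]
    simpa using ENNReal.Tendsto.const_mul (h2 j) (Or.inr hc)

lemma HasH10Grad.zero (U : Set Plane) : HasH10Grad U 0 0 := by
  have hd : ∀ j, partialD j 0 = 0 := fun j => by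
    ext1 x
    simp [partialD]
  exact ⟨MemLp.zero, fun j => MemLp.zero, fun _ => 0,
    fun _ => ⟨contDiff_const, HasCompactSupport.zero, by simp [tsupport]⟩, by simp, by simp [hd]⟩

/-- The space `H¹₀(U)` of vector fields on `U` (values outside `U` are irrelevant). -/
def H10 (U : Set Plane) : Submodule ℝ (Plane → Plane) where
  carrier := {u | ∃ g, HasH10Grad U u g}
  add_mem' := by
    rintro u u' ⟨g, hg⟩ ⟨g', hg'⟩
    exact ⟨_, hg.add hg'⟩
  zero_mem' := ⟨0, HasH10Grad.zero U⟩
  smul_mem' := by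
    rintro c u ⟨g, hg⟩
    exact ⟨_, hg.smul c⟩

/-! ### The reference triangle and its Clough–Tocher split -/

/-- The vertices `(1,0)`, `(0,1)`, `(0,0)` of the reference triangle. -/
def refVertex : Fin 3 → Plane := ![!₂[1, 0], !₂[0, 1], !₂[0, 0]]

/-- The barycentric coordinates with respect to `refVertex`. -/
def bary (x : Plane) : Fin 3 → ℝ := ![x 0, x 1, 1 - x 0 - x 1]

/-- The (closed) reference triangle. -/
def refTri : Set Plane := convexHull ℝ (range refVertex)

/-- The four vertices of the Clough–Tocher split: the barycentre and the three vertices. -/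
def ctVertex : Fin 4 → Plane := Fin.cons !₂[1 / 3, 1 / 3] refVertex

/-- The (closed) subtriangle of the Clough–Tocher split opposite to the vertex `k`. -/
def refSub (k : Fin 3) : Set Plane :=
  convexHull ℝ {refVertex (k + 1), refVertex (k + 2), ctVertex 0}

/-- The ten Lagrange nodes of the split: its four vertices and its six edge midpoints (any two of
the four vertices are joined by an edge). -/
def refNodes : Set Plane :=
  range ctVertex ∪ {x | ∃ a b : Fin 4, a ≠ b ∧ x = midpoint ℝ (ctVertex a) (ctVertex b)}

/-- `v` is given on `S` by a vector of polynomials of degree at most two. -/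
def IsQuadraticOn (v : Plane → Plane) (S : Set Plane) : Prop :=
  ∃ p : Fin 2 → MvPolynomial (Fin 2) ℝ, (∀ c, (p c).totalDegree ≤ 2) ∧
    ∀ x ∈ S, ∀ c, v x c = MvPolynomial.eval (fun j => x j) (p c)

lemma IsQuadraticOn.add {v w : Plane → Plane} {S : Set Plane} (hv : IsQuadraticOn v S)
    (hw : IsQuadraticOn w S) : IsQuadraticOn (v + w) S := by
  obtain ⟨p, hp, h⟩ := hv
  obtain ⟨q, hq, h'⟩ := hw
  exact ⟨p + q, fun c => (MvPolynomial.totalDegree_add _ _).trans (max_le (hp c) (hq c)),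
    fun x hx c => by simp [h x hx c, h' x hx c]⟩

lemma IsQuadraticOn.smul {v : Plane → Plane} {S : Set Plane} (r : ℝ) (hv : IsQuadraticOn v S) :
    IsQuadraticOn (r • v) S := by
  obtain ⟨p, hp, h⟩ := hv
  exact ⟨fun c => r • p c, fun c => (MvPolynomial.totalDegree_smul_le _ _).trans (hp c),
    fun x hx c => by simp [h x hx c]⟩

/-- The reference space `V̂`: continuous fields on the closed reference triangle that are quadratic
on each subtriangle of the split; these are the continuous representatives of the `H¹` fields that
are piecewise quadratic. -/
def Vhat : Submodule ℝ (Plane → Plane) where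
  carrier := {v | ContinuousOn v refTri ∧ ∀ k, IsQuadraticOn v (refSub k)}
  add_mem' := fun ha hb => ⟨ha.1.add hb.1, fun k => (ha.2 k).add (hb.2 k)⟩
  zero_mem' := ⟨continuousOn_const, fun _ => ⟨0, by simp, by simp⟩⟩
  smul_mem' := fun c _ ha => ⟨ha.1.const_smul c, fun k => (ha.2 k).smul c⟩

/-- The quadratic Lagrange interpolant on the (unsplit) reference triangle, determined by the values
at the three vertices and at the three edge midpoints. -/
def quadInterp (g : Plane → Plane) (x : Plane) : Plane :=
  ∑ k : Fin 3, ((bary x k * (2 * bary x k - 1)) • g (refVertex k) +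
    (4 * bary x (k + 1) * bary x (k + 2)) •
      g (midpoint ℝ (refVertex (k + 1)) (refVertex (k + 2))))

/-! ### Affine triangulations -/

/-- A conforming affine triangulation with `N` triangles. -/
structure AffineMesh (N : ℕ) where
  /-- the ordered vertices of the triangles -/
  vert : Fin N → Fin 3 → Plane
  nondegenerate : ∀ i, AffineIndependent ℝ (vert i)
  distinct : ∀ i j, i ≠ j → range (vert i) ≠ range (vert j)
  /-- two triangles meet in the empty set, a common vertex or a common edge -/
  conforming : ∀ i j, i ≠ j → convexHull ℝ (range (vert i)) ∩ convexHull ℝ (range (vert j)) =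
    convexHull ℝ (range (vert i) ∩ range (vert j))

namespace AffineMesh

variable {N : ℕ} (M : AffineMesh N)

/-- The closed affine triangle `T̃`. -/
def tri (i : Fin N) : Set Plane := convexHull ℝ (range (M.vert i))

/-- `h_T = diam T̃`. -/
def diam (i : Fin N) : ℝ := Metric.diam (M.tri i)

/-- The polygonal domain `Ω̃_h`. -/
def domain : Set Plane := interior (⋃ i, M.tri i)

/-- The affine map `F_T̃` from the reference triangle onto `T̃`. -/
def map (i : Fin N) (x : Plane) : Plane := ∑ k, bary x k • M.vert i k

/-- `F_T`, the quadratic interpolant of `G ∘ F_T̃` on the reference triangle. -/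
def isoMap (G : Plane → Plane) (i : Fin N) : Plane → Plane := quadInterp (G ∘ M.map i)

/-- The global space `Ṽ^h` on the affine triangulation. -/
def Vtilde : Submodule ℝ (Plane → Plane) where
  carrier := {v | v ∈ H10 M.domain ∧ ∀ i, v ∘ M.map i ∈ Vhat}
  add_mem' := fun ha hb => ⟨add_mem ha.1 hb.1, fun i => Vhat.add_mem (ha.2 i) (hb.2 i)⟩
  zero_mem' := ⟨zero_mem _, fun _ => Vhat.zero_mem⟩
  smul_mem' := fun c _ ha =>
    ⟨Submodule.smul_mem _ c ha.1, fun i => Vhat.smul_mem c (ha.2 i)⟩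

end AffineMesh

/-! ### Isoparametric triangulations -/

/-- An isoparametric triangulation: an affine triangulation of the polygonal domain together with the
map `G` from it to the curved domain, whose piecewise quadratic nodal interpolant `G_h` defines the
curved elements `T = G_h(T̃)`. The curved domain enters only through the nodal values of `G`. -/
structure IsoMesh (N : ℕ) extends AffineMesh N where
  G : Plane → Plane
  /-- `G` fixes the vertices of the triangulation -/
  G_vert : ∀ i k, G (vert i k) = vert i k
  /-- `G_h` is the identity on the interior edges (those shared by two triangles), that is, interior
  edges are straight; boundary edges may be curved -/
  G_edge : ∀ i j, i ≠ j → ∀ a ∈ range (vert i) ∩ range (vert j),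
    ∀ b ∈ range (vert i) ∩ range (vert j), G (midpoint ℝ a b) = midpoint ℝ a b
  /-- each triangle has at most two vertices on the boundary -/
  exists_interior_vert : ∀ i, ∃ k, vert i k ∉ frontier toAffineMesh.domain
  /-- the mappings `F_T` are orientation preserving local diffeomorphisms -/
  det_pos : ∀ i, ∀ x ∈ refTri, 0 < (fderiv ℝ (toAffineMesh.isoMap G i) x).det
  /-- `G_h` is injective on the closure of the polygonal domain -/
  injective : ∀ i j, ∀ x ∈ refTri, ∀ y ∈ refTri,
    toAffineMesh.isoMap G i x = toAffineMesh.isoMap G j y →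
      toAffineMesh.map i x = toAffineMesh.map j y

namespace IsoMesh

variable {N : ℕ} (M : IsoMesh N)

/-- The quadratic diffeomorphism `F_T = G_h ∘ F_T̃`. -/
def F (i : Fin N) : Plane → Plane := M.isoMap M.G i

/-- The restriction to `T̃` of the piecewise quadratic interpolant `G_h` of `G`
(as a polynomial map on the plane). -/
def Gh (i : Fin N) : Plane → Plane := M.F i ∘ Function.invFun (M.map i)

/-- The closed curved element `T = G_h(T̃) = F_T(T̂)`. -/
def elem (i : Fin N) : Set Plane := M.F i '' refTri

/-- The computational domain `Ω_h`. -/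
def compDomain : Set Plane := interior (⋃ i, M.elem i)

/-- The matrix `A_T = DF_T / det DF_T` of the Piola transform. -/
def A (i : Fin N) (x : Plane) : Plane →L[ℝ] Plane :=
  (fderiv ℝ (M.F i) x).det⁻¹ • fderiv ℝ (M.F i) x

/-- The local space `V(T)`: Piola transforms of fields in `V̂`, as fields on the closed element. -/
def localV (i : Fin N) : Submodule ℝ (Plane → Plane) where
  carrier := {v | ∃ w ∈ Vhat, ∀ x ∈ refTri, v (M.F i x) = M.A i x (w x)}
  add_mem' := by
    rintro v v' ⟨w, hw, h⟩ ⟨w', hw', h'⟩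
    exact ⟨w + w', Vhat.add_mem hw hw', fun x hx => by simp [h x hx, h' x hx]⟩
  zero_mem' := ⟨0, Vhat.zero_mem, fun x _ => by simp⟩
  smul_mem' := by
    rintro c v ⟨w, hw, h⟩
    exact ⟨c • w, Vhat.smul_mem c hw, fun x hx => by simp [h x hx]⟩

/-- `v = Ψ ṽ`: on the interior of each `T`, `v` coincides with the member of `V(T)` that takes at the
ten nodes `a = F_T(â)` of `T` the values of `ṽ` at the nodes `ã = F_T̃(â)` of `T̃`.
Fields `v` of this kind may jump across element boundaries, where their values are irrelevant. -/
def IsPsi (vt v : Plane → Plane) : Prop :=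
  ∀ i, ∃ w ∈ M.localV i, (∀ a ∈ refNodes, w (M.F i a) = vt (M.map i a)) ∧
    EqOn v w (M.F i '' interior refTri)

/-- The global space `V^h = Ψ(Ṽ^h)`. -/
def Vh : Submodule ℝ (Plane → Plane) where
  carrier := {v | ∃ vt ∈ M.Vtilde, M.IsPsi vt v}
  add_mem' := by
    rintro v v' ⟨vt, hvt, h⟩ ⟨vt', hvt', h'⟩
    refine ⟨vt + vt', add_mem hvt hvt', fun i => ?_⟩
    obtain ⟨w, hw, hn, he⟩ := h i
    obtain ⟨w', hw', hn', he'⟩ := h' i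
    exact ⟨w + w', add_mem hw hw', fun a ha => by simp [hn a ha, hn' a ha],
      fun x hx => by simp [he hx, he' hx]⟩
  zero_mem' := ⟨0, zero_mem _, fun i => ⟨0, zero_mem _, fun a _ => by simp, fun x _ => by simp⟩⟩
  smul_mem' := by
    rintro c v ⟨vt, hvt, h⟩
    refine ⟨c • vt, Submodule.smul_mem _ c hvt, fun i => ?_⟩
    obtain ⟨w, hw, hn, he⟩ := h i
    exact ⟨c • w, Submodule.smul_mem _ c hw, fun a ha => by simp [hn a ha],
      fun x hx => by simp [he hx]⟩

/-- The mesh-independent bounds: shape regularity with constant `σ`, mesh size at most `h₀`, and the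
bounds on `DG_h`, its derivative and its inverse on each `T̃` with constant `κ`. -/
structure Regular (σ κ h₀ : ℝ) : Prop where
  shape : ∀ i, ∃ c, ∃ ρ : ℝ, 0 < ρ ∧ Metric.ball c ρ ⊆ M.tri i ∧ M.diam i ≤ σ * ρ
  size : ∀ i, M.diam i ≤ h₀
  deriv_le : ∀ i, ∀ x ∈ M.tri i, ‖fderiv ℝ (M.Gh i) x‖ ≤ κ
  deriv_two_le : ∀ i, ∀ x ∈ M.tri i, ‖fderiv ℝ (fderiv ℝ (M.Gh i)) x‖ ≤ κ
  deriv_inv_le : ∀ i, ∀ x ∈ M.tri i, ‖(fderiv ℝ (M.Gh i) x).inverse‖ ≤ κ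

/-- `‖f‖_{L²(T)}`. -/
def normL2 (i : Fin N) (f : Plane → Plane) : ℝ≥0∞ :=
  eLpNorm f 2 (volume.restrict (M.elem i))

/-- `‖∇f‖_{L²(T)}` for fields `f` that are differentiable almost everywhere on `T`, with the operator
norm of the Jacobian matrix. -/
def gradNormL2 (i : Fin N) (f : Plane → Plane) : ℝ≥0∞ :=
  eLpNorm (fun x => ‖fderiv ℝ f x‖) 2 (volume.restrict (M.elem i))

end IsoMesh

end IsoFEM

end

open Set Filter Topology MeasureTheory
open scoped ENNReal ContDiff

noncomputable section

namespace IsoFEM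

/-! ### Polynomial functions on the plane -/

/-! Two facts are needed: the error bound on each element, and membership of the transported field
`push vt`, that is ṽ ∘ G_h⁻¹, in H¹₀(Ω_h).

Error bound. On a subtriangle of the split, pull everything back by F_T. Then v becomes B w, with w
quadratic, B = M / det M and M = DF_T / h_T, while E_h v becomes a quadratic q equal to B w at the
Lagrange nodes. The error is thus the interpolation error of B w, which would vanish for constant B.
Now B is nearly constant: M has affine entries, M and 1 / det M are bounded in terms of σ and κ, and
|DM| ≤ 4 κ h_T. To obtain a bound by the gradient of v and not by v itself, a constant must be
removed first. With c the value of B w at the barycentre z, the field adj(M) c is again polynomial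
of degree at most two and B adj(M) c = c, so B w - c = B w' with w' quadratic. An inverse estimate
bounds the supremum of ∇(B w), hence that of w', by the L² norm of ∇(B w). Freezing B at z in B w'
costs a factor of order h_T, the field c + B(z) w' is quadratic, and its distance to q is read off
at the nodes (`exists_local_estimate`). The inverse estimate is uniform in M because the derivatives
of B w, multiplied by (det M)², are polynomials of fixed degree (`exists_piola_inverse_estimate`).
The L² norm of a gradient is scale invariant in the plane, so transforming back gives the asserted
powers of h_T (`exists_element_estimate`).

Membership in H¹₀. The map G_h sends Ω̃_h into Ω_h (`F_mem_compDomain`), and its inverse is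
Lipschitz on every closed element. Hence a smooth field with compact support in Ω̃_h is transported
to a Lipschitz field with compact support in Ω_h (`push_lipschitz`), which mollification
approximates by smooth ones (`exists_smooth_approx`). Since transport is bounded in H¹, limits are
preserved (`push_mem_H10`).

Finally ṽ is determined on the elements by v (`IsPsi.unique`), which makes E_h well defined and
linear. -/

/-- Evaluation of polynomials in two variables as functions on the plane. -/
def evalPlane : MvPolynomial (Fin 2) ℝ →ₗ[ℝ] (Plane → ℝ) where
  toFun p x := MvPolynomial.eval (fun j => x j) p
  map_add' p q := by ext x; simp
  map_smul' c p := by ext x; simp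

/-- The polynomial functions of total degree at most `n`. -/
def polyFun (n : ℕ) : Submodule ℝ (Plane → ℝ) :=
  (MvPolynomial.restrictTotalDegree (Fin 2) ℝ n).map evalPlane

lemma mem_polyFun {n : ℕ} {f : Plane → ℝ} : f ∈ polyFun n ↔
    ∃ p : MvPolynomial (Fin 2) ℝ, p.totalDegree ≤ n ∧
      ∀ x : Plane, f x = MvPolynomial.eval (fun j => x j) p := by
  simp only [polyFun, Submodule.mem_map, MvPolynomial.mem_restrictTotalDegree]
  constructor
  · rintro ⟨p, hp, rfl⟩
    exact ⟨p, hp, fun _ => rfl⟩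
  · rintro ⟨p, hp, h⟩
    exact ⟨p, hp, by ext x; exact (h x).symm⟩

instance (n : ℕ) : FiniteDimensional ℝ (polyFun n) := by
  unfold polyFun; infer_instance

lemma polyFun_mono {m n : ℕ} (h : m ≤ n) : polyFun m ≤ polyFun n := by
  intro f hf
  obtain ⟨p, hp, hf⟩ := mem_polyFun.1 hf
  exact mem_polyFun.2 ⟨p, hp.trans h, hf⟩

lemma polyFun_const (n : ℕ) (c : ℝ) : (fun _ => c) ∈ polyFun n :=
  mem_polyFun.2 ⟨MvPolynomial.C c, by simp, by simp⟩

lemma polyFun_coord (j : Fin 2) : (fun x : Plane => x j) ∈ polyFun 1 :=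
  mem_polyFun.2 ⟨MvPolynomial.X j, by simp, by simp⟩

lemma polyFun_mul {m n : ℕ} {f g : Plane → ℝ} (hf : f ∈ polyFun m) (hg : g ∈ polyFun n) :
    (fun x => f x * g x) ∈ polyFun (m + n) := by
  obtain ⟨p, hp, hf⟩ := mem_polyFun.1 hf
  obtain ⟨q, hq, hg⟩ := mem_polyFun.1 hg
  exact mem_polyFun.2 ⟨p * q, (MvPolynomial.totalDegree_mul _ _).trans (by omega),
    fun x => by simp [hf x, hg x]⟩

lemma polyFun_add {n : ℕ} {f g : Plane → ℝ} (hf : f ∈ polyFun n) (hg : g ∈ polyFun n) :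
    (fun x => f x + g x) ∈ polyFun n := (polyFun n).add_mem hf hg

lemma polyFun_sub {n : ℕ} {f g : Plane → ℝ} (hf : f ∈ polyFun n) (hg : g ∈ polyFun n) :
    (fun x => f x - g x) ∈ polyFun n := (polyFun n).sub_mem hf hg

lemma polyFun_const_mul {n : ℕ} {f : Plane → ℝ} (c : ℝ) (hf : f ∈ polyFun n) :
    (fun x => c * f x) ∈ polyFun n := (polyFun n).smul_mem c hf

/-- Induction principle: a property closed under linear combinations need only be checked on
monomials. Smoothness, the degree of derivatives and the Lagrange formula are all proved this way.
-/
lemma polyFun_le {n : ℕ} {S : Submodule ℝ (Plane → ℝ)}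
    (h : ∀ a b : ℕ, a + b ≤ n → (fun x : Plane => x 0 ^ a * x 1 ^ b) ∈ S) : polyFun n ≤ S := by
  intro f hf
  obtain ⟨p, hp, hf⟩ := mem_polyFun.1 hf
  have e : f = ∑ d ∈ p.support, p.coeff d • fun x : Plane => x 0 ^ d 0 * x 1 ^ d 1 := by
    ext x
    rw [hf x, MvPolynomial.eval_eq]
    simp only [Finset.sum_apply, Pi.smul_apply, smul_eq_mul]
    refine Finset.sum_congr rfl fun d _ => ?_
    rw [Finset.prod_subset (Finset.subset_univ d.support), Fin.prod_univ_two]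
    intro j _ hj
    simp [Finsupp.notMem_support_iff.1 hj]
  rw [e]
  refine S.sum_mem fun d hd => S.smul_mem _ (h _ _ ?_)
  have := MvPolynomial.le_totalDegree hd
  rw [Finsupp.sum_fintype _ _ (by simp), Fin.sum_univ_two] at this
  omega

lemma contDiff_coord (j : Fin 2) {n : WithTop ℕ∞} : ContDiff ℝ n (fun x : Plane => x j) :=
  (EuclideanSpace.proj (𝕜 := ℝ) j).contDiff

lemma contDiff_of_mem_polyFun {n : ℕ} {f : Plane → ℝ} (hf : f ∈ polyFun n) {m : WithTop ℕ∞} :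
    ContDiff ℝ m f := by
  let S : Submodule ℝ (Plane → ℝ) :=
    { carrier := {f | ContDiff ℝ m f}
      add_mem' := fun h h' => ContDiff.add h h'
      zero_mem' := contDiff_const
      smul_mem' := fun c _ h => ContDiff.const_smul c h }
  exact (polyFun_le (S := S) fun a b _ =>
    ((contDiff_coord 0).pow a).mul ((contDiff_coord 1).pow b)) hf

lemma hasFDerivAt_coord (j : Fin 2) (x : Plane) :
    HasFDerivAt (fun x : Plane => x j) (EuclideanSpace.proj (𝕜 := ℝ) j) x :=
  (EuclideanSpace.proj (𝕜 := ℝ) j).hasFDerivAt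

lemma polyFun_monomial {a b n : ℕ} (h : a + b ≤ n) :
    (fun x : Plane => x 0 ^ a * x 1 ^ b) ∈ polyFun n := by
  refine mem_polyFun.2 ⟨MvPolynomial.X 0 ^ a * MvPolynomial.X 1 ^ b, ?_, by simp⟩
  refine (MvPolynomial.totalDegree_mul _ _).trans (le_trans (add_le_add ?_ ?_) h) <;>
  exact (MvPolynomial.totalDegree_pow _ _).trans (by simp)

/-- The drop of the degree is what makes the entries of DF_T affine. Elsewhere the weaker
`polyFun_deriv` is enough. -/
lemma polyFun_deriv_pred {n : ℕ} {f : Plane → ℝ} (hf : f ∈ polyFun n) (v : Plane) :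
    (fun x => fderiv ℝ f x v) ∈ polyFun (n - 1) := by
  let S : Submodule ℝ (Plane → ℝ) :=
    { carrier := {f | Differentiable ℝ f ∧ (fun x => fderiv ℝ f x v) ∈ polyFun (n - 1)}
      add_mem' := by
        rintro f g ⟨hf, hf'⟩ ⟨hg, hg'⟩
        refine ⟨hf.add hg, ?_⟩
        convert polyFun_add hf' hg' using 2 with x
        rw [fderiv_add (hf x) (hg x)]; rfl
      zero_mem' := ⟨differentiable_const _, by simpa using polyFun_const (n - 1) 0⟩
      smul_mem' := by
        rintro c f ⟨hf, hf'⟩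
        refine ⟨hf.const_smul c, ?_⟩
        convert polyFun_const_mul c hf' using 2 with x
        rw [fderiv_const_smul (hf x)]; rfl }
  refine ((polyFun_le (S := S) fun a b hab => ⟨?_, ?_⟩) hf).2
  · exact (((contDiff_coord 0 (n := 1)).pow a).mul ((contDiff_coord 1).pow b)).differentiable
      (by simp)
  · have : (fun x : Plane => fderiv ℝ (fun x : Plane => x 0 ^ a * x 1 ^ b) x v) =
        fun x : Plane => (a * v 0) * (x 0 ^ (a - 1) * x 1 ^ b) +
          (b * v 1) * (x 0 ^ a * x 1 ^ (b - 1)) := by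
      ext x
      have := ((hasFDerivAt_coord 0 x).pow a).mul ((hasFDerivAt_coord 1 x).pow b)
      have e : ((fun x : Plane => x 0 ^ a) * fun x : Plane => x 1 ^ b) =
        fun x : Plane => x 0 ^ a * x 1 ^ b := rfl
      rw [e] at this
      rw [this.fderiv]
      simp
      ring
    rw [this]
    refine polyFun_add ?_ ?_
    · rcases Nat.eq_zero_or_pos a with rfl | ha
      · simpa using polyFun_const (n - 1) 0
      · exact polyFun_const_mul _ (polyFun_monomial (by omega))
    · rcases Nat.eq_zero_or_pos b with rfl | hb
      · simpa using polyFun_const (n - 1) 0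
      · exact polyFun_const_mul _ (polyFun_monomial (by omega))

lemma polyFun_deriv {n : ℕ} {f : Plane → ℝ} (hf : f ∈ polyFun n) (v : Plane) :
    (fun x => fderiv ℝ f x v) ∈ polyFun n :=
  polyFun_mono (Nat.sub_le n 1) (polyFun_deriv_pred hf v)

lemma eq_zero_of_mem_polyFun {n : ℕ} {f : Plane → ℝ} (hf : f ∈ polyFun n) {U : Set Plane}
    (hU : IsOpen U) (hne : U.Nonempty) (h : ∀ x ∈ U, f x = 0) : f = 0 := by
  obtain ⟨p, -, hp⟩ := mem_polyFun.1 hf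
  obtain ⟨a, ha⟩ := hne
  have hU' : IsOpen ((fun y : Fin 2 → ℝ => (WithLp.toLp 2 y : Plane)) ⁻¹' U) :=
    hU.preimage (PiLp.continuous_toLp 2 _)
  obtain ⟨s, hs, hsU⟩ := Metric.isOpen_iff.1 hU' (WithLp.ofLp a) (by simpa using ha)
  have : p = 0 := by
    -- The open set contains a box, a product of infinite sets, and a polynomial vanishing on such a
    -- product is zero.
    refine MvPolynomial.funext_set (fun i => Metric.ball (a i) s) (fun i => ?_) fun x hx => ?_
    · rw [Real.ball_eq_Ioo]; exact Ioo_infinite (by linarith)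
    · have := h _ (hsU (a := x) ?_)
      · rw [hp] at this
        simpa using this
      · rw [ball_pi _ hs]; exact hx
  ext x
  simp [hp, this]

/-- A linear map on a finite-dimensional space is controlled by any linear map with a smaller
kernel. -/
lemma exists_bound_of_ker_le {V W W' : Type*} [AddCommGroup V] [Module ℝ V]
    [FiniteDimensional ℝ V] [NormedAddCommGroup W] [NormedSpace ℝ W] [NormedAddCommGroup W']
    [NormedSpace ℝ W'] (S : V →ₗ[ℝ] W) (T : V →ₗ[ℝ] W') (hS : Function.Injective S) :
    ∃ C : ℝ, 0 ≤ C ∧ ∀ p, ‖T p‖ ≤ C * ‖S p‖ := by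
  let e := LinearEquiv.ofInjective S hS
  have : FiniteDimensional ℝ (LinearMap.range S) := inferInstance
  let R := LinearMap.toContinuousLinearMap (T ∘ₗ e.symm.toLinearMap)
  refine ⟨‖R‖, norm_nonneg R, fun p => ?_⟩
  have h := R.le_opNorm (e p)
  have h1 : R (e p) = T p := by simp [R]
  have h2 : ‖e p‖ = ‖S p‖ := rfl
  rwa [h1, h2] at h

/-! ### The reference triangle and its split -/

lemma mem_convexHull_range_fin_three {E : Type*} [AddCommGroup E] [Module ℝ E] {v : Fin 3 → E}
    {x : E} : x ∈ convexHull ℝ (range v) ↔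
      ∃ w : Fin 3 → ℝ, (∀ k, 0 ≤ w k) ∧ ∑ k, w k = 1 ∧ ∑ k, w k • v k = x := by
  constructor
  · intro hx
    have hconv : Convex ℝ {x | ∃ w : Fin 3 → ℝ, (∀ k, 0 ≤ w k) ∧ ∑ k, w k = 1 ∧
        ∑ k, w k • v k = x} := by
      rintro _ ⟨w, hw, hs, rfl⟩ _ ⟨w', hw', hs', rfl⟩ a b ha hb hab
      refine ⟨fun k => a * w k + b * w' k, fun k => by have := hw k; have := hw' k; positivity,
        ?_, ?_⟩
      · rw [Finset.sum_add_distrib, ← Finset.mul_sum, ← Finset.mul_sum, hs, hs']; linarith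
      · simp only [Finset.smul_sum, add_smul, Finset.sum_add_distrib, mul_smul]
    refine convexHull_min ?_ hconv hx
    rintro _ ⟨k, rfl⟩
    exact ⟨Pi.single k 1, fun j => by by_cases h : j = k <;> simp [h],
      by simp, by simp [Pi.single_apply]⟩
  · rintro ⟨w, hw, hs, rfl⟩
    exact (convex_convexHull ℝ _).sum_mem (fun k _ => hw k) hs
      fun k _ => subset_convexHull ℝ _ (mem_range_self k)

lemma sum_bary (x : Plane) : ∑ k, bary x k = 1 := by
  simp [Fin.sum_univ_three, bary]

lemma sum_bary_cyc (x : Plane) (k : Fin 3) : bary x k + bary x (k + 1) + bary x (k + 2) = 1 := by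
  fin_cases k <;> simp [bary] <;> ring

lemma sum_bary_smul (x : Plane) : ∑ k, bary x k • refVertex k = x := by
  ext j
  fin_cases j <;> simp [Fin.sum_univ_three, bary, refVertex]

lemma bary_sum {w : Fin 3 → ℝ} (hw : ∑ k, w k = 1) : bary (∑ k, w k • refVertex k) = w := by
  rw [Fin.sum_univ_three] at hw
  ext k
  fin_cases k <;> simp [Fin.sum_univ_three, bary, refVertex]
  linarith

lemma mem_refTri {x : Plane} : x ∈ refTri ↔ ∀ k, 0 ≤ bary x k := by
  rw [refTri, mem_convexHull_range_fin_three]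
  constructor
  · rintro ⟨w, hw, hs, rfl⟩ k
    rw [bary_sum hs]; exact hw k
  · exact fun h => ⟨bary x, h, sum_bary x, sum_bary_smul x⟩

lemma continuous_bary (k : Fin 3) : Continuous fun x => bary x k := by
  fin_cases k <;> simp only [bary, Matrix.cons_val_zero, Fin.zero_eta, Fin.mk_one,
    Matrix.cons_val_one, Fin.reduceFinMk, Matrix.cons_val] <;> fun_prop

lemma bary_mem_polyFun (k : Fin 3) : (fun x => bary x k) ∈ polyFun 1 := by
  fin_cases k
  · exact polyFun_coord 0
  · exact polyFun_coord 1
  · exact polyFun_sub (polyFun_sub (polyFun_const 1 1) (polyFun_coord 0)) (polyFun_coord 1)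

lemma bary_lineMap (x y : Plane) (t : ℝ) (k : Fin 3) :
    bary (AffineMap.lineMap x y t) k = bary x k + t * (bary y k - bary x k) := by
  fin_cases k <;> simp [bary, AffineMap.lineMap_apply] <;> ring

lemma bary_le_one {x : Plane} (hx : x ∈ refTri) (k : Fin 3) : bary x k ≤ 1 := by
  have h := mem_refTri.1 hx
  have := sum_bary_cyc x k
  linarith [h (k + 1), h (k + 2)]

lemma bary_refVertex (k j : Fin 3) : bary (refVertex k) j = if j = k then 1 else 0 := by
  fin_cases k <;> fin_cases j <;> simp [bary, refVertex]

lemma bary_ctVertex_zero (j : Fin 3) : bary (ctVertex 0) j = 1 / 3 := by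
  fin_cases j <;> norm_num [bary, ctVertex]

lemma refVertex_mem_refTri (k : Fin 3) : refVertex k ∈ refTri :=
  subset_convexHull ℝ _ (mem_range_self k)

lemma ctVertex_zero_mem_refTri : ctVertex 0 ∈ refTri :=
  mem_refTri.2 fun k => by rw [bary_ctVertex_zero]; norm_num

lemma convex_refTri : Convex ℝ refTri := convex_convexHull ℝ _

lemma isCompact_refTri : IsCompact refTri := (finite_range _).isCompact_convexHull ℝ

lemma isOpen_bary_pos : IsOpen {x : Plane | ∀ k, 0 < bary x k} := by
  simp only [ofPred_forall]
  exact isOpen_iInter_of_finite fun k => isOpen_lt continuous_const (continuous_bary k)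

lemma mem_interior_refTri_of_pos {x : Plane} (h : ∀ k, 0 < bary x k) : x ∈ interior refTri :=
  mem_interior.2 ⟨_, fun _ hy => mem_refTri.2 fun k => (hy k).le, isOpen_bary_pos, h⟩

lemma interior_refTri_nonempty : (interior refTri).Nonempty :=
  ⟨ctVertex 0, mem_interior_refTri_of_pos fun k => by rw [bary_ctVertex_zero]; norm_num⟩

lemma norm_le_of_coord {x : Plane} {a : ℝ} (ha : ∀ j, |x j| ≤ a) : ‖x‖ ≤ 2 * a := by
  have h0 : 0 ≤ a := (abs_nonneg _).trans (ha 0)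
  rw [EuclideanSpace.norm_eq, Fin.sum_univ_two]
  apply Real.sqrt_le_iff.2 ⟨by linarith, ?_⟩
  have h1 := pow_le_pow_left₀ (abs_nonneg _) (ha 0) 2
  have h2 := pow_le_pow_left₀ (abs_nonneg _) (ha 1) 2
  simp only [Real.norm_eq_abs]
  nlinarith

lemma abs_coord_le_norm (x : Plane) (j : Fin 2) : |x j| ≤ ‖x‖ := by
  simpa using PiLp.norm_apply_le x j

lemma norm_sub_le_two {x y : Plane} (hx : x ∈ refTri) (hy : y ∈ refTri) : ‖x - y‖ ≤ 2 := by
  have hx' := mem_refTri.1 hx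
  have hy' := mem_refTri.1 hy
  have e : ∀ j, |(x - y) j| ≤ 1 := by
    have h1 : ∀ k, |bary x k - bary y k| ≤ 1 := fun k => abs_le.2
      ⟨by linarith [hx' k, bary_le_one hy k], by linarith [hy' k, bary_le_one hx k]⟩
    intro j
    fin_cases j
    · exact h1 0
    · exact h1 1
  simpa using norm_le_of_coord e

/-- The subtriangle opposite to vertex k is where the k-th barycentric coordinate is the smallest.
With b the coordinates in the large triangle, those in the subtriangle are b (k+1) - b k, b (k+2) -
b k and 3 * b k. -/
lemma mem_refSub {k : Fin 3} {x : Plane} : x ∈ refSub k ↔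
    0 ≤ bary x k ∧ bary x k ≤ bary x (k + 1) ∧ bary x k ≤ bary x (k + 2) := by
  have hr : ({refVertex (k + 1), refVertex (k + 2), ctVertex 0} : Set Plane) =
      range ![refVertex (k + 1), refVertex (k + 2), ctVertex 0] := by
    simp only [Matrix.range_cons, Matrix.range_empty, union_empty, singleton_union]
  rw [refSub, hr, mem_convexHull_range_fin_three]
  constructor
  · rintro ⟨w, hw, hs, rfl⟩
    have h0 := hw 0; have h1 := hw 1; have h2 := hw 2
    rw [Fin.sum_univ_three] at hs
    fin_cases k <;> simp [Fin.sum_univ_three, bary, refVertex, ctVertex] <;>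
      refine ⟨?_, ?_, ?_⟩ <;> linarith
  · rintro ⟨h0, h1, h2⟩
    have hs := sum_bary_cyc x k
    refine ⟨![bary x (k + 1) - bary x k, bary x (k + 2) - bary x k, 3 * bary x k],
      fun j => ?_, ?_, ?_⟩
    · fin_cases j <;> simp <;> linarith
    · simp [Fin.sum_univ_three]; linarith
    · ext j
      fin_cases k <;> fin_cases j <;>
        simp [Fin.sum_univ_three, bary, refVertex, ctVertex] <;> ring

lemma fin_three_cases (j k : Fin 3) : j = k ∨ j = k + 1 ∨ j = k + 2 := by
  revert j k; decide

lemma refSub_subset (k : Fin 3) : refSub k ⊆ refTri := by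
  intro x hx
  obtain ⟨h0, h1, h2⟩ := mem_refSub.1 hx
  rw [mem_refTri]
  intro j
  rcases fin_three_cases j k with rfl | rfl | rfl <;> linarith

lemma iUnion_refSub : ⋃ k, refSub k = refTri := by
  refine subset_antisymm (iUnion_subset refSub_subset) fun x hx => ?_
  obtain ⟨k, -, hk⟩ := Finset.exists_min_image Finset.univ (bary x) ⟨0, Finset.mem_univ _⟩
  exact mem_iUnion.2 ⟨k, mem_refSub.2 ⟨mem_refTri.1 hx k, hk _ (Finset.mem_univ _),
    hk _ (Finset.mem_univ _)⟩⟩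

lemma convex_refSub (k : Fin 3) : Convex ℝ (refSub k) := convex_convexHull ℝ _

lemma isCompact_refSub (k : Fin 3) : IsCompact (refSub k) :=
  (Set.toFinite _).isCompact_convexHull ℝ

lemma ctVertex_zero_mem_refSub (k : Fin 3) : ctVertex 0 ∈ refSub k :=
  subset_convexHull ℝ _ (by simp)

lemma interior_refSub_nonempty (k : Fin 3) : (interior (refSub k)).Nonempty := by
  -- Any point whose k-th coordinate is positive and strictly smallest will do.
  let z : Plane := ∑ j, (if j = k then (1 / 5 : ℝ) else 2 / 5) • refVertex j
  have hz : bary z = fun j => if j = k then (1 / 5 : ℝ) else 2 / 5 :=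
    bary_sum (by fin_cases k <;> simp [Fin.sum_univ_three] <;> norm_num)
  refine ⟨z, mem_interior.2 ⟨{x | 0 < bary x k ∧ bary x k < bary x (k + 1) ∧
    bary x k < bary x (k + 2)}, fun x hx => mem_refSub.2 ⟨hx.1.le, hx.2.1.le, hx.2.2.le⟩, ?_, ?_⟩⟩
  · exact (isOpen_lt continuous_const (continuous_bary _)).inter
      ((isOpen_lt (continuous_bary _) (continuous_bary _)).inter
        (isOpen_lt (continuous_bary _) (continuous_bary _)))
  · simp only [mem_ofPred_eq, hz]
    fin_cases k <;> simp <;> norm_num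

/-- The reference triangle is covered by the interiors of the subtriangles up to a null set. -/
lemma volume_refTri_diff : volume (refTri \ ⋃ k, interior (refSub k)) = 0 := by
  refine measure_mono_null (t := ⋃ k, frontier (refSub k)) ?_
    (measure_iUnion_null fun k => (convex_refSub k).addHaar_frontier volume)
  rintro x ⟨hx, hx'⟩
  rw [← iUnion_refSub] at hx
  obtain ⟨k, hk⟩ := mem_iUnion.1 hx
  exact mem_iUnion.2 ⟨k, subset_closure hk, fun h => hx' (mem_iUnion.2 ⟨k, h⟩)⟩

lemma volume_refTri_lt_top : volume refTri < ⊤ := isCompact_refTri.measure_lt_top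

/-- Lagrange interpolation of quadratic functions on a triangle. -/
lemma polyFun_two_lagrange {f : Plane → ℝ} (hf : f ∈ polyFun 2) (a b c : Plane) (α β γ : ℝ)
    (h : α + β + γ = 1) : f (α • a + β • b + γ • c) =
      α * (2 * α - 1) * f a + β * (2 * β - 1) * f b + γ * (2 * γ - 1) * f c +
      4 * α * β * f (midpoint ℝ a b) + 4 * β * γ * f (midpoint ℝ b c) +
      4 * α * γ * f (midpoint ℝ a c) := by
  let S : Submodule ℝ (Plane → ℝ) :=
    { carrier := {f | f (α • a + β • b + γ • c) =
        α * (2 * α - 1) * f a + β * (2 * β - 1) * f b + γ * (2 * γ - 1) * f c +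
        4 * α * β * f (midpoint ℝ a b) + 4 * β * γ * f (midpoint ℝ b c) +
        4 * α * γ * f (midpoint ℝ a c)}
      add_mem' := by
        intro f g hf hg
        simp only [mem_ofPred_eq, Pi.add_apply] at *
        rw [hf, hg]; ring
      zero_mem' := by simp
      smul_mem' := by
        intro t f hf
        simp only [mem_ofPred_eq, Pi.smul_apply, smul_eq_mul] at *
        rw [hf]; ring }
  -- Both sides are linear in `f`, so the six monomials of degree at most two suffice.
  refine (polyFun_le (S := S) fun m n hmn => ?_) hf
  obtain rfl : γ = 1 - α - β := by linarith
  have hm : ∀ (x y : Plane) (j : Fin 2), midpoint ℝ x y j = (x j + y j) / 2 := by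
    intro x y j
    simp [midpoint_eq_smul_add]; ring
  change _ = _
  simp only [hm, PiLp.add_apply, PiLp.smul_apply, smul_eq_mul]
  have h1 : m ≤ 2 := by omega
  have h2 : n ≤ 2 := by omega
  interval_cases m <;> interval_cases n <;> first | omega | ring

/-! ### Inverse estimates for polynomials -/

lemma memLp_of_mem_polyFun {n : ℕ} {f : Plane → ℝ} (hf : f ∈ polyFun n) (k : Fin 3) :
    MemLp f 2 (volume.restrict (refSub k)) := by
  have hc : Continuous f := (contDiff_of_mem_polyFun hf (m := 0)).continuous
  obtain ⟨B, hB⟩ := (isCompact_refSub k).exists_bound_of_continuousOn hc.continuousOn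
  have : IsFiniteMeasure (volume.restrict (refSub k)) :=
    isFiniteMeasure_restrict.2 (isCompact_refSub k).measure_ne_top
  exact MemLp.of_bound hc.aestronglyMeasurable B
    ((ae_restrict_iff' (isCompact_refSub k).measurableSet).2 (Eventually.of_forall hB))

/-- Equivalence of norms in finite dimension: the L² norm on a subtriangle is definite on
polynomials, since a polynomial vanishing almost everywhere there vanishes on an open set. It
therefore controls every linear image, even in the supremum norm over the whole triangle. The
operator `A` lets one proof serve for function values and for derivatives. -/
lemma exists_inverse_estimate_comp {n : ℕ} (A : polyFun n →ₗ[ℝ] polyFun n) :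
    ∃ C : ℝ, 0 ≤ C ∧ ∀ k, ∀ f : polyFun n, ∀ D : ℝ, 0 ≤ D →
    eLpNorm f.1 2 (volume.restrict (refSub k)) ≤ ENNReal.ofReal D →
    ∀ x ∈ refTri, |(A f).1 x| ≤ C * D := by
  have key : ∀ k : Fin 3, ∃ C : ℝ, 0 ≤ C ∧ ∀ f : polyFun n, ∀ D : ℝ, 0 ≤ D →
      eLpNorm f.1 2 (volume.restrict (refSub k)) ≤ ENNReal.ofReal D →
      ∀ x ∈ refTri, |(A f).1 x| ≤ C * D := by
    intro k
    let S : polyFun n →ₗ[ℝ] Lp ℝ 2 (volume.restrict (refSub k)) :=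
      { toFun := fun f => (memLp_of_mem_polyFun f.2 k).toLp f.1
        map_add' := fun f g => MemLp.toLp_add _ _
        map_smul' := fun c f => MemLp.toLp_const_smul c _ }
    have : CompactSpace refTri := isCompact_iff_compactSpace.1 isCompact_refTri
    let T : polyFun n →ₗ[ℝ] C(refTri, ℝ) :=
      { toFun := fun f => ⟨fun x => (A f).1 x,
          (contDiff_of_mem_polyFun (A f).2 (m := 0)).continuous.comp continuous_subtype_val⟩
        map_add' := fun f g => by ext x; simp
        map_smul' := fun c f => by ext x; simp }
    have hS : Function.Injective S := by
      rw [injective_iff_map_eq_zero]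
      intro f hf
      have h0 : f.1 =ᵐ[volume.restrict (refSub k)] 0 := by
        have h1 := (memLp_of_mem_polyFun f.2 k).coeFn_toLp
        have h2 : ((memLp_of_mem_polyFun f.2 k).toLp f.1) = 0 := hf
        rw [h2] at h1
        exact h1.symm.trans (Lp.coeFn_zero _ _ _)
      have h1 : f.1 =ᵐ[volume.restrict (interior (refSub k))] 0 :=
        ae_restrict_of_ae_restrict_of_subset interior_subset h0
      have hc : Continuous f.1 := (contDiff_of_mem_polyFun f.2 (m := 0)).continuous
      have h2 := Measure.eqOn_open_of_ae_eq h1 isOpen_interior hc.continuousOn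
        continuousOn_const
      exact Subtype.ext (eq_zero_of_mem_polyFun f.2 isOpen_interior
        (interior_refSub_nonempty k) h2)
    obtain ⟨C, hC, h⟩ := exists_bound_of_ker_le S T hS
    refine ⟨C, hC, fun f D hD hfD x hx => ?_⟩
    have h1 : |(A f).1 x| ≤ ‖T f‖ := (T f).norm_coe_le_norm ⟨x, hx⟩
    have h2 : ‖S f‖ ≤ D := by
      have : ‖S f‖ = (eLpNorm f.1 2 (volume.restrict (refSub k))).toReal :=
        Lp.norm_toLp _ (memLp_of_mem_polyFun f.2 k)
      rw [this]
      exact ENNReal.toReal_le_of_le_ofReal hD hfD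
    exact h1.trans ((h _).trans (mul_le_mul_of_nonneg_left h2 hC))
  choose C hC h using key
  -- Summing the three constants makes the bound independent of the subtriangle.
  refine ⟨∑ k, C k, Finset.sum_nonneg fun k _ => hC k, fun k f D hD hfD x hx =>
    (h k f D hD hfD x hx).trans (mul_le_mul_of_nonneg_right ?_ hD)⟩
  exact Finset.single_le_sum (fun k _ => hC k) (Finset.mem_univ k)

lemma exists_inverse_estimate (n : ℕ) : ∃ C : ℝ, 0 ≤ C ∧ ∀ k, ∀ f ∈ polyFun n, ∀ D : ℝ, 0 ≤ D →
    eLpNorm f 2 (volume.restrict (refSub k)) ≤ ENNReal.ofReal D →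
    ∀ x ∈ refTri, |f x| ≤ C * D := by
  obtain ⟨C, hC, h⟩ := exists_inverse_estimate_comp (n := n) LinearMap.id
  exact ⟨C, hC, fun k f hf => h k ⟨f, hf⟩⟩

lemma exists_inverse_estimate_deriv (n : ℕ) (v : Plane) : ∃ C : ℝ, 0 ≤ C ∧ ∀ k, ∀ f ∈ polyFun n,
    ∀ D : ℝ, 0 ≤ D → eLpNorm f 2 (volume.restrict (refSub k)) ≤ ENNReal.ofReal D →
    ∀ x ∈ refTri, |fderiv ℝ f x v| ≤ C * D := by
  have hd : ∀ f : polyFun n, Differentiable ℝ f.1 := fun f =>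
    (contDiff_of_mem_polyFun f.2 (m := 1)).differentiable (by simp)
  let A : polyFun n →ₗ[ℝ] polyFun n :=
    { toFun := fun f => ⟨_, polyFun_deriv f.2 v⟩
      map_add' := fun f g => by
        ext x
        change fderiv ℝ (f.1 + g.1) x v = fderiv ℝ f.1 x v + fderiv ℝ g.1 x v
        rw [fderiv_add (hd f x) (hd g x)]; rfl
      map_smul' := fun c f => by
        ext x
        change fderiv ℝ (c • f.1) x v = c • fderiv ℝ f.1 x v
        rw [fderiv_const_smul (hd f x)]; rfl }
  obtain ⟨C, hC, h⟩ := exists_inverse_estimate_comp A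
  exact ⟨C, hC, fun k f hf => h k ⟨f, hf⟩⟩

/-! ### Polynomial vector fields and their inverse estimates -/

/-- Vector fields whose components are polynomials of degree at most `n`. -/
def IsPolyField (n : ℕ) (v : Plane → Plane) : Prop := ∀ c, (fun x => v x c) ∈ polyFun n

lemma IsPolyField.contDiff {n : ℕ} {v : Plane → Plane} (hv : IsPolyField n v)
    {m : WithTop ℕ∞} : ContDiff ℝ m v :=
  contDiff_euclidean.2 fun c => contDiff_of_mem_polyFun (hv c)

lemma IsPolyField.differentiable {n : ℕ} {v : Plane → Plane} (hv : IsPolyField n v) :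
    Differentiable ℝ v := (hv.contDiff (m := 1)).differentiable (by simp)

lemma IsPolyField.sub {n : ℕ} {v w : Plane → Plane} (hv : IsPolyField n v)
    (hw : IsPolyField n w) : IsPolyField n (fun x => v x - w x) :=
  fun c => polyFun_sub (hv c) (hw c)

lemma isPolyField_const (n : ℕ) (c : Plane) : IsPolyField n (fun _ => c) :=
  fun _ => polyFun_const n _

lemma apply_coord (T : Plane →L[ℝ] Plane) (x : Plane) (c : Fin 2) :
    T x c = T (EuclideanSpace.single 0 1) c * x 0 + T (EuclideanSpace.single 1 1) c * x 1 := by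
  have e : x = x 0 • EuclideanSpace.single 0 (1 : ℝ) + x 1 • EuclideanSpace.single 1 (1 : ℝ) := by
    ext j; fin_cases j <;> simp
  conv_lhs => rw [e, map_add, map_smul, map_smul]
  simp only [PiLp.add_apply, PiLp.smul_apply, smul_eq_mul]
  ring

lemma IsPolyField.clm {n : ℕ} {v : Plane → Plane} (hv : IsPolyField n v)
    (T : Plane →L[ℝ] Plane) : IsPolyField n (fun x => T (v x)) := by
  intro c
  have e : (fun x => T (v x) c) = fun x => T (EuclideanSpace.single 0 1) c * v x 0 +
      T (EuclideanSpace.single 1 1) c * v x 1 := funext fun x => apply_coord T (v x) c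
  rw [e]
  exact polyFun_add (polyFun_const_mul _ (hv 0)) (polyFun_const_mul _ (hv 1))

lemma fderiv_coord {v : Plane → Plane} {x : Plane} (hv : DifferentiableAt ℝ v x) (c : Fin 2)
    (e : Plane) : fderiv ℝ v x e c = fderiv ℝ (fun y => v y c) x e := by
  have := (hasFDerivAt_coord c (v x)).comp x hv.hasFDerivAt
  rw [HasFDerivAt.fderiv (f := fun y => v y c) this]
  simp

lemma norm_le_of_entries {T : Plane →L[ℝ] Plane} {a : ℝ}
    (h : ∀ j c, |T (EuclideanSpace.single j 1) c| ≤ a) : ‖T‖ ≤ 4 * a := by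
  have ha : 0 ≤ a := (abs_nonneg _).trans (h 0 0)
  refine T.opNorm_le_bound (by linarith) fun x => ?_
  have h1 : ∀ c, |T x c| ≤ 2 * a * ‖x‖ := by
    intro c
    rw [apply_coord]
    refine (abs_add_le _ _).trans ?_
    rw [abs_mul, abs_mul]
    have := mul_le_mul (h 0 c) (abs_coord_le_norm x 0) (abs_nonneg _) ha
    have := mul_le_mul (h 1 c) (abs_coord_le_norm x 1) (abs_nonneg _) ha
    linarith
  have := norm_le_of_coord h1
  linarith

lemma abs_entry_le (T : Plane →L[ℝ] Plane) (j c : Fin 2) :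
    |T (EuclideanSpace.single j 1) c| ≤ ‖T‖ :=
  (abs_coord_le_norm _ c).trans (by simpa using T.le_opNorm (EuclideanSpace.single j 1))

/-- Markov's inequality on the subtriangles. -/
lemma exists_markov (n : ℕ) : ∃ C : ℝ, 0 ≤ C ∧ ∀ k, ∀ v, IsPolyField n v → ∀ B : ℝ,
    (∀ x ∈ refSub k, ‖v x‖ ≤ B) → ∀ x ∈ refSub k, ‖fderiv ℝ v x‖ ≤ C * B := by
  choose C hC h using fun j : Fin 2 => exists_inverse_estimate_deriv n (EuclideanSpace.single j 1)
  -- The square root of the area, so that an L² norm is at most `m` times the supremum.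
  let m : ℝ := volume.real refTri ^ (1 / 2 : ℝ)
  have hm : 0 ≤ m := by positivity
  refine ⟨4 * ((C 0 + C 1) * m), by have := hC 0; have := hC 1; positivity,
    fun k v hv B hB x hx => ?_⟩
  have hB0 : 0 ≤ B := (norm_nonneg _).trans (hB x hx)
  rw [mul_assoc, mul_assoc]
  refine norm_le_of_entries fun j c => ?_
  rw [fderiv_coord (hv.differentiable x)]
  have h1 : eLpNorm (fun x => v x c) 2 (volume.restrict (refSub k)) ≤ ENNReal.ofReal (m * B) := by
    refine (eLpNorm_le_of_ae_bound (C := B)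
      ((ae_restrict_iff' (isCompact_refSub k).measurableSet).2
      (Eventually.of_forall fun x hx => (abs_coord_le_norm _ c).trans (hB x hx)))).trans ?_
    rw [ENNReal.ofReal_mul hm]
    gcongr
    rw [Measure.restrict_apply_univ, ← ENNReal.ofReal_rpow_of_nonneg (by positivity) (by norm_num),
      ofReal_measureReal volume_refTri_lt_top.ne]
    simp only [one_div, ENNReal.toReal_ofNat]
    gcongr
    exact refSub_subset k
  refine (h j k _ (hv c) _ (by positivity) h1 x (refSub_subset k hx)).trans ?_
  refine mul_le_mul_of_nonneg_right ?_ (by positivity)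
  fin_cases j <;> simp [hC]

/-- Quadratic fields on a subtriangle are controlled by their values at the Lagrange nodes. -/
lemma norm_le_of_nodes {v : Plane → Plane} (hv : IsPolyField 2 v) {k : Fin 3} {B : ℝ}
    (h : ∀ a ∈ refNodes ∩ refSub k, ‖v a‖ ≤ B) {x : Plane} (hx : x ∈ refSub k) :
    ‖v x‖ ≤ 30 * B := by
  have ev : ∀ j : Fin 3, refVertex j = ctVertex j.succ := fun j => rfl
  have nodes : ∀ a b : Fin 4, a ≠ b → ctVertex a ∈ refSub k → ctVertex b ∈ refSub k →
      midpoint ℝ (ctVertex a) (ctVertex b) ∈ refNodes ∩ refSub k := fun a b hab ha hb =>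
    ⟨Or.inr ⟨a, b, hab, rfl⟩, (convex_refSub k).midpoint_mem ha hb⟩
  have m1 : ctVertex (k + 1).succ ∈ refSub k := subset_convexHull ℝ _ (by simp [ev])
  have m2 : ctVertex (k + 2).succ ∈ refSub k := subset_convexHull ℝ _ (by simp [ev])
  have m0 := ctVertex_zero_mem_refSub k
  have hk : ∀ k : Fin 3, (k + 1).succ ≠ (k + 2).succ := by decide
  have n12 := nodes _ _ (hk k) m1 m2
  have n10 := nodes _ _ (by simp) m1 m0
  have n20 := nodes _ _ (by simp) m2 m0
  have hs := sum_bary_cyc x k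
  obtain ⟨h0, h1, h2⟩ := mem_refSub.1 hx
  -- The barycentric coordinates of `x` in the subtriangle, as in `mem_refSub`.
  set α := bary x (k + 1) - bary x k with hα
  set β := bary x (k + 2) - bary x k with hβ
  set γ := 3 * bary x k with hγ
  have hαβγ : α + β + γ = 1 := by linarith
  have hα0 : 0 ≤ α := by linarith
  have hβ0 : 0 ≤ β := by linarith
  have hγ0 : 0 ≤ γ := by linarith
  have ex : x = α • ctVertex (k + 1).succ + β • ctVertex (k + 2).succ + γ • ctVertex 0 := by
    ext j
    fin_cases k <;> fin_cases j <;> simp [hα, hβ, hγ, bary, refVertex, ctVertex] <;> ring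
  have hB : 0 ≤ B := (norm_nonneg _).trans (h _ n12)
  have hb : ∀ c, ∀ a ∈ refNodes ∩ refSub k, |v a c| ≤ B := fun c a ha =>
    (abs_coord_le_norm _ c).trans (h a ha)
  have hq : ∀ t : ℝ, 0 ≤ t → t ≤ 1 → |t * (2 * t - 1)| ≤ 1 := fun t ht ht' => abs_le.2
    ⟨by nlinarith, by nlinarith⟩
  have hr : ∀ s t : ℝ, 0 ≤ s → 0 ≤ t → s + t ≤ 1 → |4 * s * t| ≤ 1 := fun s t hs ht hst =>
    abs_le.2 ⟨by nlinarith [mul_nonneg hs ht], by nlinarith [sq_nonneg (s - t)]⟩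
  have hm : ∀ {s y : ℝ}, |s| ≤ 1 → |y| ≤ B → |s * y| ≤ B := fun hs hy => by
    rw [abs_mul]
    calc _ ≤ 1 * B := mul_le_mul hs hy (abs_nonneg _) zero_le_one
      _ = B := one_mul B
  -- Each of the six nodal basis functions is at most one in absolute value. Passing from
  -- coordinates to the norm gives 12 B, so the constant 30 is not sharp.
  have hc : ∀ c, |v x c| ≤ 6 * B := by
    intro c
    have e := polyFun_two_lagrange (hv c) (ctVertex (k + 1).succ) (ctVertex (k + 2).succ)
      (ctVertex 0) α β γ hαβγ
    simp only [← ex] at e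
    rw [e]
    have a1 := hm (hq α hα0 (by linarith)) (hb c _ ⟨Or.inl ⟨_, rfl⟩, m1⟩)
    have a2 := hm (hq β hβ0 (by linarith)) (hb c _ ⟨Or.inl ⟨_, rfl⟩, m2⟩)
    have a3 := hm (hq γ hγ0 (by linarith)) (hb c _ ⟨Or.inl ⟨_, rfl⟩, m0⟩)
    have a4 := hm (hr α β hα0 hβ0 (by linarith)) (hb c _ n12)
    have a5 := hm (hr β γ hβ0 hγ0 (by linarith)) (hb c _ n20)
    have a6 := hm (hr α γ hα0 hγ0 (by linarith)) (hb c _ n10)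
    rw [abs_le] at *
    constructor <;> linarith [a1.1, a2.1, a3.1, a4.1, a5.1, a6.1, a1.2, a2.2, a3.2, a4.2, a5.2, a6.2]
  have := norm_le_of_coord hc
  linarith

/-! ### The local interpolation estimate on the reference triangle -/

lemma det_eq_entries (T : Plane →L[ℝ] Plane) :
    T.det = T (EuclideanSpace.single 0 1) 0 * T (EuclideanSpace.single 1 1) 1 -
      T (EuclideanSpace.single 1 1) 0 * T (EuclideanSpace.single 0 1) 1 := by
  rw [ContinuousLinearMap.det,
    ← LinearMap.det_toMatrix (EuclideanSpace.basisFun (Fin 2) ℝ).toBasis, Matrix.det_fin_two]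
  simp [LinearMap.toMatrix_apply]

lemma abs_det_le {T : Plane →L[ℝ] Plane} {b : ℝ} (hT : ‖T‖ ≤ b) : |T.det| ≤ 2 * b ^ 2 := by
  have h : ∀ j c, |T (EuclideanSpace.single j 1) c| ≤ b := fun j c => (abs_entry_le T j c).trans hT
  have hb : 0 ≤ b := (norm_nonneg _).trans hT
  rw [det_eq_entries]
  refine (abs_sub _ _).trans ?_
  rw [abs_mul, abs_mul]
  have := mul_le_mul (h 0 0) (h 1 1) (abs_nonneg _) hb
  have := mul_le_mul (h 1 0) (h 0 1) (abs_nonneg _) hb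
  nlinarith

/-! ### The matrix of the Piola transform for affine matrix fields -/

/-- The matrix `M / det M` of the Piola transform. -/
def piola (M : Plane → Plane →L[ℝ] Plane) (x : Plane) : Plane →L[ℝ] Plane :=
  (M x).det⁻¹ • M x

/-- The matrix entry functional. -/
def entry (j c : Fin 2) : (Plane →L[ℝ] Plane) →L[ℝ] ℝ :=
  (EuclideanSpace.proj c).comp (ContinuousLinearMap.apply ℝ Plane (EuclideanSpace.single j 1))

lemma entry_apply (j c : Fin 2) (T : Plane →L[ℝ] Plane) :
    entry j c T = T (EuclideanSpace.single j 1) c := rfl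

lemma norm_entry_le (j c : Fin 2) : ‖entry j c‖ ≤ 1 :=
  ContinuousLinearMap.opNorm_le_bound _ zero_le_one fun T => by
    rw [one_mul]; exact abs_entry_le T j c

lemma norm_smul_add_smulRight_le {E F : Type*} [NormedAddCommGroup E] [NormedSpace ℝ E]
    [NormedAddCommGroup F] [NormedSpace ℝ F] (s : ℝ) (A : E →L[ℝ] F) (l : E →L[ℝ] ℝ) (T : F) :
    ‖s • A + l.smulRight T‖ ≤ |s| * ‖A‖ + ‖l‖ * ‖T‖ := by
  refine (norm_add_le (s • A) (l.smulRight T)).trans (add_le_add (norm_smul_le s A) ?_)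
  rw [ContinuousLinearMap.norm_smulRight_apply]

/-- Matrix fields with affine entries whose determinant does not vanish on the reference triangle. -/
structure IsAffineMatrix (b : ℝ) (M : Plane → Plane →L[ℝ] Plane) : Prop where
  poly : ∀ y, IsPolyField 1 (fun x => M x y)
  norm_le : ∀ x ∈ refTri, ‖M x‖ ≤ b
  det_ne : ∀ x ∈ refTri, (M x).det ≠ 0
  det_inv_le : ∀ x ∈ refTri, |(M x).det|⁻¹ ≤ b

namespace IsAffineMatrix

variable {b : ℝ} {M : Plane → Plane →L[ℝ] Plane}

lemma nonneg (hM : IsAffineMatrix b M) : 0 ≤ b :=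
  (norm_nonneg _).trans (hM.norm_le _ ctVertex_zero_mem_refTri)

lemma contDiff (hM : IsAffineMatrix b M) : ContDiff ℝ ∞ M :=
  contDiff_clm_apply_iff.2 fun y => (hM.poly y).contDiff

lemma differentiable (hM : IsAffineMatrix b M) : Differentiable ℝ M :=
  hM.contDiff.differentiable (by simp)

lemma entry_mem (hM : IsAffineMatrix b M) (j c : Fin 2) :
    (fun x => M x (EuclideanSpace.single j 1) c) ∈ polyFun 1 := hM.poly _ c

lemma det_mem (hM : IsAffineMatrix b M) : (fun x => (M x).det) ∈ polyFun 2 := by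
  have h := polyFun_sub (polyFun_mul (hM.entry_mem 0 0) (hM.entry_mem 1 1))
    (polyFun_mul (hM.entry_mem 1 0) (hM.entry_mem 0 1))
  simpa only [det_eq_entries] using h

lemma apply_mem (hM : IsAffineMatrix b M) {w : Plane → Plane} (hw : IsPolyField 2 w) :
    IsPolyField 3 (fun x => M x (w x)) := by
  intro c
  have e : (fun x => M x (w x) c) = fun x => M x (EuclideanSpace.single 0 1) c * w x 0 +
      M x (EuclideanSpace.single 1 1) c * w x 1 := funext fun x => apply_coord _ _ c
  rw [e]
  have h := polyFun_add (polyFun_mul (hM.entry_mem 0 c) (hw 0))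
    (polyFun_mul (hM.entry_mem 1 c) (hw 1))
  exact h

lemma differentiable_det (hM : IsAffineMatrix b M) : Differentiable ℝ fun x => (M x).det :=
  (contDiff_of_mem_polyFun hM.det_mem (m := 1)).differentiable (by simp)

/-- By the product rule the derivative of the determinant is a signed sum of four terms, each an
entry of M (at most b) times the derivative of an entry (at most ε). -/
lemma norm_fderiv_det_le (hM : IsAffineMatrix b M) {ε : ℝ}
    {x : Plane} (hx : x ∈ refTri) (h : ‖fderiv ℝ M x‖ ≤ ε) :
    ‖fderiv ℝ (fun x => (M x).det) x‖ ≤ 4 * b * ε := by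
  have he : ∀ j c, HasFDerivAt (fun x => entry j c (M x)) ((entry j c).comp (fderiv ℝ M x)) x :=
    fun j c => (entry j c).hasFDerivAt.comp x (hM.differentiable x).hasFDerivAt
  have hn : ∀ j c, ‖(entry j c).comp (fderiv ℝ M x)‖ ≤ ε := fun j c =>
    (ContinuousLinearMap.opNorm_comp_le _ _).trans (by
      calc _ ≤ 1 * ‖fderiv ℝ M x‖ := by gcongr; exact norm_entry_le j c
        _ ≤ ε := by rwa [one_mul])
  have hv : ∀ j c, |entry j c (M x)| ≤ b := fun j c => (abs_entry_le _ j c).trans (hM.norm_le x hx)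
  have hd := ((he 0 0).mul (he 1 1)).sub ((he 1 0).mul (he 0 1))
  have e : ((fun x => entry 0 0 (M x)) * (fun x => entry 1 1 (M x)) -
      (fun x => entry 1 0 (M x)) * (fun x => entry 0 1 (M x))) = fun x => (M x).det := by
    ext y; simp [det_eq_entries, entry_apply]
  rw [e] at hd
  rw [hd.fderiv]
  have hε : 0 ≤ ε := (norm_nonneg (fderiv ℝ M x)).trans h
  have hs : ∀ j c j' c', ‖entry j c (M x) • (entry j' c').comp (fderiv ℝ M x)‖ ≤ b * ε :=
    fun j c j' c' => (norm_smul_le _ _).trans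
      (mul_le_mul (hv j c) (hn j' c') (norm_nonneg _) hM.nonneg)
  refine (norm_sub_le _ _).trans ?_
  have h1 := (norm_add_le _ _).trans (add_le_add (hs 0 0 1 1) (hs 1 1 0 0))
  have h2 := (norm_add_le _ _).trans (add_le_add (hs 1 0 0 1) (hs 0 1 1 0))
  linarith

lemma hasFDerivAt_piola (hM : IsAffineMatrix b M) {x : Plane} (hx : x ∈ refTri) :
    HasFDerivAt (piola M) ((M x).det⁻¹ • fderiv ℝ M x +
      ((-((M x).det ^ 2)⁻¹) • fderiv ℝ (fun x => (M x).det) x).smulRight (M x)) x :=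
  ((hasDerivAt_inv (hM.det_ne x hx)).comp_hasFDerivAt x
    (hM.differentiable_det x).hasFDerivAt).smul (hM.differentiable x).hasFDerivAt

/-- The two terms of the quotient rule, DM / det M and -(D det M) M / (det M)², contribute b ε and
b² (4 b ε) b. The bound is linear in ε: this is how the small variation of M passes to the Piola
matrix. -/
lemma norm_fderiv_piola_le (hM : IsAffineMatrix b M) {ε : ℝ}
    {x : Plane} (hx : x ∈ refTri) (h : ‖fderiv ℝ M x‖ ≤ ε) :
    ‖fderiv ℝ (piola M) x‖ ≤ (b + 4 * b ^ 4) * ε := by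
  rw [(hM.hasFDerivAt_piola hx).fderiv]
  have hb := hM.nonneg
  have hε : 0 ≤ ε := (norm_nonneg (fderiv ℝ M x)).trans h
  have hi := hM.det_inv_le x hx
  refine (norm_smul_add_smulRight_le _ _ _ _).trans ?_
  have h1 : |(M x).det⁻¹| * ‖fderiv ℝ M x‖ ≤ b * ε :=
    mul_le_mul (by rwa [abs_inv]) h (norm_nonneg (fderiv ℝ M x)) hb
  have h2 : ‖(-((M x).det ^ 2)⁻¹) • fderiv ℝ (fun x => (M x).det) x‖ * ‖M x‖ ≤
      b ^ 2 * (4 * b * ε) * b := by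
    refine mul_le_mul ((norm_smul_le _ _).trans (mul_le_mul ?_ (hM.norm_fderiv_det_le hx h)
      (norm_nonneg _) (by positivity))) (hM.norm_le x hx) (norm_nonneg _) (by positivity)
    rw [norm_neg, norm_inv, norm_pow, Real.norm_eq_abs, ← inv_pow]
    exact pow_le_pow_left₀ (by positivity) hi 2
  exact (add_le_add h1 h2).trans (le_of_eq (by ring))

lemma differentiableAt_piola_apply (hM : IsAffineMatrix b M) {w : Plane → Plane} {n : ℕ}
    (hw : IsPolyField n w) {x : Plane} (hx : x ∈ refTri) :
    DifferentiableAt ℝ (fun y => piola M y (w y)) x :=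
  (hM.hasFDerivAt_piola hx).differentiableAt.clm_apply (hw.differentiable x)

/-- The adjugate of `M` applied to a constant vector. -/
lemma exists_adjugate (hM : IsAffineMatrix b M) (c : Plane) : ∃ a : Plane → Plane,
    IsPolyField 2 a ∧ ∀ x, M x (a x) = (M x).det • c := by
  refine ⟨fun x => !₂[M x (EuclideanSpace.single 1 1) 1 * c 0 -
      M x (EuclideanSpace.single 1 1) 0 * c 1,
    M x (EuclideanSpace.single 0 1) 0 * c 1 - M x (EuclideanSpace.single 0 1) 1 * c 0], ?_, ?_⟩
  · intro i
    have h0 := polyFun_sub (polyFun_mul (hM.entry_mem 1 1) (polyFun_const 1 (c 0)))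
      (polyFun_mul (hM.entry_mem 1 0) (polyFun_const 1 (c 1)))
    have h1 := polyFun_sub (polyFun_mul (hM.entry_mem 0 0) (polyFun_const 1 (c 1)))
      (polyFun_mul (hM.entry_mem 0 1) (polyFun_const 1 (c 0)))
    fin_cases i
    · exact h0
    · exact h1
  · intro x
    ext i
    rw [apply_coord, det_eq_entries]
    fin_cases i <;> simp <;> ring

/-- If y = M w / det M, Cramer's rule gives w = adj(M) y, and the adjugate has the same entries as M
up to order and sign. No bound on the inverse determinant is needed. -/
lemma norm_le_of_piola (hM : IsAffineMatrix b M) {x w : Plane} (hx : x ∈ refTri) {a : ℝ}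
    (h : ‖piola M x w‖ ≤ a) : ‖w‖ ≤ 4 * b * a := by
  have hb := hM.nonneg
  obtain hd := hM.det_ne x hx
  set T := M x with hT
  have hTn := hM.norm_le x hx
  have hy : ∀ c, |piola M x w c| ≤ a := fun c => (abs_coord_le_norm _ c).trans h
  set y := piola M x w with hyd
  have e : T w = T.det • y := by
    simp [hyd, piola, ← hT, smul_smul, hd]
  have ha : 0 ≤ a := (norm_nonneg _).trans h
  have e0 := congrArg (fun z : Plane => z 0) e
  have e1 := congrArg (fun z : Plane => z 1) e
  simp only [apply_coord T w, PiLp.smul_apply, smul_eq_mul] at e0 e1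
  have hdet := det_eq_entries T
  have hent : ∀ j c, |T (EuclideanSpace.single j 1) c| ≤ b := fun j c =>
    (abs_entry_le T j c).trans hTn
  have w0 : w 0 = T (EuclideanSpace.single 1 1) 1 * y 0 - T (EuclideanSpace.single 1 1) 0 * y 1 := by
    apply mul_left_cancel₀ hd
    linear_combination (T (EuclideanSpace.single 1 1) 1) * e0 -
      (T (EuclideanSpace.single 1 1) 0) * e1 + w 0 * hdet
  have w1 : w 1 = T (EuclideanSpace.single 0 1) 0 * y 1 - T (EuclideanSpace.single 0 1) 1 * y 0 := by
    apply mul_left_cancel₀ hd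
    linear_combination (T (EuclideanSpace.single 0 1) 0) * e1 -
      (T (EuclideanSpace.single 0 1) 1) * e0 + w 1 * hdet
  have hp : ∀ j c i, |T (EuclideanSpace.single j 1) c * y i| ≤ b * a := fun j c i => by
    rw [abs_mul]; exact mul_le_mul (hent j c) (hy i) (abs_nonneg _) hb
  have : ∀ j, |w j| ≤ 2 * (b * a) := by
    intro j
    fin_cases j
    · simp only [Fin.zero_eta, w0]
      exact (abs_sub _ _).trans (by linarith [hp 1 1 0, hp 1 0 1])
    · simp only [Fin.mk_one, w1]
      exact (abs_sub _ _).trans (by linarith [hp 0 0 1, hp 0 1 0])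
  have := norm_le_of_coord this
  linarith

end IsAffineMatrix

/-- Inverse estimate for Piola transforms of quadratic fields. -/
lemma exists_piola_inverse_estimate (b : ℝ) : ∃ C : ℝ, 0 ≤ C ∧ ∀ k M, IsAffineMatrix b M →
    ∀ w, IsPolyField 2 w → ∀ D : ℝ, 0 ≤ D →
    eLpNorm (fun x => ‖fderiv ℝ (fun y => piola M y (w y)) x‖) 2
      (volume.restrict (refSub k)) ≤ ENNReal.ofReal D →
    ∀ x ∈ refSub k, ‖fderiv ℝ (fun y => piola M y (w y)) x‖ ≤ C * D := by
  obtain ⟨C, hC, h⟩ := exists_inverse_estimate 5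
  refine ⟨4 * (b ^ 2 * C * (2 * b ^ 2) ^ 2), by positivity, fun k M hM w hw D hD hwD x hx => ?_⟩
  rw [mul_assoc]
  refine norm_le_of_entries fun j c => ?_
  set e : Plane := EuclideanSpace.single j 1 with he
  set R : Plane → ℝ := fun x => M x (w x) c with hR
  set J : Plane → ℝ := fun x => (M x).det with hJ
  have hRp : R ∈ polyFun 3 := hM.apply_mem hw c
  have hJp : J ∈ polyFun 2 := hM.det_mem
  have hRd : Differentiable ℝ R := (contDiff_of_mem_polyFun hRp (m := 1)).differentiable (by simp)
  have hJd : Differentiable ℝ J := hM.differentiable_det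
  -- With component R / J of the transformed field, the derivative is P / J². The numerator is a
  -- polynomial of degree at most 2 + 3, whatever M is, so one inverse estimate in a fixed space
  -- applies; J² is bounded above and below through b.
  set P : Plane → ℝ := fun x => J x * fderiv ℝ R x e - R x * fderiv ℝ J x e with hPdef
  have hP : P ∈ polyFun 5 := by
    have h1 := polyFun_mul hJp (polyFun_deriv hRp e)
    have h2 := polyFun_mul hRp (polyFun_deriv hJp e)
    exact polyFun_sub h1 h2
  have key : ∀ y ∈ refTri, fderiv ℝ (fun y => piola M y (w y)) y e c * J y ^ 2 = P y := by
    intro y hy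
    have hJ0 : J y ≠ 0 := hM.det_ne y hy
    rw [fderiv_coord (hM.differentiableAt_piola_apply hw hy)]
    have e1 : (fun y => piola M y (w y) c) = fun y => (J y)⁻¹ * R y := by
      ext y; simp [piola, hJ, hR]
    have h2 := ((hasDerivAt_inv hJ0).comp_hasFDerivAt y (hJd y).hasFDerivAt).mul
      (hRd y).hasFDerivAt
    rw [e1, HasFDerivAt.fderiv (f := fun y => (J y)⁻¹ * R y) h2]
    simp [hPdef]
    field_simp
    ring
  have hxT := refSub_subset k hx
  have hJle : ∀ y ∈ refTri, J y ^ 2 ≤ (2 * b ^ 2) ^ 2 := fun y hy => by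
    rw [← sq_abs]
    exact pow_le_pow_left₀ (abs_nonneg _) (abs_det_le (hM.norm_le y hy)) 2
  have hPn : eLpNorm P 2 (volume.restrict (refSub k)) ≤
      ENNReal.ofReal ((2 * b ^ 2) ^ 2 * D) := by
    rw [ENNReal.ofReal_mul (by positivity)]
    refine (eLpNorm_le_mul_eLpNorm_of_ae_le_mul (c := (2 * b ^ 2) ^ 2)
      (g := fun x => ‖fderiv ℝ (fun y => piola M y (w y)) x‖) ?_ 2).trans (by gcongr)
    refine (ae_restrict_iff' (isCompact_refSub k).measurableSet).2 (Eventually.of_forall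
      fun y hy => ?_)
    have hyT := refSub_subset k hy
    rw [← key y hyT, Real.norm_eq_abs, abs_mul, norm_norm, mul_comm, abs_pow, sq_abs]
    exact mul_le_mul (hJle y hyT) (abs_entry_le _ j c) (abs_nonneg _) (by positivity)
  have hPx := h k P hP _ (by positivity) hPn x hxT
  have hJ0 : J x ≠ 0 := hM.det_ne x hxT
  have e2 : fderiv ℝ (fun y => piola M y (w y)) x e c = (J x)⁻¹ ^ 2 * P x := by
    rw [← key x hxT]; field_simp
  rw [e2, abs_mul, abs_pow, abs_inv]
  calc |J x|⁻¹ ^ 2 * |P x| ≤ b ^ 2 * (C * ((2 * b ^ 2) ^ 2 * D)) := by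
        refine mul_le_mul (pow_le_pow_left₀ (by positivity) (hM.det_inv_le x hxT) 2) hPx
          (abs_nonneg _) (by positivity)
    _ = _ := by ring

/-- The interpolation error of Piola transforms of quadratic fields on a subtriangle. -/
theorem exists_local_estimate (b : ℝ) (hb : 0 ≤ b) : ∃ C : ℝ, 0 ≤ C ∧ ∀ k M,
    IsAffineMatrix b M → ∀ ε : ℝ, (∀ x ∈ refTri, ‖fderiv ℝ M x‖ ≤ ε) →
    ∀ w q, IsPolyField 2 w → IsPolyField 2 q →
    (∀ a ∈ refNodes ∩ refSub k, q a = piola M a (w a)) → ∀ D : ℝ, 0 ≤ D →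
    eLpNorm (fun x => ‖fderiv ℝ (fun y => piola M y (w y)) x‖) 2
      (volume.restrict (refSub k)) ≤ ENNReal.ofReal D →
    ∀ x ∈ refSub k, ‖piola M x (w x) - q x‖ ≤ C * ε * D ∧
      ‖fderiv ℝ (fun y => piola M y (w y) - q y) x‖ ≤ C * ε * D := by
  obtain ⟨C₁, hC₁, h₁⟩ := exists_piola_inverse_estimate b
  obtain ⟨C₂, hC₂, h₂⟩ := exists_markov 2
  -- In `c₁` the factor 2 bounds the diameter of the reference triangle and 4 b comes from
  -- `norm_le_of_piola`. In `c₂` the factor 2 is the diameter again, multiplying the Lipschitz bound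
  -- of `norm_fderiv_piola_le`.
  set c₁ := 4 * b * (2 * C₁) with hc₁
  set c₂ := 2 * (b + 4 * b ^ 4) with hc₂
  have hc₁0 : 0 ≤ c₁ := by positivity
  have hc₂0 : 0 ≤ c₂ := by positivity
  refine ⟨31 * c₂ * c₁ + (c₂ * c₁ + c₂ * (C₂ * c₁) + C₂ * (30 * (c₂ * c₁))), by positivity,
    fun k M hM ε hε w q hw hq hn D hD hwD => ?_⟩
  set B := piola M with hB
  set z := ctVertex 0 with hz
  have hzk : z ∈ refSub k := ctVertex_zero_mem_refSub k
  have hzT := refSub_subset k hzk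
  have hε0 : 0 ≤ ε := (norm_nonneg (fderiv ℝ M z)).trans (hε z hzT)
  have hvd : ∀ x ∈ refSub k, DifferentiableAt ℝ (fun y => B y (w y)) x := fun x hx =>
    hM.differentiableAt_piola_apply hw (refSub_subset k hx)
  set c := B z (w z) with hc
  -- Constants are Piola transforms of polynomials: c = B adj(M) c. Subtracting c from B w therefore
  -- stays within transforms of quadratic fields.
  obtain ⟨a, ha, hMa⟩ := hM.exists_adjugate c
  have hBa : ∀ x, (M x).det ≠ 0 → B x (a x) = c := fun x hx => by
    simp [hB, piola, hMa, smul_smul, hx]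
  set w' : Plane → Plane := fun x => w x - a x with hw'
  have hw'p : IsPolyField 2 w' := hw.sub ha
  have hBw : ∀ x, (M x).det ≠ 0 → B x (w x) - c = B x (w' x) := fun x hx => by
    simp [hw', hBa x hx]
  have hdet : ∀ x ∈ refSub k, (M x).det ≠ 0 := fun x hx => hM.det_ne x (refSub_subset k hx)
  have hw'n : ∀ x ∈ refSub k, ‖w' x‖ ≤ c₁ * D := by
    intro x hx
    -- The mean value inequality turns the uniform gradient bound into a bound on B w - c, hence on
    -- w'.
    have h3 : ‖B x (w x) - B z (w z)‖ ≤ C₁ * D * ‖x - z‖ :=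
      (convex_refSub k).norm_image_sub_le_of_norm_fderiv_le (f := fun y => B y (w y)) hvd
        (fun y hy => h₁ k M hM w hw D hD hwD y hy) hzk hx
    have h4 : ‖B x (w' x)‖ ≤ C₁ * D * 2 := by
      rw [← hBw x (hdet x hx)]
      exact h3.trans (mul_le_mul_of_nonneg_left
        (norm_sub_le_two (refSub_subset k hx) hzT) (by positivity))
    exact (hM.norm_le_of_piola (refSub_subset k hx) h4).trans (le_of_eq (by rw [hc₁]; ring))
  have hw'd : ∀ x ∈ refSub k, ‖fderiv ℝ w' x‖ ≤ C₂ * (c₁ * D) :=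
    h₂ k w' hw'p _ hw'n
  have hBd : ∀ x ∈ refTri, ‖fderiv ℝ B x‖ ≤ c₂ * ε := fun x hx => by
    have h := hM.norm_fderiv_piola_le hx (hε x hx)
    have h' : 0 ≤ (b + 4 * b ^ 4) * ε := by positivity
    calc _ ≤ (b + 4 * b ^ 4) * ε := h
      _ ≤ c₂ * ε := by rw [hc₂]; linarith
  have hBz : ∀ x ∈ refSub k, ‖B x - B z‖ ≤ c₂ * ε := fun x hx => by
    have := (convex_refSub k).norm_image_sub_le_of_norm_fderiv_le (f := B)
      (fun y hy => (hM.hasFDerivAt_piola (refSub_subset k hy)).differentiableAt)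
      (fun y hy => hM.norm_fderiv_piola_le (refSub_subset k hy) (hε y (refSub_subset k hy))) hzk hx
    refine this.trans ((mul_le_mul_of_nonneg_left
        (norm_sub_le_two (refSub_subset k hx) hzT) (by positivity)).trans (le_of_eq ?_))
    rw [hc₂]; ring
  -- The difference of q and the frozen field c + B(z) w' is quadratic. At the nodes it equals (B -
  -- B(z)) w', which is small, and so it is small everywhere, with its gradient by Markov's
  -- inequality.
  set r : Plane → Plane := fun x => q x - c - B z (w' x) with hr
  have hrp : IsPolyField 2 r := (hq.sub (isPolyField_const 2 c)).sub (hw'p.clm (B z))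
  have hBw' : ∀ x ∈ refSub k, ‖(B x - B z) (w' x)‖ ≤ c₂ * ε * (c₁ * D) := fun x hx =>
    (ContinuousLinearMap.le_opNorm _ _).trans
      (mul_le_mul (hBz x hx) (hw'n x hx) (norm_nonneg _) (by positivity))
  have hrn : ∀ x ∈ refSub k, ‖r x‖ ≤ 30 * (c₂ * ε * (c₁ * D)) := fun x hx => by
    refine norm_le_of_nodes hrp (fun y hy => ?_) hx
    have : r y = (B y - B z) (w' y) := by
      simp only [hr, hn y hy, hBw y (hdet y hy.2), sub_apply]
    rw [this]
    exact hBw' y hy.2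
  have hrd := h₂ k r hrp _ hrn
  have herr : ∀ x, (M x).det ≠ 0 → B x (w x) - q x = (B x - B z) (w' x) - r x := fun x hx => by
    have := hBw x hx
    simp only [hr, sub_apply, ← this]
    abel
  intro x hx
  have hxT := refSub_subset k hx
  constructor
  · rw [herr x (hdet x hx)]
    calc _ ≤ c₂ * ε * (c₁ * D) + 30 * (c₂ * ε * (c₁ * D)) :=
          (norm_sub_le _ _).trans (add_le_add (hBw' x hx) (hrn x hx))
      _ = 31 * c₂ * c₁ * ε * D := by ring
      _ ≤ _ := by
        have : 0 ≤ (c₂ * c₁ + c₂ * (C₂ * c₁) + C₂ * (30 * (c₂ * c₁))) * ε * D := by positivity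
        linarith
  -- The splitting of the error needs a nonvanishing determinant, which is an open condition. It can
  -- thus be differentiated at x even when x lies on the boundary of the subtriangle.
  · have hev : ∀ᶠ y in 𝓝 x, (M y).det ≠ 0 :=
      hM.differentiable_det.continuous.continuousAt.eventually_ne (hdet x hx)
    have hB1 := (hM.hasFDerivAt_piola hxT).differentiableAt.hasFDerivAt.sub_const (B z)
    have hd := (hB1.clm_apply (hw'p.differentiable x).hasFDerivAt).sub
      (hrp.differentiable x).hasFDerivAt
    have he : (fun y => B y (w y) - q y) =ᶠ[𝓝 x]
        ((fun y => (B y - B z) (w' y)) - fun y => r y) := hev.mono fun y hy => herr y hy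
    rw [he.fderiv_eq, hd.fderiv]
    have n1 : ‖(B x - B z).comp (fderiv ℝ w' x)‖ ≤ c₂ * ε * (C₂ * (c₁ * D)) :=
      (ContinuousLinearMap.opNorm_comp_le _ _).trans
        (mul_le_mul (hBz x hx) (hw'd x hx) (norm_nonneg _) (by positivity))
    have n2 : ‖(fderiv ℝ B x).flip (w' x)‖ ≤ c₂ * ε * (c₁ * D) := by
      refine (ContinuousLinearMap.le_opNorm _ _).trans ?_
      rw [ContinuousLinearMap.opNorm_flip]
      exact mul_le_mul (hBd x hxT) (hw'n x hx) (norm_nonneg _) (by positivity)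
    calc _ ≤ c₂ * ε * (C₂ * (c₁ * D)) + c₂ * ε * (c₁ * D) + C₂ * (30 * (c₂ * ε * (c₁ * D))) :=
          (norm_sub_le _ _).trans (add_le_add ((norm_add_le _ _).trans (add_le_add n1 n2))
            (hrd x hx))
      _ = (c₂ * c₁ + c₂ * (C₂ * c₁) + C₂ * (30 * (c₂ * c₁))) * ε * D := by ring
      _ ≤ _ := by
        have : 0 ≤ 31 * c₂ * c₁ * ε * D := by positivity
        linarith

/-! ### The element maps -/

lemma IsPolyField.fderiv_apply {n : ℕ} {v : Plane → Plane} (hv : IsPolyField n v) (y : Plane) :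
    IsPolyField (n - 1) (fun x => fderiv ℝ v x y) := by
  intro c
  have e : (fun x => fderiv ℝ v x y c) = fun x => fderiv ℝ (fun z => v z c) x y :=
    funext fun x => fderiv_coord (hv.differentiable x) c y
  rw [e]
  exact polyFun_deriv_pred (hv c) y

lemma isPolyField_quadInterp (g : Plane → Plane) : IsPolyField 2 (quadInterp g) := by
  intro c
  have h1 : ∀ k : Fin 3, (fun x => (bary x k * (2 * bary x k - 1)) * g (refVertex k) c +
      (4 * bary x (k + 1) * bary x (k + 2)) *
        g (midpoint ℝ (refVertex (k + 1)) (refVertex (k + 2))) c) ∈ polyFun 2 := by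
    intro k
    have a1 := polyFun_mul (bary_mem_polyFun k) (polyFun_sub (polyFun_const_mul 2
      (bary_mem_polyFun k)) (polyFun_const 1 1))
    have a2 := polyFun_mul (polyFun_const_mul 4 (bary_mem_polyFun (k + 1)))
      (bary_mem_polyFun (k + 2))
    have b1 := polyFun_mul a1 (polyFun_const 0 (g (refVertex k) c))
    have b2 := polyFun_mul a2
      (polyFun_const 0 (g (midpoint ℝ (refVertex (k + 1)) (refVertex (k + 2))) c))
    exact polyFun_add b1 b2
  have h := (polyFun 2).sum_mem fun k (_ : k ∈ Finset.univ) => h1 k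
  convert h using 1
  ext x
  simp [quadInterp, Finset.sum_apply]

namespace AffineMesh

variable {N : ℕ} (M : AffineMesh N) (i : Fin N)

/-- The linear part of the affine map `M.map i`. -/
def lin : Plane →L[ℝ] Plane :=
  (EuclideanSpace.proj (𝕜 := ℝ) (0 : Fin 2)).smulRight (M.vert i 0 - M.vert i 2) +
    (EuclideanSpace.proj (𝕜 := ℝ) (1 : Fin 2)).smulRight (M.vert i 1 - M.vert i 2)

lemma lin_apply (x : Plane) :
    M.lin i x = x 0 • (M.vert i 0 - M.vert i 2) + x 1 • (M.vert i 1 - M.vert i 2) := by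
  simp [lin]

lemma map_eq (x : Plane) : M.map i x = M.lin i x + M.vert i 2 := by
  simp only [map, Fin.sum_univ_three, bary, lin_apply, Matrix.cons_val_zero, Matrix.cons_val_one,
    Matrix.cons_val]
  module

lemma map_sub (x y : Plane) : M.map i x - M.map i y = M.lin i (x - y) := by
  rw [map_eq, map_eq, _root_.map_sub]; abel

lemma map_lineMap (x y : Plane) (t : ℝ) :
    M.map i (AffineMap.lineMap x y t) = AffineMap.lineMap (M.map i x) (M.map i y) t := by
  simp only [AffineMap.lineMap_apply, map_eq, vsub_eq_sub, vadd_eq_add, map_add, map_smul,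
    _root_.map_sub]
  module

lemma map_refVertex (k : Fin 3) : M.map i (refVertex k) = M.vert i k := by
  simp [map, bary_refVertex]

lemma map_midpoint (x y : Plane) :
    M.map i (midpoint ℝ x y) = midpoint ℝ (M.map i x) (M.map i y) :=
  M.map_lineMap i x y _

lemma lin_injective : Function.Injective (M.lin i) := by
  rw [injective_iff_map_eq_zero]
  intro x hx
  -- A vector in the kernel gives an affine dependence with weights of sum zero.
  have h := (affineIndependent_iff (k := ℝ)).1 (M.nondegenerate i) Finset.univ
    ![x 0, x 1, - x 0 - x 1] (by simp [Fin.sum_univ_three])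
    (by
      rw [lin_apply] at hx
      simp only [Fin.sum_univ_three, Matrix.cons_val_zero, Matrix.cons_val_one, Matrix.cons_val]
      rw [← hx]; module)
  ext j
  fin_cases j
  · exact h 0 (Finset.mem_univ _)
  · exact h 1 (Finset.mem_univ _)

/-- The linear part of `M.map i` as a linear equivalence. -/
def linEquiv : Plane ≃L[ℝ] Plane :=
  (LinearEquiv.ofInjectiveEndo (M.lin i : Plane →ₗ[ℝ] Plane)
    (M.lin_injective i)).toContinuousLinearEquiv

lemma linEquiv_apply (x : Plane) : M.linEquiv i x = M.lin i x := rfl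

/-- The affine map `M.map i` as a homeomorphism of the plane. -/
def mapHomeo : Plane ≃ₜ Plane :=
  (M.linEquiv i).toHomeomorph.trans (Homeomorph.addRight (M.vert i 2))

lemma mapHomeo_apply (x : Plane) : M.mapHomeo i x = M.map i x := (M.map_eq i x).symm

lemma coe_mapHomeo : ⇑(M.mapHomeo i) = M.map i := funext (M.mapHomeo_apply i)

lemma map_injective : Function.Injective (M.map i) := by
  rw [← coe_mapHomeo]; exact (M.mapHomeo i).injective

lemma continuous_map : Continuous (M.map i) := by
  rw [← coe_mapHomeo]; exact (M.mapHomeo i).continuous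

lemma hasFDerivAt_map (x : Plane) : HasFDerivAt (M.map i) (M.lin i) x := by
  have h : M.map i = fun x => M.lin i x + M.vert i 2 := funext (M.map_eq i)
  rw [h]
  exact (M.lin i).hasFDerivAt.add_const _

lemma tri_eq : M.tri i = M.map i '' refTri := by
  ext y
  rw [tri, mem_convexHull_range_fin_three]
  constructor
  · rintro ⟨w, hw, hs, rfl⟩
    exact ⟨∑ k, w k • refVertex k, mem_refTri.2 (by rw [bary_sum hs]; exact hw),
      by rw [map, bary_sum hs]⟩
  · rintro ⟨x, hx, rfl⟩
    exact ⟨bary x, mem_refTri.1 hx, sum_bary x, rfl⟩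

lemma map_mem_tri {x : Plane} : M.map i x ∈ M.tri i ↔ x ∈ refTri := by
  rw [tri_eq, (M.map_injective i).mem_set_image]

lemma isCompact_tri : IsCompact (M.tri i) := (finite_range _).isCompact_convexHull ℝ

lemma isClosed_tri : IsClosed (M.tri i) := (M.isCompact_tri i).isClosed

lemma convex_tri : Convex ℝ (M.tri i) := convex_convexHull ℝ _

lemma interior_tri : interior (M.tri i) = M.map i '' interior refTri := by
  rw [tri_eq, ← coe_mapHomeo, (M.mapHomeo i).image_interior]

lemma isOpen_domain : IsOpen M.domain := isOpen_interior

lemma interior_tri_subset_domain : interior (M.tri i) ⊆ M.domain :=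
  interior_mono (subset_iUnion _ i)

lemma tri_subset_closure_domain : M.tri i ⊆ closure M.domain := by
  have h : (interior (M.tri i)).Nonempty := by
    rw [interior_tri]; exact interior_refTri_nonempty.image _
  calc M.tri i ⊆ closure (M.tri i) := subset_closure
    _ = closure (interior (M.tri i)) :=
      ((M.convex_tri i).closure_interior_eq_closure_of_nonempty_interior h).symm
    _ ⊆ _ := closure_mono (M.interior_tri_subset_domain i)

/-! ### How the triangles of a conforming mesh meet -/

/-- The barycentric coordinates of the vertices spanning a face carry all the points of the face. -/
lemma vert_mem_of_bary_ne_zero {S : Set Plane} (hS : S ⊆ range (M.vert i)) {x : Plane}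
    (hx : M.map i x ∈ convexHull ℝ S) {k : Fin 3} (hk : bary x k ≠ 0) : M.vert i k ∈ S := by
  by_contra hkS
  have hconv : Convex ℝ {x : Plane | bary x k = 0} := by
    intro x hx y hy a b _ _ hab
    obtain rfl : a = 1 - b := by linarith
    have h := bary_lineMap x y b k
    rw [AffineMap.lineMap_apply_module] at h
    simp only [mem_ofPred_eq] at hx hy ⊢
    rw [h, hx, hy]; ring
  have himg : Convex ℝ (M.map i '' {x : Plane | bary x k = 0}) := by
    rintro _ ⟨x, hx, rfl⟩ _ ⟨y, hy, rfl⟩ a b ha hb hab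
    refine ⟨a • x + b • y, hconv hx hy ha hb hab, ?_⟩
    obtain rfl : a = 1 - b := by linarith
    have h := M.map_lineMap i x y b
    rwa [AffineMap.lineMap_apply_module, AffineMap.lineMap_apply_module] at h
  -- Without vertex k, the set lies on the line carrying the opposite edge. This line is convex, so
  -- it also contains the hull.
  have hsub : S ⊆ M.map i '' {x : Plane | bary x k = 0} := by
    intro s hs
    obtain ⟨j, rfl⟩ := hS hs
    refine ⟨refVertex j, ?_, M.map_refVertex i j⟩
    rw [mem_ofPred_eq, bary_refVertex, if_neg]
    rintro rfl
    exact hkS hs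
  obtain ⟨z, hz, hzx⟩ := convexHull_min hsub himg hx
  exact hk ((M.map_injective i hzx) ▸ hz)

/-- A point of two triangles lies on the face spanned by common vertices. -/
lemma vert_mem_range {j : Fin N} (hij : i ≠ j) {x : Plane} (hx : x ∈ refTri)
    (hj : M.map i x ∈ M.tri j) {k : Fin 3} (hk : bary x k ≠ 0) :
    M.vert i k ∈ range (M.vert i) ∩ range (M.vert j) := by
  refine M.vert_mem_of_bary_ne_zero i inter_subset_left ?_ hk
  rw [← M.conforming i j hij]
  exact ⟨(M.map_mem_tri i).2 hx, hj⟩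

/-- Interior points of a triangle belong to no other triangle. -/
lemma map_notMem_tri {j : Fin N} (hij : i ≠ j) {x : Plane} (hx : ∀ k, 0 < bary x k) :
    M.map i x ∉ M.tri j := by
  intro hj
  have h : range (M.vert i) ⊆ range (M.vert j) := by
    rintro _ ⟨k, rfl⟩
    exact (M.vert_mem_range i hij (mem_refTri.2 fun k => (hx k).le) hj (hx k).ne').2
  refine M.distinct i j hij (Set.eq_of_subset_of_ncard_le h ?_ (finite_range _))
  rw [← image_univ, ← image_univ, Set.ncard_image_of_injective _ (M.nondegenerate i).injective,
    Set.ncard_image_of_injective _ (M.nondegenerate j).injective]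

/-- A point of the domain on the boundary of a triangle belongs to another triangle. -/
lemma exists_other_tri {x : Plane} {k : Fin 3} (hk : bary x k = 0)
    (hd : M.map i x ∈ M.domain) : ∃ j, i ≠ j ∧ M.map i x ∈ M.tri j := by
  -- The path leaves the triangle through the edge, away from the barycentre. Its points remain in
  -- the domain for small t, hence lie in other triangles, and these finitely many closed sets
  -- contain the limit.
  let p : ℝ → Plane := fun t => AffineMap.lineMap x (ctVertex 0) (-t)
  have hp : Continuous p := by
    unfold p
    exact AffineMap.lineMap_continuous.comp continuous_neg
  have hp0 : p 0 = x := by simp [p]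
  have hmem : ∀ᶠ t in 𝓝[>] (0 : ℝ), M.map i (p t) ∈ ⋃ j ∈ {j | i ≠ j}, M.tri j := by
    have h1 : ∀ᶠ t in 𝓝 (0 : ℝ), M.map i (p t) ∈ M.domain := by
      refine ((M.continuous_map i).comp hp).continuousAt.eventually_mem
        (M.isOpen_domain.mem_nhds ?_)
      simpa [hp0] using hd
    filter_upwards [nhdsWithin_le_nhds h1, self_mem_nhdsWithin] with t ht (ht0 : 0 < t)
    obtain ⟨j, hj⟩ := mem_iUnion.1 (interior_subset ht)
    refine mem_biUnion (x := j) ?_ hj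
    rintro rfl
    have h2 := mem_refTri.1 ((M.map_mem_tri i).1 hj) k
    rw [bary_lineMap, hk, bary_ctVertex_zero] at h2
    linarith
  have hlim : Tendsto (fun t => M.map i (p t)) (𝓝[>] 0) (𝓝 (M.map i x)) := by
    have := (((M.continuous_map i).comp hp).tendsto 0).mono_left
      (nhdsWithin_le_nhds (s := Ioi (0 : ℝ)))
    rwa [Function.comp_apply, hp0] at this
  have hcl : IsClosed (⋃ j ∈ {j | i ≠ j}, M.tri j) :=
    (toFinite _).isClosed_biUnion fun j _ => M.isClosed_tri j
  simpa using hcl.mem_of_tendsto hlim hmem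

end AffineMesh

/-! ### The isoparametric maps send the polygonal domain into the computational domain -/

/-- The linear parts of the barycentric coordinates. -/
def baryLin : Fin 3 → Plane →L[ℝ] ℝ :=
  ![EuclideanSpace.proj (0 : Fin 2), EuclideanSpace.proj (1 : Fin 2),
    -EuclideanSpace.proj (0 : Fin 2) - EuclideanSpace.proj (1 : Fin 2)]

lemma bary_add (x v : Plane) (k : Fin 3) : bary (x + v) k = bary x k + baryLin k v := by
  fin_cases k <;> simp [bary, baryLin] <;> ring

lemma hasFDerivAt_bary (k : Fin 3) (x : Plane) :
    HasFDerivAt (fun x => bary x k) (baryLin k) x := by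
  have h : (fun x => bary x k) = fun x => bary 0 k + baryLin k x := by
    ext x; rw [← bary_add, zero_add]
  rw [h]
  exact (baryLin k).hasFDerivAt.const_add _

lemma det_id_add_smulRight (l : Plane →L[ℝ] ℝ) (e : Plane) :
    (ContinuousLinearMap.id ℝ Plane + l.smulRight e).det = 1 + l e := by
  have h := LinearMap.transvection.det (l : Plane →ₗ[ℝ] ℝ) e
  rw [ContinuousLinearMap.coe_coe] at h
  rw [← h, ContinuousLinearMap.det]
  congr 1

lemma fin_three_ne (k : Fin 3) : k + 1 ≠ k ∧ k + 2 ≠ k ∧ k + 1 ≠ k + 2 := by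
  revert k; decide

lemma det_comp (S T : Plane →L[ℝ] Plane) : (S.comp T).det = S.det * T.det := by
  simp [ContinuousLinearMap.det]

lemma bary_midpoint_refVertex (k j : Fin 3) :
    bary (midpoint ℝ (refVertex (k + 1)) (refVertex (k + 2))) j =
      if j = k then 0 else 1 / 2 := by
  rw [midpoint, bary_lineMap, bary_refVertex, bary_refVertex]
  fin_cases k <;> fin_cases j <;> simp <;> norm_num

namespace IsoMesh

variable {N : ℕ} (M : IsoMesh N) (i : Fin N)

/-- The displacement of the midpoint of the edge opposite to the vertex `k`. -/
def disp (k : Fin 3) : Plane :=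
  M.G (midpoint ℝ (M.vert i (k + 1)) (M.vert i (k + 2))) -
    midpoint ℝ (M.vert i (k + 1)) (M.vert i (k + 2))

/-- Quadratic interpolation reproduces affine maps and G fixes the vertices. Only the displacements
of the edge midpoints remain, each multiplied by the quadratic bubble of its edge. -/
lemma F_eq (x : Plane) : M.F i x = M.map i x +
    ∑ k, (4 * bary x (k + 1) * bary x (k + 2)) • M.disp i k := by
  simp only [F, AffineMesh.isoMap, quadInterp, Function.comp_apply, M.map_refVertex,
    M.map_midpoint, M.G_vert]
  have hs : bary x 2 = 1 - bary x 0 - bary x 1 := by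
    have := sum_bary_cyc x 0
    norm_num at this
    linarith
  simp only [Fin.sum_univ_three, disp, AffineMesh.map, midpoint_eq_smul_add,
    Fin.reduceAdd, zero_add, hs, invOf_eq_inv]
  module

/-- Curved edges are disjoint from the polygonal domain. -/
lemma map_notMem_domain {k : Fin 3} (hd : M.disp i k ≠ 0) {x : Plane} (hx : x ∈ refTri)
    (hk : bary x k = 0) : M.map i x ∉ M.domain := by
  intro hdom
  -- Moving x slightly towards the midpoint of its edge keeps it in the domain and makes both
  -- remaining coordinates positive. Another triangle containing the new point then shares both
  -- endpoints of the edge, so G fixes the midpoint.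
  set m := midpoint ℝ (refVertex (k + 1)) (refVertex (k + 2)) with hm
  have hc : Continuous fun t : ℝ => M.map i (AffineMap.lineMap x m t) :=
    (M.continuous_map i).comp AffineMap.lineMap_continuous
  have h1 : ∀ᶠ t in 𝓝[>] (0 : ℝ), M.map i (AffineMap.lineMap x m t) ∈ M.domain :=
    nhdsWithin_le_nhds (hc.continuousAt.eventually_mem
      (M.isOpen_domain.mem_nhds (by simpa using hdom)))
  obtain ⟨t, htd, ht0, ht1⟩ := (h1.and (Ioo_mem_nhdsGT zero_lt_one)).exists
  have hb : ∀ j, bary (AffineMap.lineMap x m t) j =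
      bary x j + t * ((if j = k then 0 else 1 / 2) - bary x j) := fun j => by
    rw [bary_lineMap, bary_midpoint_refVertex]
  have hbk : bary (AffineMap.lineMap x m t) k = 0 := by rw [hb, hk]; simp
  have hbj : ∀ j, j ≠ k → 0 < bary (AffineMap.lineMap x m t) j := fun j hj => by
    rw [hb, if_neg hj]
    nlinarith [mem_refTri.1 hx j]
  have hmem : AffineMap.lineMap x m t ∈ refTri := mem_refTri.2 fun j => by
    by_cases hj : j = k
    · rw [hj, hbk]
    · exact (hbj j hj).le
  obtain ⟨j, hij, hj⟩ := M.exists_other_tri i hbk htd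
  exact hd (sub_eq_zero.2 (M.G_edge i j hij _ (M.vert_mem_range i hij hmem hj (hbj _ (fin_three_ne k).1).ne') _
    (M.vert_mem_range i hij hmem hj (hbj _ (fin_three_ne k).2.1).ne')))

/-- At most one edge of a triangle is curved. -/
lemma exists_disp_eq_zero : ∃ k, ∀ j, j ≠ k → M.disp i j = 0 := by
  by_contra! h
  obtain ⟨k, -, hk⟩ := h 0
  obtain ⟨l, hlk, hl⟩ := h k
  obtain ⟨m, hm⟩ := M.exists_interior_vert i
  -- Two different curved edges together contain all three vertices, so no vertex would be in the
  -- open domain.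
  have hv : M.vert i m ∉ M.domain := by
    rw [← M.map_refVertex i m]
    by_cases hmk : m = k
    · exact M.map_notMem_domain i hl (refVertex_mem_refTri m)
        (by rw [bary_refVertex, if_neg (by rw [hmk]; exact hlk)])
    · exact M.map_notMem_domain i hk (refVertex_mem_refTri m)
        (by rw [bary_refVertex, if_neg (Ne.symm hmk)])
  apply hm
  rw [frontier, M.isOpen_domain.interior_eq]
  exact ⟨M.tri_subset_closure_domain i (subset_convexHull ℝ _ (mem_range_self m)), hv⟩

lemma isPolyField_F : IsPolyField 2 (M.F i) := isPolyField_quadInterp _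

lemma contDiff_F {n : WithTop ℕ∞} : ContDiff ℝ n (M.F i) := (M.isPolyField_F i).contDiff

lemma differentiable_F : Differentiable ℝ (M.F i) := (M.isPolyField_F i).differentiable

lemma det_fderiv_F_pos {x : Plane} (hx : x ∈ refTri) : 0 < (fderiv ℝ (M.F i) x).det :=
  M.det_pos i x hx

/-- The derivative of `F_T` at a point of the reference triangle, as an equivalence. -/
def derivEquiv {x : Plane} (hx : x ∈ refTri) : Plane ≃L[ℝ] Plane :=
  (fderiv ℝ (M.F i) x).toContinuousLinearEquivOfDetNeZero (M.det_fderiv_F_pos i hx).ne'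

lemma hasStrictFDerivAt_F {x : Plane} (hx : x ∈ refTri) :
    HasStrictFDerivAt (M.F i) (M.derivEquiv i hx : Plane →L[ℝ] Plane) x := by
  have h := (M.contDiff_F i (n := 1)).contDiffAt.hasStrictFDerivAt (x := x) (by simp)
  have e : (M.derivEquiv i hx : Plane →L[ℝ] Plane) = fderiv ℝ (M.F i) x := by
    ext; rfl
  rwa [e]

lemma map_nhds_F {x : Plane} (hx : x ∈ refTri) : map (M.F i) (𝓝 x) = 𝓝 (M.F i x) :=
  (M.hasStrictFDerivAt_F i hx).map_nhds_eq_of_equiv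

/-- `F_T = F_T̃ ∘ Q` with `Q x = x + 4 b b' e` for two barycentric coordinates `b`, `b'`. -/
lemma exists_F_eq_map : ∃ (k : Fin 3) (e : Plane), M.lin i e = M.disp i k ∧
    ∀ x, M.F i x = M.map i (x + (4 * bary x (k + 1) * bary x (k + 2)) • e) := by
  obtain ⟨k, hk⟩ := M.exists_disp_eq_zero i
  have he : M.lin i ((M.linEquiv i).symm (M.disp i k)) = M.disp i k :=
    (M.linEquiv i).apply_symm_apply _
  refine ⟨k, (M.linEquiv i).symm (M.disp i k), he, fun x => ?_⟩
  rw [F_eq, Finset.sum_eq_single k (fun j _ hj => by rw [hk j hj, smul_zero]) (by simp),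
    M.map_eq, M.map_eq, map_add, map_smul, he]
  abel

/-- The derivative is the linear part composed with a rank-one perturbation of the identity, whose
determinant is one plus a trace. -/
lemma det_fderiv_F_eq {k : Fin 3} {e : Plane}
    (h : ∀ x, M.F i x = M.map i (x + (4 * bary x (k + 1) * bary x (k + 2)) • e)) (x : Plane) :
    (fderiv ℝ (M.F i) x).det = (M.lin i).det *
      (1 + 4 * (bary x (k + 1) * baryLin (k + 2) e + bary x (k + 2) * baryLin (k + 1) e)) := by
  have h1 := ((hasFDerivAt_bary (k + 1) x).const_mul 4).mul (hasFDerivAt_bary (k + 2) x)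
  have h2 := (hasFDerivAt_id x).add (h1.smul_const e)
  have h3 := (M.hasFDerivAt_map i _).comp x h2
  have h4 : M.F i = M.map i ∘ (id + fun x => (((fun x => 4 * bary x (k + 1)) *
    fun x => bary x (k + 2)) x) • e) := funext h
  rw [h4, h3.fderiv, det_comp, det_id_add_smulRight]
  simp
  ring_nf
  simp

/-- Near a boundary point away from the curved edge, `F_T` covers the affine triangle. -/
lemma image_F_mem_nhdsWithin {x : Plane} (hx : x ∈ refTri) (hb : ∃ k, bary x k = 0)
    (hd : M.map i x ∈ M.domain) :
    M.F i x = M.map i x ∧ M.elem i ∈ 𝓝[M.tri i] (M.map i x) := by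
  obtain ⟨k, e, he, hF⟩ := M.exists_F_eq_map i
  by_cases hk0 : M.disp i k = 0
  · have he0 : e = 0 := M.lin_injective i (by rw [he, hk0, map_zero])
    have : M.elem i = M.tri i := by
      rw [elem, M.tri_eq]
      exact image_congr fun y _ => by rw [hF, he0, smul_zero, add_zero]
    rw [this]
    exact ⟨by rw [hF, he0, smul_zero, add_zero], self_mem_nhdsWithin⟩
  · have hkpos : 0 < bary x k := lt_of_le_of_ne (mem_refTri.1 hx k) fun h =>
      M.map_notMem_domain i hk0 hx h.symm hd
    have hzero : bary x (k + 1) * bary x (k + 2) = 0 := by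
      obtain ⟨l, hl⟩ := hb
      rcases fin_three_cases l k with rfl | rfl | rfl
      · exact absurd hl hkpos.ne'
      · rw [hl, zero_mul]
      · rw [hl, mul_zero]
    have hFx : M.F i x = M.map i x := by
      rw [hF, mul_assoc, hzero, mul_zero, zero_smul, add_zero]
    -- Positivity of the Jacobian at the three vertices yields 1 + 4 λ(e) > 0 for the linear parts λ
    -- of the two coordinates in the bubble.
    have hdet : ∀ j, 0 < (M.lin i).det * (1 + 4 * (bary (refVertex j) (k + 1) *
        baryLin (k + 2) e + bary (refVertex j) (k + 2) * baryLin (k + 1) e)) := fun j => by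
      rw [← M.det_fderiv_F_eq i hF]; exact M.det_fderiv_F_pos i (refVertex_mem_refTri j)
    obtain ⟨hk1, hk2, hk12⟩ := fin_three_ne k
    have h0 := hdet k
    have h1 := hdet (k + 1)
    have h2 := hdet (k + 2)
    simp only [bary_refVertex, if_neg hk1, if_neg hk2, if_neg hk12, if_neg hk12.symm, if_true,
      zero_mul, one_mul, add_zero, zero_add, mul_zero, mul_one] at h0 h1 h2
    have hδ2 : 0 < 1 + 4 * baryLin (k + 2) e := pos_of_mul_pos_right h1 h0.le
    have hδ1 : 0 < 1 + 4 * baryLin (k + 1) e := pos_of_mul_pos_right h2 h0.le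
    have hfac : ∀ s δ : ℝ, 0 ≤ s → s ≤ 1 → 0 < 1 + 4 * δ → 0 < 1 + 4 * s * δ := by
      intro s δ hs0 hs1 hδ
      rcases le_total 0 δ with h | h
      · positivity
      · nlinarith [mul_nonneg (sub_nonneg.2 hs1) (neg_nonneg.2 h)]
    have hev : ∀ j l, 0 < 1 + 4 * baryLin l e →
        ∀ᶠ p in 𝓝 x, 0 < 1 + 4 * bary p j * baryLin l e := fun j l hl =>
      continuousAt_const.eventually_lt (Continuous.continuousAt
        (((continuous_const.mul (continuous_bary j)).mul continuous_const).const_add 1))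
        (hfac _ _ (mem_refTri.1 hx j) (bary_le_one hx j) hl)
    have hevk : ∀ᶠ p in 𝓝 x, 0 < bary p k :=
      continuousAt_const.eventually_lt (continuous_bary k).continuousAt hkpos
    refine ⟨hFx, ?_⟩
    -- Near F x every point is F p with p close to x. If F p is in the affine triangle, then b (1 +
    -- 4 b' λ(e)) ≥ 0 for each of the two coordinates b of p in the bubble, b' being the other one.
    -- The factor in parentheses is positive, so b ≥ 0 and p is in the reference triangle.
    rw [mem_nhdsWithin_iff_eventually, ← hFx, ← M.map_nhds_F i hx, eventually_map]
    filter_upwards [hevk, hev (k + 2) (k + 1) hδ1, hev (k + 1) (k + 2) hδ2] with p hpk hp1 hp2 hp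
    refine mem_image_of_mem _ ?_
    rw [hF, M.map_mem_tri, mem_refTri] at hp
    have q1 := hp (k + 1)
    have q2 := hp (k + 2)
    rw [bary_add, map_smul, smul_eq_mul] at q1 q2
    have r1 : 0 ≤ bary p (k + 1) * (1 + 4 * bary p (k + 2) * baryLin (k + 1) e) := by linarith
    have r2 : 0 ≤ bary p (k + 2) * (1 + 4 * bary p (k + 1) * baryLin (k + 2) e) := by linarith
    refine mem_refTri.2 fun j => ?_
    rcases fin_three_cases j k with rfl | rfl | rfl
    · exact hpk.le
    · exact nonneg_of_mul_nonneg_left r1 hp1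
    · exact nonneg_of_mul_nonneg_left r2 hp2

/-- The union of the closed curved elements. -/
def union : Set Plane := ⋃ i, M.elem i

lemma elem_subset_union : M.elem i ⊆ M.union := subset_iUnion _ i

/-- `G_h` maps the polygonal domain into the computational domain. -/
theorem F_mem_compDomain {x : Plane} (hx : x ∈ refTri) (hd : M.map i x ∈ M.domain) :
    M.F i x ∈ M.compDomain := by
  rw [compDomain, mem_interior_iff_mem_nhds]
  change M.union ∈ _
  by_cases hpos : ∀ k, 0 < bary x k
  · refine mem_of_superset ?_ (M.elem_subset_union i)
    rw [← M.map_nhds_F i hx]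
    exact image_mem_map (mem_interior_iff_mem_nhds.1 (mem_interior_refTri_of_pos hpos))
  · have hzero : ∃ k, bary x k = 0 := by
      push Not at hpos
      obtain ⟨k, hk⟩ := hpos
      exact ⟨k, le_antisymm hk (mem_refTri.1 hx k)⟩
    -- The affine triangles together form a neighbourhood of the point. Each one containing the
    -- point is, near it, covered by its curved element, and F fixes the point.
    have hmem : M.union ∈ 𝓝 (M.map i x) := by
      have hK : (⋃ j, M.tri j) ∈ 𝓝 (M.map i x) := mem_interior_iff_mem_nhds.1 hd
      rw [← nhdsWithin_eq_nhds.2 hK, nhdsWithin_iUnion, mem_iSup]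
      intro j
      by_cases hj : M.map i x ∈ M.tri j
      · obtain ⟨y, hy, hyx⟩ := (M.tri_eq j ▸ hj : M.map i x ∈ M.map j '' refTri)
        rw [← hyx]
        refine mem_of_superset (M.image_F_mem_nhdsWithin j hy ?_ (hyx ▸ hd)).2
          (M.elem_subset_union j)
        by_contra! hne
        have hy' : ∀ k, 0 < bary y k := fun k =>
          lt_of_le_of_ne (mem_refTri.1 hy k) (hne k).symm
        by_cases hij : j = i
        · subst hij
          obtain ⟨k, hk⟩ := hzero
          exact hne k ((M.map_injective j hyx) ▸ hk)
        · exact M.map_notMem_tri j hij hy' (hyx ▸ (M.map_mem_tri i).2 hx)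
      · rw [notMem_closure_iff_nhdsWithin_eq_bot.1 ((M.isClosed_tri j).closure_eq.symm ▸ hj)]
        exact mem_bot
    rwa [(M.image_F_mem_nhdsWithin i hx hzero hd).1]

end IsoMesh

/-! ### Smooth approximation of compactly supported Lipschitz fields -/

open ContinuousLinearMap in
/-- Mollification of a vector field. -/
def mollify (η : ContDiffBump (0 : Plane)) (g : Plane → Plane) : Plane → Plane :=
  MeasureTheory.convolution (η.normed volume) g (lsmul ℝ ℝ) volume

lemma mollify_apply (η : ContDiffBump (0 : Plane)) (g : Plane → Plane) (x : Plane) :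
    mollify η g x = ∫ t, η.normed volume t • g (x - t) := rfl

lemma norm_mollify_le (η : ContDiffBump (0 : Plane)) {g : Plane → Plane} {B : ℝ}
    (hB : ∀ x, ‖g x‖ ≤ B) (x : Plane) : ‖mollify η g x‖ ≤ B := by
  rw [mollify_apply]
  have h : ∀ t, ‖η.normed volume t • g (x - t)‖ ≤ η.normed volume t * B := fun t => by
    rw [norm_smul, Real.norm_of_nonneg (η.nonneg_normed t)]
    exact mul_le_mul_of_nonneg_left (hB _) (η.nonneg_normed t)
  refine (norm_integral_le_of_norm_le (η.integrable_normed.mul_const B)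
    (Eventually.of_forall h)).trans (le_of_eq ?_)
  rw [integral_mul_const, η.integral_normed, one_mul]

lemma support_mollify_subset (η : ContDiffBump (0 : Plane)) {g : Plane → Plane} {S : Set Plane}
    (hg : Function.support g ⊆ S) {δ : ℝ} (hδ : η.rOut ≤ δ) :
    Function.support (mollify η g) ⊆ Metric.cthickening δ S := by
  intro x hx
  obtain ⟨t, ht, s, hs, rfl⟩ := Set.mem_add.1 (support_convolution_subset _ hx)
  rw [η.support_normed_eq, mem_ball_zero_iff] at ht
  refine Metric.mem_cthickening_of_dist_le (t + s) s δ S (hg hs) ?_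
  rw [dist_eq_norm, add_sub_cancel_right]
  exact (ht.trans_le hδ).le

/-- Mollifications converge almost everywhere for locally integrable fields. Boundedness and compact
support give the dominating function: the constant 2 B on a closed thickening of the support.
Continuity is not assumed, so the lemma also applies to gradients of Lipschitz fields. -/
lemma tendsto_eLpNorm_mollify {η : ℕ → ContDiffBump (0 : Plane)} {g : Plane → Plane} {B : ℝ}
    (hr : Tendsto (fun n => (η n).rOut) atTop (𝓝 0)) (hη : ∀ n, (η n).rOut ≤ 2 * (η n).rIn)
    (hm : Measurable g) (hB : ∀ x, ‖g x‖ ≤ B) {S : Set Plane} (hS : IsCompact S)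
    (hg : Function.support g ⊆ S) {δ : ℝ} (hδ : ∀ n, (η n).rOut ≤ δ) :
    Tendsto (fun n => eLpNorm (g - mollify (η n) g) 2 volume) atTop (𝓝 0) := by
  have hB0 : 0 ≤ B := (norm_nonneg _).trans (hB 0)
  have hδ0 : 0 ≤ δ := (η 0).rOut_pos.le.trans (hδ 0)
  have hloc : LocallyIntegrable g volume :=
    (memLp_top_of_bound hm.aestronglyMeasurable B (Eventually.of_forall hB)).locallyIntegrable
      le_top
  set T := Metric.cthickening δ S with hT
  have hTc : IsCompact T := hS.cthickening
  have hae := ContDiffBump.ae_convolution_tendsto_right_of_locallyIntegrable hr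
    (Eventually.of_forall hη) hloc
  have hcont : ∀ n, Continuous (mollify (η n) g) := fun n =>
    (η n).hasCompactSupport_normed.continuous_convolution_left _ (η n).continuous_normed hloc
  have hbound : ∀ n, ∀ᵐ x, ‖(g - mollify (η n) g) x‖ₑ ^ (2 : ℝ) ≤
      T.indicator (fun _ => ENNReal.ofReal (2 * B) ^ (2 : ℝ)) x := fun n => by
    refine Eventually.of_forall fun x => ?_
    by_cases hx : x ∈ T
    · rw [indicator_of_mem hx]
      refine ENNReal.rpow_le_rpow ?_ (by norm_num)
      rw [← ofReal_norm]
      refine ENNReal.ofReal_le_ofReal ((norm_sub_le _ _).trans ?_)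
      linarith [hB x, norm_mollify_le (η n) hB x]
    · have h1 : g x = 0 := by
        by_contra h
        exact hx (Metric.self_subset_cthickening S (hg h))
      have h2 : mollify (η n) g x = 0 := by
        by_contra h
        exact hx (support_mollify_subset (η n) hg (hδ n) h)
      simp [h1, h2]
  have hlim : ∀ᵐ x, Tendsto (fun n => ‖(g - mollify (η n) g) x‖ₑ ^ (2 : ℝ)) atTop (𝓝 0) := by
    filter_upwards [hae] with x hx
    have h1 : Tendsto (fun n => (g - mollify (η n) g) x) atTop (𝓝 0) := by
      have := (tendsto_const_nhds (x := g x)).sub hx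
      rwa [sub_self] at this
    have h2 := ((ENNReal.continuous_rpow_const (y := 2)).tendsto _).comp
      ((continuous_enorm.tendsto _).comp h1)
    simpa [Function.comp_def] using h2
  have hd := tendsto_lintegral_of_dominated_convergence' _
    (fun n => ((hm.aestronglyMeasurable.sub (hcont n).aestronglyMeasurable).enorm.pow_const 2))
    hbound (by
      rw [lintegral_indicator hTc.measurableSet, lintegral_const, Measure.restrict_apply_univ]
      exact ENNReal.mul_ne_top
        (ENNReal.rpow_ne_top_of_nonneg (by norm_num) ENNReal.ofReal_ne_top) hTc.measure_ne_top) hlim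
  have hs : ∀ n, eLpNorm (g - mollify (η n) g) 2 volume =
      (∫⁻ x, ‖(g - mollify (η n) g) x‖ₑ ^ (2 : ℝ)) ^ (1 / 2 : ℝ) := fun n => by
    rw [eLpNorm_eq_lintegral_rpow_enorm_toReal (by norm_num) (by norm_num)]
    simp
  simp only [hs]
  have := ((ENNReal.continuous_rpow_const (y := 1 / 2)).tendsto _).comp hd
  simpa [Function.comp_def] using this

-- The derivative is put on the field and not on the kernel: a Lipschitz field is differentiable
-- almost everywhere by Rademacher's theorem, and its Lipschitz constant dominates the difference
-- quotients.
open scoped NNReal in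
lemma partialD_mollify (η : ContDiffBump (0 : Plane)) {ψ : Plane → Plane} {K : ℝ≥0}
    (hψ : LipschitzWith K ψ) (j : Fin 2) :
    partialD j (mollify η ψ) = mollify η (partialD j ψ) := by
  ext1 x
  have hmp : Measure.QuasiMeasurePreserving (fun t : Plane => x - t) volume volume :=
    (Measure.measurePreserving_sub_left volume x).quasiMeasurePreserving
  have hmeas : Measurable (fderiv ℝ ψ) := measurable_fderiv ℝ ψ
  have key := hasFDerivAt_integral_of_dominated_loc_of_lip (𝕜 := ℝ) (μ := volume) (x₀ := x)
    (s := univ) (F := fun x t => η.normed volume t • ψ (x - t))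
    (F' := fun t => η.normed volume t • fderiv ℝ ψ (x - t))
    (bound := fun t => η.normed volume t * K) univ_mem
    (Eventually.of_forall fun y => (η.continuous_normed.smul
      (hψ.continuous.comp (continuous_const.sub continuous_id))).aestronglyMeasurable)
    ((η.continuous_normed.smul (hψ.continuous.comp
      (continuous_const.sub continuous_id))).integrable_of_hasCompactSupport
        η.hasCompactSupport_normed.smul_right)
    (η.continuous_normed.measurable.smul
      (hmeas.comp (measurable_const.sub measurable_id))).aestronglyMeasurable
    (Eventually.of_forall fun t => by
      refine (LipschitzWith.of_dist_le_mul fun y z => ?_).lipschitzOnWith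
      have hK : |η.normed volume t * (K : ℝ)| = η.normed volume t * K :=
        abs_of_nonneg (mul_nonneg (η.nonneg_normed t) K.2)
      rw [dist_smul₀, Real.coe_nnabs, hK, Real.norm_of_nonneg (η.nonneg_normed t), mul_assoc]
      refine mul_le_mul_of_nonneg_left ?_ (η.nonneg_normed t)
      simpa using hψ.dist_le_mul (y - t) (z - t))
    (η.integrable_normed.mul_const _)
    (by
      filter_upwards [hmp.ae hψ.ae_differentiableAt] with t ht
      have h1 : HasFDerivAt (fun y => ψ (y - t)) (fderiv ℝ ψ (x - t)) x :=
        
        (hasFDerivAt_comp_sub t).2 ht.hasFDerivAt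
      exact h1.const_smul (η.normed volume t))
  have e : mollify η ψ = fun x => ∫ t, η.normed volume t • ψ (x - t) := rfl
  rw [partialD, e, key.2.fderiv, ContinuousLinearMap.integral_apply key.1, mollify_apply]
  rfl

-- Mollification with radius δ / (n + 1), where the closed δ-thickening of the support is still
-- inside U. By `partialD_mollify` the gradients are mollified as well, so the same L² convergence
-- result applies to the field and to its derivatives.
open scoped NNReal in
theorem exists_smooth_approx {ψ : Plane → Plane} {K : ℝ≥0} (hψ : LipschitzWith K ψ)
    (hc : HasCompactSupport ψ) {U : Set Plane} (hU : IsOpen U) (hs : tsupport ψ ⊆ U) :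
    ∃ φ : ℕ → Plane → Plane,
      (∀ n, ContDiff ℝ ∞ (φ n) ∧ HasCompactSupport (φ n) ∧ tsupport (φ n) ⊆ U) ∧
      Tendsto (fun n => eLpNorm (ψ - φ n) 2 volume) atTop (𝓝 0) ∧
      ∀ j, Tendsto (fun n => eLpNorm (partialD j ψ - partialD j (φ n)) 2 volume) atTop (𝓝 0) := by
  obtain ⟨δ, hδ, hδU⟩ := hc.isCompact.exists_cthickening_subset_open hU hs
  let η : ℕ → ContDiffBump (0 : Plane) := fun n =>
    { rIn := δ / (n + 1) / 2
      rOut := δ / (n + 1)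
      rIn_pos := by positivity
      rIn_lt_rOut := half_lt_self (by positivity) }
  have hr : Tendsto (fun n => (η n).rOut) atTop (𝓝 0) := by
    have h := (tendsto_one_div_add_atTop_nhds_zero_nat (𝕜 := ℝ)).const_mul δ
    simpa [η, div_eq_mul_inv] using h
  have hη : ∀ n, (η n).rOut ≤ 2 * (η n).rIn := fun n => by
    change δ / (n + 1) ≤ 2 * (δ / (n + 1) / 2)
    linarith
  have hrδ : ∀ n, (η n).rOut ≤ δ := fun n => div_le_self hδ.le (by simp)
  obtain ⟨B, hB⟩ := hc.exists_bound_of_continuous hψ.continuous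
  have hloc : LocallyIntegrable ψ volume := hψ.continuous.locallyIntegrable
  have hsub : ∀ n, tsupport (mollify (η n) ψ) ⊆ Metric.cthickening δ (tsupport ψ) := fun n =>
    closure_minimal (support_mollify_subset (η n) (subset_tsupport ψ) (hrδ n))
      Metric.isClosed_cthickening
  refine ⟨fun n => mollify (η n) ψ, fun n => ⟨?_, ?_, (hsub n).trans hδU⟩, ?_, fun j => ?_⟩
  · exact (η n).hasCompactSupport_normed.contDiff_convolution_left _ (η n).contDiff_normed hloc
  · exact HasCompactSupport.of_support_subset_isCompact hc.isCompact.cthickening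
      (subset_closure.trans (hsub n))
  · exact tendsto_eLpNorm_mollify hr hη hψ.continuous.measurable hB hc.isCompact
      (subset_tsupport ψ) hrδ
  · simp only [partialD_mollify _ hψ]
    refine tendsto_eLpNorm_mollify (B := K) hr hη ?_ (fun x => ?_) hc.isCompact ?_ hrδ
    · exact measurable_fderiv_apply_const ℝ ψ _
    · refine ((fderiv ℝ ψ x).le_opNorm _).trans ?_
      simpa using norm_fderiv_le_of_lipschitz ℝ hψ
    · intro x hx
      apply support_fderiv_subset ℝ (f := ψ)
      intro h
      exact hx (by rw [partialD, h]; rfl)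

/-! ### Limits of Lipschitz fields -/

open scoped NNReal in
/-- `H¹` limits of Lipschitz fields with compact support in `U` belong to `H¹₀(U)`. -/
theorem HasH10Grad.of_lipschitz {U : Set Plane} (hU : IsOpen U) {u : Plane → Plane}
    {g : Fin 2 → Plane → Plane} (hu : MemLp u 2 (volume.restrict U))
    (hg : ∀ j, MemLp (g j) 2 (volume.restrict U)) {ψ : ℕ → Plane → Plane}
    (hψ : ∀ n, (∃ K : ℝ≥0, LipschitzWith K (ψ n)) ∧ HasCompactSupport (ψ n) ∧ tsupport (ψ n) ⊆ U)
    (h : Tendsto (fun n => eLpNorm (u - ψ n) 2 (volume.restrict U)) atTop (𝓝 0))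
    (h' : ∀ j, Tendsto (fun n => eLpNorm (g j - partialD j (ψ n)) 2 (volume.restrict U))
      atTop (𝓝 0)) : HasH10Grad U u g := by
  -- Diagonal choice: the n-th Lipschitz field is replaced by a smooth one within 1 / n in H¹.
  have key : ∀ n : ℕ, ∃ φ : Plane → Plane,
      (ContDiff ℝ ∞ φ ∧ HasCompactSupport φ ∧ tsupport φ ⊆ U) ∧
      eLpNorm (ψ n - φ) 2 volume ≤ (n : ℝ≥0∞)⁻¹ ∧
      ∀ j, eLpNorm (partialD j (ψ n) - partialD j φ) 2 volume ≤ (n : ℝ≥0∞)⁻¹ := fun n => by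
    obtain ⟨⟨K, hK⟩, hc, hs⟩ := hψ n
    obtain ⟨φ, hφ, h1, h2⟩ := exists_smooth_approx hK hc hU hs
    have hpos : (0 : ℝ≥0∞) < (n : ℝ≥0∞)⁻¹ := ENNReal.inv_pos.2 (ENNReal.natCast_ne_top n)
    obtain ⟨m, hm1, hm2⟩ := ((h1.eventually_le_const hpos).and
      (eventually_all.2 fun j => (h2 j).eventually_le_const hpos)).exists
    exact ⟨φ m, hφ m, hm1, hm2⟩
  choose φ hφ h1 h2 using key
  refine ⟨hu, hg, φ, hφ, ?_, fun j => ?_⟩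
  · refine tendsto_of_tendsto_of_tendsto_of_le_of_le tendsto_const_nhds
      (by simpa using h.add ENNReal.tendsto_inv_nat_nhds_zero) (fun n => zero_le) fun n => ?_
    have e : u - φ n = (u - ψ n) + (ψ n - φ n) := by abel
    obtain ⟨K, hK⟩ := (hψ n).1
    simp only [e]
    refine (eLpNorm_add_le (hu.1.sub hK.continuous.aestronglyMeasurable)
      (hK.continuous.sub (hφ n).1.continuous).aestronglyMeasurable (by norm_num)).trans ?_
    gcongr
    exact (eLpNorm_mono_measure _ Measure.restrict_le_self).trans (h1 n)
  · refine tendsto_of_tendsto_of_tendsto_of_le_of_le tendsto_const_nhds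
      (by simpa using (h' j).add ENNReal.tendsto_inv_nat_nhds_zero) (fun n => zero_le)
      fun n => ?_
    have e : g j - partialD j (φ n) =
        (g j - partialD j (ψ n)) + (partialD j (ψ n) - partialD j (φ n)) := by abel
    have hm : Measurable (partialD j (ψ n)) := measurable_fderiv_apply_const ℝ (ψ n) _
    simp only [e]
    refine (eLpNorm_add_le ((hg j).1.sub hm.aestronglyMeasurable)
      (hm.aestronglyMeasurable.sub (continuous_partialD (hφ n).1 j).aestronglyMeasurable)
      (by norm_num)).trans ?_
    gcongr
    exact (eLpNorm_mono_measure _ Measure.restrict_le_self).trans (h2 n j)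

open scoped NNReal in
/-- A map that is Lipschitz on each set of a finite closed cover of a normed space is Lipschitz. -/
lemma lipschitzWith_of_closed_cover {ι E F : Type*} [Finite ι] [NormedAddCommGroup E]
    [NormedSpace ℝ E] [NormedAddCommGroup F] {S : ι → Set E} (hS : ∀ i, IsClosed (S i))
    (hcov : ⋃ i, S i = univ) {f : E → F} {K : ℝ≥0} (hf : ∀ i, LipschitzOnWith K f (S i)) :
    LipschitzWith K f := by
  have hcont : Continuous f := (locallyFinite_of_finite S).continuous hcov hS
    fun i => (hf i).continuousOn
  refine LipschitzWith.of_dist_le_mul fun y x => ?_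
  refine le_of_forall_pos_le_add fun ε hε => ?_
  let γ : ℝ → E := AffineMap.lineMap x y
  have hγ : Continuous γ := AffineMap.lineMap_continuous
  -- Along the segment from x to y, the right lower slope of the norm of f(γ t) - f(x) is at most K
  -- times the length. The additional ε makes the comparison slope strictly larger.
  have h := image_norm_le_of_liminf_right_slope_norm_lt_deriv_boundary (a := 0) (b := 1)
    (f := fun t => f (γ t) - f x) (f' := fun _ => K * dist y x)
    (B := fun t => (K * dist y x + ε) * t) (B' := fun _ => K * dist y x + ε)
    ((hcont.comp hγ).sub continuous_const).continuousOn ?_ (by simp [γ])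
    (by fun_prop) (fun t _ => by
      simpa using ((hasDerivAt_id t).const_mul (K * dist y x + ε)).hasDerivWithinAt)
    (fun _ _ _ => by linarith) (right_mem_Icc.2 zero_le_one)
  · simpa [γ, dist_eq_norm] using h
  · intro t _ r hr
    -- The cover is finite, so one closed set contains points of the segment arbitrarily close to t
    -- on the right, hence also the point at t. The Lipschitz bound on that set controls the slope.
    have hex : ∃ i, ∃ᶠ z in 𝓝[>] t, γ z ∈ S i := by
      by_contra! hne
      obtain ⟨z, hz⟩ := (eventually_all.2 hne).exists
      obtain ⟨i, hi⟩ := mem_iUnion.1 (hcov.symm ▸ mem_univ (γ z))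
      exact hz i hi
    obtain ⟨i, hi⟩ := hex
    have hti : γ t ∈ S i := (hS i).mem_of_frequently_of_tendsto hi
      (hγ.continuousAt.tendsto.mono_left nhdsWithin_le_nhds)
    refine (hi.and_eventually self_mem_nhdsWithin).mono fun z ⟨hz, (htz : t < z)⟩ => ?_
    have hzt : 0 < z - t := sub_pos.2 htz
    refine lt_of_le_of_lt ?_ hr
    rw [slope_def_field, div_le_iff₀ hzt]
    refine (norm_sub_norm_le _ _).trans ?_
    have h1 := (hf i).dist_le_mul _ hz _ hti
    simp only [γ, dist_lineMap_lineMap, Real.dist_eq, abs_of_pos hzt] at h1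
    rw [sub_sub_sub_cancel_right, ← dist_eq_norm]
    refine h1.trans (le_of_eq ?_)
    rw [dist_comm x y]; ring

open scoped NNReal in
/-- An injective map on a convex compact set that is a local diffeomorphism has a Lipschitz
inverse. -/
lemma exists_antilipschitz {E F : Type*} [NormedAddCommGroup E] [NormedSpace ℝ E]
    [CompleteSpace E] [NormedAddCommGroup F] [NormedSpace ℝ F] {S : Set E} (hS : IsCompact S)
    {f : E → F} (hf : Continuous f) (hinj : InjOn f S)
    (hd : ∀ x ∈ S, ∃ f' : E ≃L[ℝ] F, HasStrictFDerivAt f (f' : E →L[ℝ] F) x) :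
    ∃ K : ℝ, 0 ≤ K ∧ ∀ x ∈ S, ∀ y ∈ S, dist x y ≤ K * dist (f x) (f y) := by
  -- Compactness of the square of S reduces the bound to neighbourhoods of pairs. At a diagonal
  -- pair, strict differentiability with invertible derivative gives it; off the diagonal,
  -- injectivity keeps the images apart and continuity extends the bound.
  have key := (hS.prod hS).induction_on
    (p := fun T => ∃ K : ℝ, 0 ≤ K ∧ ∀ z ∈ T, z ∈ S ×ˢ S → dist z.1 z.2 ≤ K * dist (f z.1) (f z.2))
    ⟨0, le_rfl, by simp⟩
    (fun T T' hT ⟨K, hK, h⟩ => ⟨K, hK, fun z hz => h z (hT hz)⟩)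
    (fun T T' ⟨K, hK, h⟩ ⟨K', hK', h'⟩ => ⟨max K K', le_max_of_le_left hK, fun z hz hzS => by
      rcases hz with hz | hz
      · exact (h z hz hzS).trans (mul_le_mul_of_nonneg_right (le_max_left _ _) dist_nonneg)
      · exact (h' z hz hzS).trans (mul_le_mul_of_nonneg_right (le_max_right _ _) dist_nonneg)⟩)
    ?_
  · obtain ⟨K, hK, h⟩ := key
    exact ⟨K, hK, fun x hx y hy => h (x, y) ⟨hx, hy⟩ ⟨hx, hy⟩⟩
  · rintro ⟨x, y⟩ ⟨hx, hy⟩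
    by_cases hxy : x = y
    · subst hxy
      obtain ⟨f', hf'⟩ := hd x hx
      obtain ⟨c, hc, s, hs, hA⟩ : ∃ K : ℝ≥0, True ∧ ∃ s ∈ 𝓝 x, AntilipschitzWith K (s.domRestrict f) := by
        rcases subsingleton_or_nontrivial E with hE | hE
        · exact ⟨0, trivial, univ, univ_mem, AntilipschitzWith.of_subsingleton⟩
        · have hpos : 0 < ‖(f'.symm : F →L[ℝ] E)‖₊⁻¹ / 2 := by
            have := f'.nnnorm_symm_pos
            positivity
          obtain ⟨s, hs, hA⟩ := hf'.approximates_deriv_on_nhds (c := ‖(f'.symm : F →L[ℝ] E)‖₊⁻¹ / 2)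
            (Or.inr hpos)
          exact ⟨_, trivial, s, hs, hA.antilipschitz (Or.inr (NNReal.half_lt_self (by
            have := f'.nnnorm_symm_pos; positivity)))⟩
      refine ⟨s ×ˢ s, mem_nhdsWithin_of_mem_nhds (prod_mem_nhds hs hs), c, c.2, ?_⟩
      rintro ⟨a, b⟩ ⟨ha, hb⟩ -
      exact hA.le_mul_dist ⟨a, ha⟩ ⟨b, hb⟩
    · have hne : 0 < dist (f x) (f y) := dist_pos.2 fun h => hxy (hinj hx hy h)
      obtain ⟨K, hK⟩ : ∃ K : ℝ, dist x y / dist (f x) (f y) < K := exists_gt _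
      have hK0 : 0 ≤ K := (by positivity : (0 : ℝ) ≤ dist x y / dist (f x) (f y)).trans hK.le
      rw [div_lt_iff₀ hne] at hK
      refine ⟨{z | dist z.1 z.2 < K * dist (f z.1) (f z.2)}, mem_nhdsWithin_of_mem_nhds
        ((isOpen_lt (by fun_prop) (by fun_prop)).mem_nhds hK), K, hK0, fun z hz _ => le_of_lt hz⟩

/-! ### Transfer of fields by the isoparametric maps -/

namespace IsoMesh

variable {N : ℕ} (M : IsoMesh N) (i : Fin N)

/-- The chain rule for fields given through their pull-back to the reference triangle. -/
lemma hasFDerivAt_of_comp_F {x : Plane} (hx : x ∈ refTri) {f g : Plane → Plane}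
    (hfg : ∀ᶠ z in 𝓝 x, f (M.F i z) = g z) (hg : DifferentiableAt ℝ g x) :
    HasFDerivAt f ((fderiv ℝ g x).comp ((M.derivEquiv i hx).symm : Plane →L[ℝ] Plane))
      (M.F i x) := by
  have hF := M.hasStrictFDerivAt_F i hx
  set R := hF.localInverse (M.F i) _ x with hR
  have hRx : R (M.F i x) = x := hF.localInverse_apply_image
  have hR' : HasFDerivAt R ((M.derivEquiv i hx).symm : Plane →L[ℝ] Plane) (M.F i x) :=
    hF.to_localInverse.hasFDerivAt
  have hcomp := HasFDerivAt.comp (M.F i x) (hRx.symm ▸ hg.hasFDerivAt : HasFDerivAt g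
    (fderiv ℝ g x) (R (M.F i x))) hR'
  refine hcomp.congr_of_eventuallyEq ?_
  have hRt : Tendsto R (𝓝 (M.F i x)) (𝓝 x) := by
    have := hR'.continuousAt.tendsto
    rwa [hRx] at this
  have h1 : ∀ᶠ y in 𝓝 (M.F i x), f (M.F i (R y)) = g (R y) := hRt.eventually hfg
  filter_upwards [h1, hF.eventually_right_inverse] with y hy hy'
  rw [← hR] at hy'
  rw [Function.comp_apply, ← hy, hy']

/-- The inverse of `G_h`. -/
def inv (y : Plane) : Plane :=
  open scoped Classical in
  if h : ∃ p : Fin N × Plane, p.2 ∈ refTri ∧ M.F p.1 p.2 = y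
    then M.map h.choose.1 h.choose.2 else 0

/-- The chosen preimage may belong to a neighbouring element, but injectivity of G_h makes both
preimages the same point of the affine mesh. -/
lemma inv_F {x : Plane} (hx : x ∈ refTri) : M.inv (M.F i x) = M.map i x := by
  have h : ∃ p : Fin N × Plane, p.2 ∈ refTri ∧ M.F p.1 p.2 = M.F i x := ⟨(i, x), hx, rfl⟩
  rw [inv, dif_pos h]
  exact M.injective _ _ _ h.choose_spec.1 _ hx h.choose_spec.2

lemma F_injOn : InjOn (M.F i) refTri := fun x hx y hy h =>
  M.map_injective i (M.injective i i x hx y hy h)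

lemma isCompact_elem : IsCompact (M.elem i) := isCompact_refTri.image (M.contDiff_F i (n := 0)).continuous

lemma isClosed_elem : IsClosed (M.elem i) := (M.isCompact_elem i).isClosed

lemma isOpen_compDomain : IsOpen M.compDomain := isOpen_interior

open scoped NNReal in
lemma exists_lipschitzOnWith_inv : ∃ K : ℝ≥0, ∀ i, LipschitzOnWith K M.inv (M.elem i) := by
  have key : ∀ i, ∃ K : ℝ≥0, LipschitzOnWith K M.inv (M.elem i) := fun i => by
    obtain ⟨K, hK, h⟩ := exists_antilipschitz isCompact_refTri
      (M.contDiff_F i (n := 0)).continuous (M.F_injOn i)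
      fun x hx => ⟨_, M.hasStrictFDerivAt_F i hx⟩
    refine ⟨‖M.lin i‖₊ * K.toNNReal, LipschitzOnWith.of_dist_le_mul ?_⟩
    rintro _ ⟨x, hx, rfl⟩ _ ⟨y, hy, rfl⟩
    rw [M.inv_F i hx, M.inv_F i hy, dist_eq_norm, M.map_sub, NNReal.coe_mul, mul_assoc,
      Real.coe_toNNReal K hK]
    refine ((M.lin i).le_opNorm _).trans (mul_le_mul_of_nonneg_left ?_ (norm_nonneg _))
    rw [← dist_eq_norm]
    exact h x hx y hy
  choose K hK using key
  exact ⟨∑ i, K i, fun i => (hK i).weaken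
    (Finset.single_le_sum (fun j _ => zero_le) (Finset.mem_univ i))⟩

/-- The field `v ∘ G_h⁻¹` on the union of the elements, extended by zero. -/
def push (v : Plane → Plane) : Plane → Plane := M.union.indicator (v ∘ M.inv)

lemma F_mem_union {x : Plane} (hx : x ∈ refTri) : M.F i x ∈ M.union :=
  M.elem_subset_union i (mem_image_of_mem _ hx)

lemma push_F (v : Plane → Plane) {x : Plane} (hx : x ∈ refTri) :
    M.push v (M.F i x) = v (M.map i x) := by
  rw [push, indicator_of_mem (M.F_mem_union i hx), Function.comp_apply, M.inv_F i hx]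

lemma exists_of_mem_union {y : Plane} (hy : y ∈ M.union) : ∃ i, ∃ x ∈ refTri, M.F i x = y := by
  obtain ⟨i, x, hx, h⟩ := mem_iUnion.1 hy
  exact ⟨i, x, hx, h⟩

lemma push_congr {v w : Plane → Plane} (h : ∀ i, ∀ x ∈ refTri, v (M.map i x) = w (M.map i x)) :
    M.push v = M.push w := by
  ext1 y
  by_cases hy : y ∈ M.union
  · obtain ⟨i, x, hx, rfl⟩ := M.exists_of_mem_union hy
    rw [M.push_F i v hx, M.push_F i w hx, h i x hx]
  · rw [push, push, indicator_of_notMem hy, indicator_of_notMem hy]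

lemma push_add (v w : Plane → Plane) : M.push (v + w) = M.push v + M.push w :=
  indicator_add _ _ _

lemma push_smul (c : ℝ) (v : Plane → Plane) : M.push (c • v) = c • M.push v :=
  indicator_const_smul M.union c (v ∘ M.inv)

/-- Almost every point of an element is the image of an interior point. -/
lemma volume_elem_diff {S : Set Plane} (hS : volume (refTri \ S) = 0) :
    volume (M.elem i \ M.F i '' S) = 0 := by
  refine measure_mono_null ?_ (addHaar_image_eq_zero_of_differentiableOn_of_addHaar_eq_zero volume
    ((M.differentiable_F i).differentiableOn (s := refTri \ S)) hS)
  rintro _ ⟨⟨x, hx, rfl⟩, h⟩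
  exact ⟨x, ⟨hx, fun hxS => h ⟨x, hxS, rfl⟩⟩, rfl⟩

lemma volume_refTri_diff_interior : volume (refTri \ interior refTri) = 0 := by
  refine measure_mono_null ?_ (convex_refTri.addHaar_frontier volume)
  exact sdiff_subset_sdiff_left subset_closure

lemma ae_compDomain : ∀ᵐ y ∂(volume.restrict M.compDomain),
    ∃ i, ∃ x ∈ interior refTri, M.F i x = y := by
  rw [ae_restrict_iff' M.isOpen_compDomain.measurableSet]
  have h : volume (⋃ i, M.elem i \ M.F i '' interior refTri) = 0 :=
    measure_iUnion_null fun i => M.volume_elem_diff i volume_refTri_diff_interior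
  filter_upwards [compl_mem_ae_iff.2 h] with y hy hyd
  obtain ⟨i, hi⟩ := mem_iUnion.1 (interior_subset hyd)
  by_contra! hne
  exact hy (mem_iUnion.2 ⟨i, hi, fun ⟨x, hx, hxy⟩ => hne i x hx hxy⟩)

lemma hasFDerivAt_inv {x : Plane} (hx : x ∈ interior refTri) : DifferentiableAt ℝ M.inv (M.F i x) := by
  refine (M.hasFDerivAt_of_comp_F i (interior_subset hx) (g := M.map i) ?_
    (M.hasFDerivAt_map i x).differentiableAt).differentiableAt
  filter_upwards [isOpen_interior.mem_nhds hx] with z hz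
  exact M.inv_F i (interior_subset hz)

lemma elem_mem_nhds {x : Plane} (hx : x ∈ interior refTri) : M.elem i ∈ 𝓝 (M.F i x) := by
  rw [← M.map_nhds_F i (interior_subset hx)]
  exact image_mem_map (mem_interior_iff_mem_nhds.1 hx)

lemma sum_coord_smul_partialD (φ : Plane → Plane) (x e : Plane) :
    fderiv ℝ φ x e = ∑ k, e k • partialD k φ x := by
  have he : e = ∑ k, e k • EuclideanSpace.single k (1 : ℝ) := by
    ext j; fin_cases j <;> simp
  conv_lhs => rw [he]
  simp [partialD]

/-- The transformed gradient. -/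
def pushGrad (g : Fin 2 → Plane → Plane) (j : Fin 2) (y : Plane) : Plane :=
  ∑ k, (fderiv ℝ M.inv y (EuclideanSpace.single j 1)) k • g k (M.inv y)

lemma partialD_push {φ : Plane → Plane} (hφ : Differentiable ℝ φ) (j : Fin 2) {x : Plane}
    (hx : x ∈ interior refTri) : partialD j (M.push φ) (M.F i x) =
      M.pushGrad (fun k => partialD k φ) j (M.F i x) := by
  have h : M.push φ =ᶠ[𝓝 (M.F i x)] φ ∘ M.inv := by
    filter_upwards [M.elem_mem_nhds i hx] with y hy
    rw [push, indicator_of_mem (M.elem_subset_union i hy)]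
  rw [partialD, h.fderiv_eq, fderiv_comp _ (hφ _) (M.hasFDerivAt_inv i hx)]
  exact sum_coord_smul_partialD φ _ _

open scoped NNReal in
/-- Fields with compact support in the polygonal domain are transformed into Lipschitz fields with
compact support in the computational domain. -/
lemma push_lipschitz {φ : Plane → Plane} (hφ : ContDiff ℝ ∞ φ) (hc : HasCompactSupport φ)
    (hs : tsupport φ ⊆ M.domain) : (∃ K : ℝ≥0, LipschitzWith K (M.push φ)) ∧
      HasCompactSupport (M.push φ) ∧ tsupport (M.push φ) ⊆ M.compDomain := by
  obtain ⟨Kφ, hKφ⟩ := hφ.lipschitzWith_of_hasCompactSupport hc (by simp)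
  obtain ⟨K, hK⟩ := M.exists_lipschitzOnWith_inv
  -- The image under G_h of the support of φ inside the mesh: a compact subset of the computational
  -- domain.
  set Z := ⋃ i, M.F i '' (refTri ∩ M.map i ⁻¹' tsupport φ) with hZ
  have hZc : IsCompact Z := isCompact_iUnion fun i =>
    (isCompact_refTri.inter_right ((isClosed_tsupport φ).preimage (M.continuous_map i))).image
      (M.contDiff_F i (n := 0)).continuous
  have hZd : Z ⊆ M.compDomain := by
    rintro y hy
    obtain ⟨i, x, ⟨hx, hxs⟩, rfl⟩ := mem_iUnion.1 hy
    exact M.F_mem_compDomain i hx (hs hxs)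
  have hsupp : Function.support (M.push φ) ⊆ Z := by
    intro y hy
    have hyu : y ∈ M.union := by
      by_contra h
      exact hy (indicator_of_notMem h _)
    obtain ⟨i, x, hx, rfl⟩ := M.exists_of_mem_union hyu
    rw [Function.mem_support, M.push_F i φ hx] at hy
    exact mem_iUnion.2 ⟨i, x, ⟨hx, subset_tsupport φ hy⟩, rfl⟩
  refine ⟨⟨Kφ * K, ?_⟩, HasCompactSupport.of_support_subset_isCompact hZc hsupp,
    (closure_minimal hsupp hZc.isClosed).trans hZd⟩
  -- The cover consists of the closed elements, where the field is φ after a Lipschitz map, and the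
  -- complement of the computational domain, where it vanishes.
  refine lipschitzWith_of_closed_cover (ι := Option (Fin N))
    (S := fun o => o.elim M.compDomainᶜ M.elem) ?_ ?_ ?_
  · rintro (_ | i)
    · exact M.isOpen_compDomain.isClosed_compl
    · exact M.isClosed_elem i
  · rw [eq_univ_iff_forall]
    intro y
    by_cases hy : y ∈ M.compDomain
    · obtain ⟨i, hi⟩ := mem_iUnion.1 (interior_subset hy)
      exact mem_iUnion.2 ⟨some i, hi⟩
    · exact mem_iUnion.2 ⟨none, hy⟩
  · rintro (_ | i)
    · refine (LipschitzOnWith.of_dist_le_mul fun y hy z hz => ?_)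
      have h0 : ∀ y ∈ M.compDomainᶜ, M.push φ y = 0 := fun y hy => by
        by_contra h
        exact hy (hZd (hsupp h))
      rw [h0 y hy, h0 z hz, dist_self]
      positivity
    · have h := hKφ.comp_lipschitzOnWith (hK i)
      have he : EqOn (M.push φ) (φ ∘ M.inv) (M.elem i) := fun y hy =>
        indicator_of_mem (M.elem_subset_union i hy) _
      intro y hy z hz
      rw [he hy, he hz]
      exact h hy hz

end IsoMesh

/-! ### The transformed fields belong to `H¹₀` of the computational domain -/

lemma continuous_det : Continuous fun T : Plane →L[ℝ] Plane => T.det := by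
  have h : (fun T : Plane →L[ℝ] Plane => T.det) =
      fun T => entry 0 0 T * entry 1 1 T - entry 1 0 T * entry 0 1 T := by
    ext T; simp [det_eq_entries, entry_apply]
  rw [h]
  exact ((entry 0 0).continuous.mul (entry 1 1).continuous).sub
    ((entry 1 0).continuous.mul (entry 0 1).continuous)

namespace AffineMesh

variable {N : ℕ} (M : AffineMesh N) (i : Fin N)

lemma invFun_map : Function.invFun (M.map i) = (M.mapHomeo i).symm := by
  ext1 y
  apply M.map_injective i
  rw [← M.coe_mapHomeo, (M.mapHomeo i).apply_symm_apply]
  exact Function.invFun_eq ⟨(M.mapHomeo i).symm y, (M.mapHomeo i).apply_symm_apply y⟩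

lemma invFun_map_apply (x : Plane) : Function.invFun (M.map i) (M.map i x) = x :=
  Function.leftInverse_invFun (M.map_injective i) x

lemma mapHomeo_symm_apply (y : Plane) :
    (M.mapHomeo i).symm y = (M.linEquiv i).symm (y - M.vert i 2) := by
  apply (M.mapHomeo i).injective
  rw [Homeomorph.apply_symm_apply, mapHomeo_apply, map_eq, ← linEquiv_apply,
    ContinuousLinearEquiv.apply_symm_apply, sub_add_cancel]

lemma contDiff_invFun_map {n : WithTop ℕ∞} : ContDiff ℝ n (Function.invFun (M.map i)) := by
  have h : Function.invFun (M.map i) = fun y => (M.linEquiv i).symm (y - M.vert i 2) := by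
    rw [invFun_map]; ext1 y; exact M.mapHomeo_symm_apply i y
  rw [h]
  exact (M.linEquiv i).symm.contDiff.comp (contDiff_id.sub contDiff_const)

end AffineMesh

namespace IsoMesh

variable {N : ℕ} (M : IsoMesh N) (i : Fin N)

lemma contDiff_Gh {n : WithTop ℕ∞} : ContDiff ℝ n (M.Gh i) :=
  (M.contDiff_F i).comp (M.contDiff_invFun_map i)

lemma Gh_map (x : Plane) : M.Gh i (M.map i x) = M.F i x := by
  rw [Gh, Function.comp_apply, M.invFun_map_apply]

lemma exists_volume_image_Gh_le : ∃ c : ℝ≥0∞, c ≠ ⊤ ∧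
    ∀ S ⊆ M.tri i, MeasurableSet S → volume (M.Gh i '' S) ≤ c * volume S := by
  have hc : Continuous fun y => |(fderiv ℝ (M.Gh i) y).det| :=
    (continuous_det.comp ((M.contDiff_Gh i (n := 1)).continuous_fderiv (by simp))).abs
  obtain ⟨c, hc⟩ := (M.isCompact_tri i).bddAbove_image hc.continuousOn
  refine ⟨ENNReal.ofReal c, ENNReal.ofReal_ne_top, fun S hS hSm => ?_⟩
  refine (addHaar_image_le_lintegral_abs_det_fderiv volume hSm fun y _ =>
    ((M.contDiff_Gh i (n := 1)).differentiable (by simp) y).hasFDerivAt.hasFDerivWithinAt).trans ?_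
  rw [← setLIntegral_const]
  exact setLIntegral_mono measurable_const fun y hy =>
    ENNReal.ofReal_le_ofReal (hc (mem_image_of_mem _ (hS hy)))

lemma continuousOn_inv : ContinuousOn M.inv M.union := by
  obtain ⟨K, hK⟩ := M.exists_lipschitzOnWith_inv
  exact (locallyFinite_of_finite M.elem).continuousOn_iUnion M.isClosed_elem
    fun i => (hK i).continuousOn

lemma compDomain_subset_union : M.compDomain ⊆ M.union := interior_subset

lemma aemeasurable_inv : AEMeasurable M.inv (volume.restrict M.compDomain) :=
  (M.continuousOn_inv.mono M.compDomain_subset_union).aemeasurable M.isOpen_compDomain.measurableSet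

lemma volume_inter_tri_le (A : Set Plane) : volume (A ∩ M.tri i) ≤ volume (A ∩ M.domain) := by
  calc volume (A ∩ M.tri i) ≤ volume (A ∩ M.domain ∪ frontier (M.tri i)) := by
        refine measure_mono fun y ⟨hyA, hy⟩ => ?_
        by_cases h : y ∈ interior (M.tri i)
        · exact Or.inl ⟨hyA, M.interior_tri_subset_domain i h⟩
        · exact Or.inr ⟨subset_closure hy, h⟩
    _ ≤ volume (A ∩ M.domain) + volume (frontier (M.tri i)) := measure_union_le _ _
    _ = _ := by rw [(M.convex_tri i).addHaar_frontier volume, add_zero]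

/-- The inverse of `G_h` increases the measure by at most a constant factor. -/
lemma exists_map_inv_le : ∃ c : ℝ≥0∞, c ≠ ⊤ ∧
    Measure.map M.inv (volume.restrict M.compDomain) ≤ c • volume.restrict M.domain := by
  choose c hc h using M.exists_volume_image_Gh_le
  refine ⟨∑ i, c i, ENNReal.sum_ne_top.2 fun i _ => hc i, Measure.le_iff.2 fun A hA => ?_⟩
  rw [Measure.map_apply_of_aemeasurable M.aemeasurable_inv hA, Measure.smul_apply,
    Measure.restrict_apply hA, Measure.restrict_apply₀' M.isOpen_compDomain.nullMeasurableSet,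
    smul_eq_mul, Finset.sum_mul]
  -- Each point of the preimage of A comes back from A by G_h on some triangle, and G_h expands
  -- areas there by a bounded factor.
  have hsub : M.inv ⁻¹' A ∩ M.compDomain ⊆ ⋃ i, M.Gh i '' (A ∩ M.tri i) := by
    rintro y ⟨hyA, hy⟩
    obtain ⟨i, x, hx, rfl⟩ := M.exists_of_mem_union (M.compDomain_subset_union hy)
    rw [mem_preimage, M.inv_F i hx] at hyA
    exact mem_iUnion.2 ⟨i, M.map i x, ⟨hyA, (M.map_mem_tri i).2 hx⟩, M.Gh_map i x⟩
  refine (measure_mono hsub).trans ((measure_iUnion_fintype_le _ _).trans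
    (Finset.sum_le_sum fun i _ => ?_))
  refine (h i _ inter_subset_right (hA.inter (M.isClosed_tri i).measurableSet)).trans ?_
  exact mul_le_mul_right (M.volume_inter_tri_le i A) (c i)

/-- Here the constant may depend on the mesh: it serves only for membership in H¹₀, not for the
error estimate. -/
lemma exists_eLpNorm_comp_inv_le : ∃ c : ℝ≥0∞, c ≠ ⊤ ∧ ∀ f : Plane → Plane,
    AEStronglyMeasurable f (volume.restrict M.domain) →
    AEStronglyMeasurable (f ∘ M.inv) (volume.restrict M.compDomain) ∧
    eLpNorm (f ∘ M.inv) 2 (volume.restrict M.compDomain) ≤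
      c * eLpNorm f 2 (volume.restrict M.domain) := by
  obtain ⟨c, hc, h⟩ := M.exists_map_inv_le
  refine ⟨c ^ (1 / (2 : ℝ≥0∞)).toReal, ENNReal.rpow_ne_top_of_nonneg (by positivity) hc,
    fun f hf => ?_⟩
  have hf' : AEStronglyMeasurable f (Measure.map M.inv (volume.restrict M.compDomain)) :=
    (hf.smul_measure c).mono_measure h
  refine ⟨hf'.comp_aemeasurable M.aemeasurable_inv, ?_⟩
  rw [← eLpNorm_map_measure hf' M.aemeasurable_inv]
  refine (eLpNorm_mono_measure _ h).trans ?_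
  rw [eLpNorm_smul_measure_of_ne_top (by norm_num), smul_eq_mul]

lemma pushGrad_sub (g g' : Fin 2 → Plane → Plane) (j : Fin 2) :
    M.pushGrad g j - M.pushGrad g' j = M.pushGrad (fun k => g k - g' k) j := by
  ext1 y
  simp only [pushGrad, Pi.sub_apply, ← Finset.sum_sub_distrib, smul_sub]

/-- Almost every point of the computational domain is interior to an element, where the Lipschitz
constant of the inverse bounds its derivative. -/
lemma exists_eLpNorm_pushGrad_le : ∃ c : ℝ≥0∞, c ≠ ⊤ ∧ ∀ g : Fin 2 → Plane → Plane,
    (∀ k, AEStronglyMeasurable (g k) (volume.restrict M.domain)) → ∀ j,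
    AEStronglyMeasurable (M.pushGrad g j) (volume.restrict M.compDomain) ∧
    eLpNorm (M.pushGrad g j) 2 (volume.restrict M.compDomain) ≤
      c * ∑ k, eLpNorm (g k) 2 (volume.restrict M.domain) := by
  obtain ⟨c, hc, h⟩ := M.exists_eLpNorm_comp_inv_le
  obtain ⟨K, hK⟩ := M.exists_lipschitzOnWith_inv
  refine ⟨K * c, ENNReal.mul_ne_top ENNReal.coe_ne_top hc, fun g hg j => ?_⟩
  have hmeas : ∀ k, Measurable fun y => fderiv ℝ M.inv y (EuclideanSpace.single j 1) k := fun k =>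
    (EuclideanSpace.proj (𝕜 := ℝ) k).continuous.measurable.comp
      (measurable_fderiv_apply_const ℝ M.inv _)
  have hm : ∀ k, AEStronglyMeasurable
      (fun y => (fderiv ℝ M.inv y (EuclideanSpace.single j 1)) k • g k (M.inv y))
      (volume.restrict M.compDomain) := fun k =>
    (hmeas k).aestronglyMeasurable.smul (h (g k) (hg k)).1
  have e : M.pushGrad g j = ∑ k, fun y =>
      (fderiv ℝ M.inv y (EuclideanSpace.single j 1)) k • g k (M.inv y) := by
    ext1 y; simp [pushGrad]
  have hderiv : ∀ᵐ y ∂(volume.restrict M.compDomain), ‖fderiv ℝ M.inv y‖ ≤ K := by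
    filter_upwards [M.ae_compDomain] with y ⟨i, x, hx, hxy⟩
    rw [← hxy]
    exact norm_fderiv_le_of_lipschitzOn ℝ (M.elem_mem_nhds i hx) (hK i)
  rw [e]
  refine ⟨Finset.aestronglyMeasurable_sum _ fun k _ => hm k, ?_⟩
  refine (eLpNorm_sum_le (fun k _ => hm k) (by norm_num)).trans ?_
  rw [Finset.mul_sum]
  refine Finset.sum_le_sum fun k _ => ?_
  have h1 : eLpNorm (fun y => (fderiv ℝ M.inv y (EuclideanSpace.single j 1)) k • g k (M.inv y)) 2
      (volume.restrict M.compDomain) ≤ ENNReal.ofReal K *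
      eLpNorm (g k ∘ M.inv) 2 (volume.restrict M.compDomain) := by
    refine eLpNorm_le_mul_eLpNorm_of_ae_le_mul ?_ 2
    filter_upwards [hderiv] with y hy
    rw [norm_smul, Function.comp_apply]
    exact mul_le_mul_of_nonneg_right ((abs_entry_le _ j k).trans hy) (norm_nonneg _)
  rw [ENNReal.ofReal_coe_nnreal] at h1
  refine h1.trans ?_
  rw [mul_assoc]
  gcongr
  exact (h (g k) (hg k)).2

/-- The transformation of `H¹₀` fields. -/
theorem push_mem_H10 {v : Plane → Plane} (hv : v ∈ H10 M.domain) :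
    M.push v ∈ H10 M.compDomain := by
  obtain ⟨g, hv, hg, φ, hφ, h0, h1⟩ := hv
  obtain ⟨c, hc, hcomp⟩ := M.exists_eLpNorm_comp_inv_le
  obtain ⟨c', hc', hgrad⟩ := M.exists_eLpNorm_pushGrad_le
  have hpush : ∀ w : Plane → Plane,
      M.push w =ᵐ[volume.restrict M.compDomain] w ∘ M.inv := fun w => by
    rw [EventuallyEq, ae_restrict_iff' M.isOpen_compDomain.measurableSet]
    exact Eventually.of_forall fun y hy => indicator_of_mem (M.compDomain_subset_union hy) _
  have hlip := fun n => M.push_lipschitz (hφ n).1 (hφ n).2.1 (hφ n).2.2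
  have hlt : ∀ {c a : ℝ≥0∞}, c ≠ ⊤ → a < ⊤ → c * a < ⊤ := fun hc ha =>
    ENNReal.mul_lt_top hc.lt_top ha
  refine ⟨M.pushGrad g, HasH10Grad.of_lipschitz M.isOpen_compDomain
    (MemLp.ae_eq (hpush v).symm ⟨(hcomp v hv.1).1, (hcomp v hv.1).2.trans_lt (hlt hc hv.2)⟩)
    (fun j => ⟨(hgrad g (fun k => (hg k).1) j).1, (hgrad g (fun k => (hg k).1) j).2.trans_lt
      (hlt hc' (ENNReal.sum_lt_top.2 fun k _ => (hg k).2))⟩) (ψ := fun n => M.push (φ n)) hlip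
      ?_ fun j => ?_⟩
  · refine tendsto_of_tendsto_of_tendsto_of_le_of_le tendsto_const_nhds
      (by simpa using ENNReal.Tendsto.const_mul h0 (Or.inr hc)) (fun n => zero_le) fun n => ?_
    have e : M.push v - M.push (φ n) =ᵐ[volume.restrict M.compDomain] (v - φ n) ∘ M.inv :=
      (hpush v).sub (hpush (φ n))
    simp only [eLpNorm_congr_ae e]
    exact (hcomp _ (hv.1.sub (hφ n).1.continuous.aestronglyMeasurable)).2
  · have hsum : Tendsto (fun n => c' * ∑ k, eLpNorm (g k - partialD k (φ n)) 2
        (volume.restrict M.domain)) atTop (𝓝 0) := by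
      have := ENNReal.Tendsto.const_mul (a := c') (tendsto_finsetSum Finset.univ
        fun k _ => h1 k) (Or.inr hc')
      simpa using this
    refine tendsto_of_tendsto_of_tendsto_of_le_of_le tendsto_const_nhds hsum
      (fun n => zero_le) fun n => ?_
    -- The chain rule identifies the classical gradient of the transported smooth field with its
    -- formal transform, outside the null set of element boundaries.
    have e : M.pushGrad g j - partialD j (M.push (φ n)) =ᵐ[volume.restrict M.compDomain]
        M.pushGrad (fun k => g k - partialD k (φ n)) j := by
      filter_upwards [M.ae_compDomain] with y ⟨i, x, hx, hxy⟩
      rw [← M.pushGrad_sub g (fun k => partialD k (φ n)), Pi.sub_apply, Pi.sub_apply, ← hxy,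
        M.partialD_push i ((hφ n).1.differentiable (by simp)) j hx]
    simp only [eLpNorm_congr_ae e]
    exact (hgrad _ (fun k => (hg k).1.sub
      (continuous_partialD (hφ n).1 k).aestronglyMeasurable) j).2

end IsoMesh

/-! ### Scaling -/

lemma det_smul (c : ℝ) (T : Plane →L[ℝ] Plane) : (c • T).det = c ^ 2 * T.det := by
  simp only [det_eq_entries, smul_apply, PiLp.smul_apply, smul_eq_mul]
  ring

namespace AffineMesh

variable {N : ℕ} (M : AffineMesh N) (i : Fin N)

lemma dist_le_diam {x y : Plane} (hx : x ∈ M.tri i) (hy : y ∈ M.tri i) : dist x y ≤ M.diam i :=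
  Metric.dist_le_diam_of_mem (M.isCompact_tri i).isBounded hx hy

lemma vert_mem_tri (k : Fin 3) : M.vert i k ∈ M.tri i := subset_convexHull ℝ _ (mem_range_self k)

lemma diam_pos : 0 < M.diam i := by
  refine lt_of_lt_of_le (dist_pos.2 fun h => ?_)
    (M.dist_le_diam i (M.vert_mem_tri i 0) (M.vert_mem_tri i 1))
  exact absurd ((M.nondegenerate i).injective h) (by decide)

lemma norm_lin_le : ‖M.lin i‖ ≤ 2 * M.diam i := by
  refine (M.lin i).opNorm_le_bound (by linarith [M.diam_pos i]) fun x => ?_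
  have h : ∀ k, ‖M.vert i k - M.vert i 2‖ ≤ M.diam i := fun k => by
    rw [← dist_eq_norm]; exact M.dist_le_diam i (M.vert_mem_tri i k) (M.vert_mem_tri i 2)
  rw [lin_apply]
  refine (norm_add_le _ _).trans ?_
  rw [norm_smul, norm_smul]
  have h0 := mul_le_mul (abs_coord_le_norm x 0) (h 0) (norm_nonneg _) (norm_nonneg _)
  have h1 := mul_le_mul (abs_coord_le_norm x 1) (h 1) (norm_nonneg _) (norm_nonneg _)
  simp only [Real.norm_eq_abs]
  linarith

/-- A vector in the direction z of length ρ / 2 fits into the inscribed ball. Its preimage joins two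
points of the reference triangle, so has length at most 2, which gives the factor 4 / ρ ≤ 4 σ / h.
-/
lemma norm_linEquiv_symm_le {c : Plane} {ρ σ : ℝ} (hρ : 0 < ρ)
    (hball : Metric.ball c ρ ⊆ M.tri i) (hσ : M.diam i ≤ σ * ρ) :
    ‖((M.linEquiv i).symm : Plane →L[ℝ] Plane)‖ ≤ 4 * σ / M.diam i := by
  have hd := M.diam_pos i
  have hσ0 : 0 < σ := pos_of_mul_pos_left (hd.trans_le hσ) hρ.le
  refine ContinuousLinearMap.opNorm_le_bound _ (by positivity) fun z => ?_
  by_cases hz : z = 0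
  · simp [hz]
  have hz0 : 0 < ‖z‖ := norm_pos_iff.2 hz
  set s := ρ / 2 / ‖z‖ with hs
  have hs0 : 0 < s := by positivity
  have h1 : c + s • z ∈ M.tri i := hball (by
    rw [mem_ball_iff_norm, add_sub_cancel_left, norm_smul, Real.norm_of_nonneg hs0.le, hs,
      div_mul_cancel₀ _ hz0.ne']
    linarith)
  have h0 : c ∈ M.tri i := hball (Metric.mem_ball_self hρ)
  rw [tri_eq] at h0 h1
  obtain ⟨x, hx, hxc⟩ := h0
  obtain ⟨y, hy, hyc⟩ := h1
  have e : M.linEquiv i (y - x) = s • z := by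
    rw [linEquiv_apply, ← map_sub, hxc, hyc, add_sub_cancel_left]
  have e' : s • (M.linEquiv i).symm z = y - x := by
    rw [← map_smul, ← e, ContinuousLinearEquiv.symm_apply_apply]
  have hn : s * ‖(M.linEquiv i).symm z‖ ≤ 2 := by
    rw [← Real.norm_of_nonneg hs0.le, ← norm_smul, e']
    exact norm_sub_le_two hy hx
  have hle : ‖(M.linEquiv i).symm z‖ ≤ 2 / s := by rwa [le_div_iff₀ hs0, mul_comm]
  refine hle.trans ?_
  rw [hs, div_div_eq_mul_div, div_mul_eq_mul_div, div_div_eq_mul_div, div_le_div_iff₀ hρ hd]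
  nlinarith

end AffineMesh

namespace IsoMesh

variable {N : ℕ} (M : IsoMesh N) (i : Fin N)

lemma hasFDerivAt_Gh (y : Plane) : HasFDerivAt (M.Gh i) (fderiv ℝ (M.Gh i) y) y :=
  ((M.contDiff_Gh i (n := 1)).differentiable (by simp) y).hasFDerivAt

lemma fderiv_F (x : Plane) :
    fderiv ℝ (M.F i) x = (fderiv ℝ (M.Gh i) (M.map i x)).comp (M.lin i) := by
  have h : M.F i = M.Gh i ∘ M.map i := funext fun z => (M.Gh_map i z).symm
  rw [h]
  exact ((M.hasFDerivAt_Gh i _).comp x (M.hasFDerivAt_map i x)).fderiv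

/-- The scaled derivative of `F_T`. -/
def scaledDeriv (x : Plane) : Plane →L[ℝ] Plane := (M.diam i)⁻¹ • fderiv ℝ (M.F i) x

lemma fderiv_F_eq_smul (x : Plane) : fderiv ℝ (M.F i) x = M.diam i • M.scaledDeriv i x := by
  rw [scaledDeriv, smul_smul, mul_inv_cancel₀ (M.diam_pos i).ne', one_smul]

lemma det_fderiv_F (x : Plane) :
    (fderiv ℝ (M.F i) x).det = M.diam i ^ 2 * (M.scaledDeriv i x).det := by
  rw [fderiv_F_eq_smul, det_smul]

/-- In the plane the determinant scales like h² and the matrix like h. The remaining factor 1 / h is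
moved onto the argument, where it is absorbed in the polynomial. -/
lemma A_apply (x z : Plane) : M.A i x z = piola (M.scaledDeriv i) x ((M.diam i)⁻¹ • z) := by
  have hd := (M.diam_pos i).ne'
  simp only [A, piola, det_fderiv_F, smul_apply, map_smul]
  rw [fderiv_F_eq_smul, smul_apply, smul_smul, smul_smul]
  congr 1
  field_simp

/-- The constant bounding the scaled derivatives of the element maps. -/
def scaleBound (σ κ : ℝ) : ℝ := 2 * |κ| + 64 * κ ^ 2 * σ ^ 2

lemma scaleBound_nonneg (σ κ : ℝ) : 0 ≤ scaleBound σ κ := by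
  unfold scaleBound; positivity

variable {σ κ h₀ : ℝ}

lemma Regular.kappa_nonneg {M : IsoMesh N} (hM : M.Regular σ κ h₀) (i : Fin N) : 0 ≤ κ :=
  (norm_nonneg _).trans (hM.deriv_le i _ (M.vert_mem_tri i 0))

lemma Regular.norm_linEquiv_symm_le {M : IsoMesh N} (hM : M.Regular σ κ h₀) (i : Fin N) :
    ‖((M.linEquiv i).symm : Plane →L[ℝ] Plane)‖ ≤ 4 * σ / M.diam i := by
  obtain ⟨c, ρ, hρ, hb, hσ⟩ := hM.shape i
  exact M.toAffineMesh.norm_linEquiv_symm_le i hρ hb hσ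

lemma Regular.sigma_pos {M : IsoMesh N} (hM : M.Regular σ κ h₀) (i : Fin N) : 0 < σ := by
  obtain ⟨c, ρ, hρ, hb, hσ⟩ := hM.shape i
  exact pos_of_mul_pos_left ((M.diam_pos i).trans_le hσ) hρ.le

lemma det_fderiv_Gh_ne {x : Plane} (hx : x ∈ refTri) :
    (fderiv ℝ (M.Gh i) (M.map i x)).det ≠ 0 := by
  have h := M.det_fderiv_F_pos i hx
  rw [fderiv_F, det_comp] at h
  exact left_ne_zero_of_mul h.ne'

lemma fderiv_Gh_inverse_apply {x : Plane} (hx : x ∈ refTri) (z : Plane) :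
    fderiv ℝ (M.Gh i) (M.map i x) ((fderiv ℝ (M.Gh i) (M.map i x)).inverse z) = z := by
  set e := (fderiv ℝ (M.Gh i) (M.map i x)).toContinuousLinearEquivOfDetNeZero
    (M.det_fderiv_Gh_ne i hx) with he
  have h : fderiv ℝ (M.Gh i) (M.map i x) = (e : Plane →L[ℝ] Plane) := by ext; rfl
  rw [h, ContinuousLinearMap.inverse_equiv]
  exact e.apply_symm_apply z

lemma derivEquiv_apply {x : Plane} (hx : x ∈ refTri) (z : Plane) :
    M.derivEquiv i hx z = fderiv ℝ (M.F i) x z := rfl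

lemma Regular.norm_derivEquiv_symm_le {M : IsoMesh N} (hM : M.Regular σ κ h₀) (i : Fin N)
    {x : Plane} (hx : x ∈ refTri) :
    ‖((M.derivEquiv i hx).symm : Plane →L[ℝ] Plane)‖ ≤ 4 * σ / M.diam i * κ := by
  have e : ((M.derivEquiv i hx).symm : Plane →L[ℝ] Plane) =
      ((M.linEquiv i).symm : Plane →L[ℝ] Plane).comp (fderiv ℝ (M.Gh i) (M.map i x)).inverse := by
    ext1 z
    apply (M.derivEquiv i hx).injective
    rw [ContinuousLinearEquiv.coe_coe, ContinuousLinearEquiv.apply_symm_apply, derivEquiv_apply,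
      fderiv_F, ContinuousLinearMap.comp_apply, ContinuousLinearMap.comp_apply,
      ← AffineMesh.linEquiv_apply, ContinuousLinearEquiv.coe_coe,
      ContinuousLinearEquiv.apply_symm_apply, M.fderiv_Gh_inverse_apply i hx]
  rw [e]
  have hσ := hM.sigma_pos i
  have hd := M.diam_pos i
  exact (ContinuousLinearMap.opNorm_comp_le _ _).trans (mul_le_mul (hM.norm_linEquiv_symm_le i)
    (hM.deriv_inv_le i _ ((M.map_mem_tri i).2 hx)) (norm_nonneg _) (by positivity))

lemma Regular.norm_scaledDeriv_le {M : IsoMesh N} (hM : M.Regular σ κ h₀) (i : Fin N)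
    {x : Plane} (hx : x ∈ refTri) : ‖M.scaledDeriv i x‖ ≤ 2 * κ := by
  have hd := M.diam_pos i
  have hκ := hM.kappa_nonneg i
  have h1 : ‖fderiv ℝ (M.F i) x‖ ≤ κ * (2 * M.diam i) := by
    rw [fderiv_F]
    exact (ContinuousLinearMap.opNorm_comp_le _ _).trans (mul_le_mul
      (hM.deriv_le i _ ((M.map_mem_tri i).2 hx)) (M.norm_lin_le i) (norm_nonneg _) hκ)
  have h2 : ‖M.scaledDeriv i x‖ = (M.diam i)⁻¹ * ‖fderiv ℝ (M.F i) x‖ := by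
    rw [scaledDeriv, norm_smul, Real.norm_of_nonneg (by positivity)]
  rw [h2, inv_mul_le_iff₀ hd]
  linarith

lemma Regular.isAffineMatrix {M : IsoMesh N} (hM : M.Regular σ κ h₀) (i : Fin N) :
    IsAffineMatrix (scaleBound σ κ) (M.scaledDeriv i) where
  poly y := by
    intro c
    have h := polyFun_const_mul (M.diam i)⁻¹ ((M.isPolyField_F i).fderiv_apply y c)
    exact h
  norm_le x hx := by
    refine (hM.norm_scaledDeriv_le i hx).trans ?_
    unfold scaleBound
    have : 0 ≤ 64 * κ ^ 2 * σ ^ 2 := by positivity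
    linarith [le_abs_self κ]
  det_ne x hx h := by
    have := M.det_fderiv_F_pos i hx
    rw [det_fderiv_F, h, mul_zero] at this
    exact lt_irrefl _ this
  det_inv_le x hx := by
    have hd := M.diam_pos i
    have hne := M.det_fderiv_Gh_ne i hx
    set T := fderiv ℝ (M.Gh i) (M.map i x) with hT
    set S := ((M.linEquiv i).symm : Plane →L[ℝ] Plane) with hS
    have h1 : T.det * T.inverse.det = 1 := by
      rw [← det_comp]
      have : T.comp T.inverse = ContinuousLinearMap.id ℝ Plane := by
        ext1 z; exact M.fderiv_Gh_inverse_apply i hx z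
      rw [this]; simp [ContinuousLinearMap.det]
    have h2 : (M.lin i).det * S.det = 1 := by
      rw [← det_comp]
      have : (M.lin i).comp S = ContinuousLinearMap.id ℝ Plane := by
        ext1 z; exact (M.linEquiv i).apply_symm_apply z
      rw [this]; simp [ContinuousLinearMap.det]
    have h3 : |T.inverse.det| ≤ 2 * κ ^ 2 :=
      abs_det_le (hM.deriv_inv_le i _ ((M.map_mem_tri i).2 hx))
    have h4 : |S.det| ≤ 2 * (4 * σ / M.diam i) ^ 2 := abs_det_le (hM.norm_linEquiv_symm_le i)
    -- The scaled determinant has the explicit inverse h² det((DG_h)⁻¹) det(L⁻¹), with L the linear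
    -- part of the affine map. The powers of h cancel and leave 64 κ² σ².
    have h5 : (M.scaledDeriv i x).det * (M.diam i ^ 2 * (T.inverse.det * S.det)) = 1 := by
      have h6 := M.det_fderiv_F i x
      rw [fderiv_F, det_comp] at h6
      calc _ = (M.diam i ^ 2 * (M.scaledDeriv i x).det) * (T.inverse.det * S.det) := by ring
        _ = (T.det * T.inverse.det) * ((M.lin i).det * S.det) := by rw [← h6]; ring
        _ = 1 := by rw [h1, h2, one_mul]
    have h7 : |(M.scaledDeriv i x).det|⁻¹ = M.diam i ^ 2 * (|T.inverse.det| * |S.det|) := by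
      rw [← abs_inv, inv_eq_of_mul_eq_one_right h5, abs_mul, abs_mul, abs_of_pos (by positivity)]
    rw [h7]
    calc _ ≤ M.diam i ^ 2 * (2 * κ ^ 2 * (2 * (4 * σ / M.diam i) ^ 2)) := by gcongr
      _ = 64 * κ ^ 2 * σ ^ 2 := by field_simp; ring
      _ ≤ scaleBound σ κ := by unfold scaleBound; linarith [abs_nonneg κ]

/-- The source of the gained power of h: differentiating DG_h ∘ L once more brings a second factor
L, each of size 2 h, against a single division by h. -/
lemma Regular.norm_fderiv_scaledDeriv_le {M : IsoMesh N} (hM : M.Regular σ κ h₀) (i : Fin N)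
    {x : Plane} (hx : x ∈ refTri) :
    ‖fderiv ℝ (M.scaledDeriv i) x‖ ≤ 4 * κ * M.diam i := by
  have hd := M.diam_pos i
  have hκ := hM.kappa_nonneg i
  have hG : ContDiff ℝ 1 (fderiv ℝ (M.Gh i)) := (M.contDiff_Gh i (n := 2)).fderiv_right (by norm_num)
  have h1 := (hG.differentiable (by simp) (M.map i x)).hasFDerivAt.comp x (M.hasFDerivAt_map i x)
  have h2 := ((ContinuousLinearMap.compL ℝ Plane Plane Plane).flip (M.lin i)).hasFDerivAt.comp x h1
  have h3 := h2.const_smul (M.diam i)⁻¹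
  have e : M.scaledDeriv i = (M.diam i)⁻¹ •
      (⇑((ContinuousLinearMap.compL ℝ Plane Plane Plane).flip (M.lin i)) ∘
        fderiv ℝ (M.Gh i) ∘ M.map i) := by
    ext1 z
    rw [scaledDeriv, fderiv_F]; rfl
  rw [e, h3.fderiv]
  refine ContinuousLinearMap.opNorm_le_bound _ (by positivity) fun v => ?_
  have hv : ‖fderiv ℝ (fderiv ℝ (M.Gh i)) (M.map i x) (M.lin i v)‖ ≤
      κ * (2 * M.diam i * ‖v‖) :=
    (ContinuousLinearMap.le_opNorm _ _).trans (mul_le_mul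
      (hM.deriv_two_le i _ ((M.map_mem_tri i).2 hx)) ((M.lin i).le_of_opNorm_le (M.norm_lin_le i) v)
      (norm_nonneg _) hκ)
  have hv2 : ‖(fderiv ℝ (fderiv ℝ (M.Gh i)) (M.map i x) (M.lin i v)).comp (M.lin i)‖ ≤
      κ * (2 * M.diam i * ‖v‖) * (2 * M.diam i) :=
    (ContinuousLinearMap.opNorm_comp_le _ _).trans (mul_le_mul hv (M.norm_lin_le i)
      (norm_nonneg _) (by positivity))
  change ‖(M.diam i)⁻¹ • (fderiv ℝ (fderiv ℝ (M.Gh i)) (M.map i x) (M.lin i v)).comp (M.lin i)‖ ≤ _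
  rw [norm_smul, Real.norm_of_nonneg (by positivity), inv_mul_le_iff₀ hd]
  linarith

end IsoMesh

/-! ### The error estimate on an element -/

lemma IsQuadraticOn.exists_polyField {v : Plane → Plane} {S : Set Plane}
    (hv : IsQuadraticOn v S) : ∃ q, IsPolyField 2 q ∧ EqOn v q S := by
  obtain ⟨p, hp, h⟩ := hv
  refine ⟨fun x => WithLp.toLp 2 fun c => MvPolynomial.eval (fun j => x j) (p c),
    fun c => mem_polyFun.2 ⟨p c, hp c, fun x => rfl⟩, fun x hx => ?_⟩
  ext c
  exact h x hx c

namespace IsoMesh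

variable {N : ℕ} (M : IsoMesh N) (i : Fin N)

/-- On a subtriangle the field `v`, its preimage and its transform are given by polynomials. -/
lemma IsPsi.exists_poly {M : IsoMesh N} {vt v : Plane → Plane} (hvt : vt ∈ M.Vtilde)
    (hv : M.IsPsi vt v) (i : Fin N) (k : Fin 3) : ∃ w q, IsPolyField 2 w ∧ IsPolyField 2 q ∧
      (∀ a ∈ refNodes ∩ refSub k, q a = piola (M.scaledDeriv i) a (w a)) ∧
      (∀ x ∈ interior (refSub k), v (M.F i x) = piola (M.scaledDeriv i) x (w x)) ∧
      ∀ x ∈ refSub k, M.push vt (M.F i x) = q x := by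
  obtain ⟨w, ⟨wh, hwh, hw⟩, hnodes, heq⟩ := hv i
  obtain ⟨p, hp, hpe⟩ := (hwh.2 k).exists_polyField
  obtain ⟨q, hq, hqe⟩ := ((hvt.2 i).2 k).exists_polyField
  -- The factor 1 / h is the one separated in `A_apply`.
  refine ⟨fun x => (M.diam i)⁻¹ • p x, q, fun c => polyFun_const_mul _ (hp c), hq, ?_, ?_, ?_⟩
  · rintro a ⟨ha, hak⟩
    rw [← hqe hak, Function.comp_apply, ← hnodes a ha, hw a (refSub_subset k hak), A_apply,
      hpe hak]
  · intro x hx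
    have hxT := refSub_subset k (interior_subset hx)
    rw [heq (mem_image_of_mem _ (interior_mono (refSub_subset k) hx)), hw x hxT, A_apply,
      hpe (interior_subset hx)]
  · intro x hx
    rw [M.push_F i vt (refSub_subset k hx), ← hqe hx, Function.comp_apply]

variable {σ κ h₀ : ℝ}

/-- Change of variables for the norm of the gradient. -/
lemma Regular.eLpNorm_fderiv_le {M : IsoMesh N} (hM : M.Regular σ κ h₀) (i : Fin N) (k : Fin 3)
    {v g : Plane → Plane} (hv : ∀ x ∈ interior (refSub k), v (M.F i x) = g x)
    (hg : ∀ x ∈ interior (refSub k), DifferentiableAt ℝ g x) :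
    eLpNorm (fun x => ‖fderiv ℝ g x‖) 2 (volume.restrict (refSub k)) ≤
      ENNReal.ofReal ((4 * κ ^ 2 * scaleBound σ κ) ^ (1 / 2 : ℝ)) * M.gradNormL2 i v := by
  have hd := M.diam_pos i
  have hκ := hM.kappa_nonneg i
  have hb := scaleBound_nonneg σ κ
  have hA := hM.isAffineMatrix i
  have hKT : interior (refSub k) ⊆ refTri := interior_subset.trans (refSub_subset k)
  have hs : ∀ (f : Plane → Plane →L[ℝ] Plane) (μ : Measure Plane),
      eLpNorm (fun x => ‖f x‖) 2 μ = (∫⁻ x, ‖f x‖ₑ ^ (2 : ℝ) ∂μ) ^ (1 / 2 : ℝ) := fun f μ => by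
    rw [eLpNorm_eq_lintegral_rpow_enorm_toReal (by norm_num) (by norm_num)]
    simp
  rw [gradNormL2, hs, hs, ← ENNReal.ofReal_rpow_of_nonneg (by positivity) (by norm_num),
    ← ENNReal.mul_rpow_of_nonneg _ _ (by norm_num)]
  refine ENNReal.rpow_le_rpow ?_ (by norm_num)
  have hres : volume.restrict (refSub k) = volume.restrict (interior (refSub k)) := by
    exact Measure.restrict_congr_set
      (interior_ae_eq_of_null_frontier ((convex_refSub k).addHaar_frontier volume)).symm
  have hpt : ∀ x ∈ interior (refSub k), ‖fderiv ℝ g x‖ₑ ^ (2 : ℝ) ≤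
      ENNReal.ofReal (4 * κ ^ 2 * scaleBound σ κ) *
        (ENNReal.ofReal |(fderiv ℝ (M.F i) x).det| * ‖fderiv ℝ v (M.F i x)‖ₑ ^ (2 : ℝ)) := by
    intro x hx
    have hxT := hKT hx
    have h1 := M.hasFDerivAt_of_comp_F i hxT (f := v) (g := g)
      (by filter_upwards [isOpen_interior.mem_nhds hx] with z hz using hv z hz) (hg x hx)
    have h2 : fderiv ℝ g x = (fderiv ℝ v (M.F i x)).comp (fderiv ℝ (M.F i) x) := by
      rw [h1.fderiv]
      ext1 z
      simp [← M.derivEquiv_apply i hxT]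
    have h3 : ‖fderiv ℝ g x‖ ≤ ‖fderiv ℝ v (M.F i x)‖ * (M.diam i * (2 * κ)) := by
      rw [h2]
      refine (ContinuousLinearMap.opNorm_comp_le _ _).trans
        (mul_le_mul_of_nonneg_left ?_ (norm_nonneg _))
      rw [fderiv_F_eq_smul, norm_smul, Real.norm_of_nonneg hd.le]
      exact mul_le_mul_of_nonneg_left (hM.norm_scaledDeriv_le i hxT) hd.le
    -- This turns the factor h² from the squared chain rule into the Jacobian needed for the change
    -- of variables, so no power of h is left over.
    have h4 : 1 ≤ scaleBound σ κ * |(M.scaledDeriv i x).det| := by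
      have := hA.det_inv_le x hxT
      rwa [inv_le_iff_one_le_mul₀ (abs_pos.2 (hA.det_ne x hxT))] at this
    have h5 : ‖fderiv ℝ g x‖ ^ 2 ≤ (4 * κ ^ 2 * scaleBound σ κ) *
        (|(fderiv ℝ (M.F i) x).det| * ‖fderiv ℝ v (M.F i x)‖ ^ 2) := by
      rw [det_fderiv_F, abs_mul, abs_of_pos (by positivity : 0 < M.diam i ^ 2)]
      calc _ ≤ (‖fderiv ℝ v (M.F i x)‖ * (M.diam i * (2 * κ))) ^ 2 :=
            pow_le_pow_left₀ (norm_nonneg _) h3 2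
        _ = (4 * κ ^ 2 * M.diam i ^ 2 * ‖fderiv ℝ v (M.F i x)‖ ^ 2) * 1 := by ring
        _ ≤ (4 * κ ^ 2 * M.diam i ^ 2 * ‖fderiv ℝ v (M.F i x)‖ ^ 2) *
            (scaleBound σ κ * |(M.scaledDeriv i x).det|) :=
              mul_le_mul_of_nonneg_left h4 (by positivity)
        _ = _ := by ring
    have he : ∀ T : Plane →L[ℝ] Plane, ‖T‖ₑ ^ (2 : ℝ) = ENNReal.ofReal (‖T‖ ^ 2) := fun T => by
      rw [← ofReal_norm, ENNReal.ofReal_rpow_of_nonneg (norm_nonneg _) (by norm_num)]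
      norm_num
    rw [he, he, ← ENNReal.ofReal_mul (abs_nonneg _), ← ENNReal.ofReal_mul (by positivity)]
    exact ENNReal.ofReal_le_ofReal h5
  have hcv := lintegral_image_eq_lintegral_abs_det_fderiv_mul volume
    (isOpen_interior (s := refSub k)).measurableSet
    (fun x _ => (M.differentiable_F i x).hasFDerivAt.hasFDerivWithinAt)
    ((M.F_injOn i).mono hKT) (fun y => ‖fderiv ℝ v y‖ₑ ^ (2 : ℝ))
  calc _ = ∫⁻ x in interior (refSub k), ‖fderiv ℝ g x‖ₑ ^ (2 : ℝ) := by rw [hres]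
    _ ≤ ∫⁻ x in interior (refSub k), ENNReal.ofReal (4 * κ ^ 2 * scaleBound σ κ) *
        (ENNReal.ofReal |(fderiv ℝ (M.F i) x).det| * ‖fderiv ℝ v (M.F i x)‖ₑ ^ (2 : ℝ)) :=
        setLIntegral_mono' isOpen_interior.measurableSet hpt
    _ = ENNReal.ofReal (4 * κ ^ 2 * scaleBound σ κ) *
        ∫⁻ y in M.F i '' interior (refSub k), ‖fderiv ℝ v y‖ₑ ^ (2 : ℝ) := by
        rw [lintegral_const_mul' _ _ ENNReal.ofReal_ne_top, hcv]
    _ ≤ _ := by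
        gcongr
        exact image_mono hKT

/-- The area of an element. -/
lemma Regular.volume_elem_le {M : IsoMesh N} (hM : M.Regular σ κ h₀) (i : Fin N) :
    volume (M.elem i) ≤ ENNReal.ofReal (M.diam i ^ 2 * (8 * κ ^ 2 * volume.real refTri)) := by
  have h := addHaar_image_le_lintegral_abs_det_fderiv volume isCompact_refTri.measurableSet
    fun x _ => (M.differentiable_F i x).hasFDerivAt.hasFDerivWithinAt
  refine h.trans ((setLIntegral_mono' (g := fun _ => ENNReal.ofReal (M.diam i ^ 2 * (8 * κ ^ 2)))
    isCompact_refTri.measurableSet fun x hx => ENNReal.ofReal_le_ofReal ?_).trans ?_)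
  · rw [det_fderiv_F, abs_mul, abs_of_pos (pow_pos (M.diam_pos i) 2)]
    refine mul_le_mul_of_nonneg_left ?_ (by positivity)
    exact (abs_det_le (hM.norm_scaledDeriv_le i hx)).trans (le_of_eq (by ring))
  · rw [setLIntegral_const, ← ofReal_measureReal volume_refTri_lt_top.ne,
      ← ENNReal.ofReal_mul (by positivity), mul_assoc, mul_assoc]

/-- The error estimate on one element. -/
theorem exists_element_estimate (σ κ : ℝ) : ∃ C : ℝ, 0 < C ∧ ∀ (h₀ : ℝ) (N : ℕ) (M : IsoMesh N),
    M.Regular σ κ h₀ → ∀ vt ∈ M.Vtilde, ∀ v, M.IsPsi vt v → ∀ i,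
    M.normL2 i (v - M.push vt) + ENNReal.ofReal (M.diam i) * M.gradNormL2 i (v - M.push vt) ≤
      ENNReal.ofReal (C * M.diam i ^ 2) * M.gradNormL2 i v := by
  obtain ⟨C₀, hC₀, hloc⟩ := exists_local_estimate (scaleBound σ κ) (scaleBound_nonneg σ κ)
  set c := (4 * κ ^ 2 * scaleBound σ κ) ^ (1 / 2 : ℝ) with hc
  have hb := scaleBound_nonneg σ κ
  have hc0 : 0 ≤ c := by positivity
  set m := (8 * κ ^ 2 * volume.real refTri) ^ (1 / 2 : ℝ) with hm
  have hm0 : 0 ≤ m := by positivity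
  -- Absolute values appear because the constant is fixed before any mesh is given; the signs of σ
  -- and κ are known only once a triangle exists.
  set C₁ := m * (C₀ * (4 * |κ|) * c) with hC₁
  have hC₁0 : 0 ≤ C₁ := by positivity
  refine ⟨C₁ * (1 + 4 * |σ| * |κ|) + 1, by positivity, fun h₀ N M hM vt hvt v hv i => ?_⟩
  have hd := M.diam_pos i
  have hκ := hM.kappa_nonneg i
  have hσ := hM.sigma_pos i
  rw [abs_of_nonneg hκ] at hC₁
  rw [abs_of_nonneg hκ, abs_of_pos hσ]
  -- An infinite right-hand side needs a nonzero factor in front, which the summand 1 in the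
  -- constant guarantees.
  by_cases htop : M.gradNormL2 i v = ⊤
  · rw [htop, ENNReal.mul_top]
    · exact le_top
    · exact (ENNReal.ofReal_pos.2 (by positivity)).ne'
  set X := (M.gradNormL2 i v).toReal with hX
  have hX0 : 0 ≤ X := ENNReal.toReal_nonneg
  have hXe : M.gradNormL2 i v = ENNReal.ofReal X := (ENNReal.ofReal_toReal htop).symm
  set h := M.diam i with hh
  set E := C₀ * (4 * κ * h) * (c * X) with hE
  have hE0 : 0 ≤ E := by positivity
  have hpt : ∀ k, ∀ x ∈ interior (refSub k), ‖(v - M.push vt) (M.F i x)‖ ≤ E ∧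
      ‖fderiv ℝ (v - M.push vt) (M.F i x)‖ ≤ E * (4 * σ / h * κ) := by
    intro k x hx
    obtain ⟨w, q, hw, hq, hnodes, hvw, hqv⟩ := hv.exists_poly hvt i k
    have hxk := interior_subset hx
    have hxT := refSub_subset k hxk
    have hA := hM.isAffineMatrix i
    have hgrad := hM.eLpNorm_fderiv_le i k hvw fun y hy =>
      hA.differentiableAt_piola_apply hw (refSub_subset k (interior_subset hy))
    rw [hXe, ← ENNReal.ofReal_mul hc0] at hgrad
    obtain ⟨e1, e2⟩ := hloc k _ hA (4 * κ * h) (fun y hy => hM.norm_fderiv_scaledDeriv_le i hy)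
      w q hw hq hnodes (c * X) (by positivity) hgrad x hxk
    refine ⟨?_, ?_⟩
    · rw [Pi.sub_apply, hvw x hx, hqv x hxk]
      exact e1
    · have hF := M.hasFDerivAt_of_comp_F i hxT (f := v - M.push vt)
        (g := fun y => piola (M.scaledDeriv i) y (w y) - q y)
        (by
          filter_upwards [isOpen_interior.mem_nhds hx] with z hz
          rw [Pi.sub_apply, hvw z hz, hqv z (interior_subset hz)])
        ((hA.differentiableAt_piola_apply hw hxT).sub (hq.differentiable x))
      rw [hF.fderiv]
      exact (ContinuousLinearMap.opNorm_comp_le _ _).trans (mul_le_mul e2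
        (hM.norm_derivEquiv_symm_le i hxT) (norm_nonneg _) hE0)
  -- The images of the interiors of the subtriangles cover the element up to a null set, so the
  -- pointwise bounds hold almost everywhere, whatever v does on interfaces.
  have hae : ∀ᵐ y ∂(volume.restrict (M.elem i)), ‖(v - M.push vt) y‖ ≤ E ∧
      ‖fderiv ℝ (v - M.push vt) y‖ ≤ E * (4 * σ / h * κ) := by
    rw [ae_restrict_iff' (M.isClosed_elem i).measurableSet]
    filter_upwards [compl_mem_ae_iff.2 (M.volume_elem_diff i volume_refTri_diff)] with y hy hyT
    by_contra hne
    refine hy ⟨hyT, ?_⟩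
    rintro ⟨x, hx, rfl⟩
    obtain ⟨k, hk⟩ := mem_iUnion.1 hx
    exact hne (hpt k x hk)
  -- The square root of the area supplies one power of h and `E` supplies the other.
  have hvol : (volume.restrict (M.elem i)) univ ^ (2 : ℝ≥0∞).toReal⁻¹ ≤ ENNReal.ofReal (h * m) := by
    rw [Measure.restrict_apply_univ]
    refine (ENNReal.rpow_le_rpow (hM.volume_elem_le i) (by positivity)).trans (le_of_eq ?_)
    rw [ENNReal.ofReal_rpow_of_nonneg (by positivity) (by positivity),
      Real.mul_rpow (by positivity) (by positivity), ENNReal.toReal_ofNat, ← one_div, ← hm,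
      ← Real.sqrt_eq_rpow, Real.sqrt_sq hd.le]
  have hn : M.normL2 i (v - M.push vt) ≤ ENNReal.ofReal (h * m * E) := by
    rw [ENNReal.ofReal_mul (by positivity)]
    exact (eLpNorm_le_of_ae_bound (hae.mono fun y hy => hy.1)).trans (by gcongr)
  have hg : M.gradNormL2 i (v - M.push vt) ≤
      ENNReal.ofReal (h * m * (E * (4 * σ / h * κ))) := by
    rw [ENNReal.ofReal_mul (by positivity)]
    refine (eLpNorm_le_of_ae_bound (C := E * (4 * σ / h * κ)) (hae.mono fun y hy => ?_)).trans
      (by gcongr)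
    rw [norm_norm]
    exact hy.2
  calc _ ≤ ENNReal.ofReal (h * m * E) +
        ENNReal.ofReal h * ENNReal.ofReal (h * m * (E * (4 * σ / h * κ))) := by gcongr
    _ = ENNReal.ofReal (h * m * E + h * (h * m * (E * (4 * σ / h * κ)))) := by
        rw [← ENNReal.ofReal_mul hd.le, ENNReal.ofReal_add (by positivity) (by positivity)]
    _ = ENNReal.ofReal (C₁ * (1 + 4 * σ * κ) * h ^ 2 * X) := by
        congr 1
        rw [hE, hC₁]
        field_simp
    _ ≤ ENNReal.ofReal ((C₁ * (1 + 4 * σ * κ) + 1) * h ^ 2) * M.gradNormL2 i v := by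
        rw [hXe, ← ENNReal.ofReal_mul (by positivity)]
        refine ENNReal.ofReal_le_ofReal (mul_le_mul_of_nonneg_right ?_ hX0)
        exact mul_le_mul_of_nonneg_right (by linarith) (by positivity)

/-! ### Linearity of Ψ and uniqueness of the preimage -/

lemma IsPsi.add {M : IsoMesh N} {vt vt' v v' : Plane → Plane} (h : M.IsPsi vt v)
    (h' : M.IsPsi vt' v') : M.IsPsi (vt + vt') (v + v') := fun i => by
  obtain ⟨w, hw, hn, he⟩ := h i
  obtain ⟨w', hw', hn', he'⟩ := h' i
  exact ⟨w + w', add_mem hw hw', fun a ha => by simp [hn a ha, hn' a ha],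
    fun x hx => by simp [he hx, he' hx]⟩

lemma IsPsi.smul {M : IsoMesh N} {vt v : Plane → Plane} (c : ℝ) (h : M.IsPsi vt v) :
    M.IsPsi (c • vt) (c • v) := fun i => by
  obtain ⟨w, hw, hn, he⟩ := h i
  exact ⟨c • w, Submodule.smul_mem _ c hw, fun a ha => by simp [hn a ha],
    fun x hx => by simp [he hx]⟩

/-- The preimage of a field in `V^h` is unique on the polygonal domain. -/
theorem IsPsi.unique {M : IsoMesh N} {vt vt' v : Plane → Plane} (hvt : vt ∈ M.Vtilde)
    (hvt' : vt' ∈ M.Vtilde) (h : M.IsPsi vt v) (h' : M.IsPsi vt' v) (i : Fin N) {x : Plane}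
    (hx : x ∈ refTri) : vt (M.map i x) = vt' (M.map i x) := by
  obtain ⟨w, ⟨wh, hwh, hw⟩, hn, he⟩ := h i
  obtain ⟨w', ⟨wh', hwh', hw'⟩, hn', he'⟩ := h' i
  have hAinj : ∀ y ∈ refTri, Function.Injective (M.A i y) := fun y hy a b hab => by
    have hdet := (M.det_fderiv_F_pos i hy).ne'
    simp only [A, smul_apply] at hab
    exact (M.derivEquiv i hy).injective (smul_right_injective _ (inv_ne_zero hdet) hab)
  -- The field v is prescribed only on open elements, but A_T is invertible and the reference fields
  -- are continuous, so they agree up to the boundary and hence at all nodes.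
  have hint : EqOn wh wh' (interior refTri) := fun y hy => by
    have hyT := interior_subset hy
    apply hAinj y hyT
    rw [← hw y hyT, ← hw' y hyT, ← he (mem_image_of_mem _ hy), ← he' (mem_image_of_mem _ hy)]
  have hall : EqOn wh wh' refTri := hint.of_subset_closure hwh.1 hwh'.1 interior_subset
    (by
      rw [convex_refTri.closure_interior_eq_closure_of_nonempty_interior interior_refTri_nonempty]
      exact subset_closure)
  rw [← iUnion_refSub] at hx
  obtain ⟨k, hk⟩ := mem_iUnion.1 hx
  obtain ⟨q, hq, hqe⟩ := ((hvt.2 i).2 k).exists_polyField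
  obtain ⟨q', hq', hqe'⟩ := ((hvt'.2 i).2 k).exists_polyField
  -- With bound zero at the nodes, the estimate becomes unisolvence of quadratic Lagrange
  -- interpolation.
  have hz := norm_le_of_nodes (hq.sub hq') (k := k) (B := 0) (fun a ⟨ha, hak⟩ => by
    have haT := refSub_subset k hak
    rw [← hqe hak, ← hqe' hak, Function.comp_apply, Function.comp_apply, ← hn a ha, ← hn' a ha,
      hw a haT, hw' a haT, hall haT, sub_self, norm_zero]) hk
  rw [mul_zero, norm_le_zero_iff, sub_eq_zero] at hz
  have h1 := hqe hk
  have h2 := hqe' hk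
  rw [Function.comp_apply] at h1 h2
  rw [h1, h2, hz]

end IsoMesh

end IsoFEM

end

/-- The constant `C` depends only on the regularity constants. On each element the fields are
piecewise smooth, so the elementwise gradient is the (almost everywhere defined) derivative. -/
theorem mainTheorem10 (σ κ h₀ : ℝ) :
    ∃ C : ℝ, 0 < C ∧ ∀ (N : ℕ) (M : IsoFEM.IsoMesh N), M.Regular σ κ h₀ →
      ∃ E : M.Vh →ₗ[ℝ] IsoFEM.H10 M.compDomain,
        (∀ (v : M.Vh), ∀ vt ∈ M.Vtilde, M.IsPsi vt (v : IsoFEM.Plane → IsoFEM.Plane) →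
          ∀ i, ∀ x ∈ IsoFEM.refTri,
            (E v : IsoFEM.Plane → IsoFEM.Plane) (M.F i x) = vt (M.map i x)) ∧
        ∀ (v : M.Vh) (i : Fin N),
          M.normL2 i ((v : IsoFEM.Plane → IsoFEM.Plane) - (E v : IsoFEM.Plane → IsoFEM.Plane)) +
            ENNReal.ofReal (M.diam i) * M.gradNormL2 i
              ((v : IsoFEM.Plane → IsoFEM.Plane) - (E v : IsoFEM.Plane → IsoFEM.Plane)) ≤
          ENNReal.ofReal (C * M.diam i ^ 2) *
            M.gradNormL2 i (v : IsoFEM.Plane → IsoFEM.Plane) := by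
  obtain ⟨C, hC, hest⟩ := IsoFEM.IsoMesh.exists_element_estimate σ κ
  refine ⟨C, hC, fun N M hM => ?_⟩
  choose vt hvt hpsi using fun v : M.Vh => v.2
  -- Independence of the chosen preimage: the sum of chosen preimages is a preimage of the sum,
  -- which gives additivity, and likewise homogeneity.
  have hE : ∀ (v : M.Vh), ∀ vt' ∈ M.Vtilde, M.IsPsi vt' (v : IsoFEM.Plane → IsoFEM.Plane) →
      M.push (vt v) = M.push vt' := fun v vt' hvt' h =>
    M.push_congr fun i x hx => (hpsi v).unique (hvt v) hvt' h i hx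
  refine ⟨{ toFun := fun v => ⟨M.push (vt v), M.push_mem_H10 (hvt v).1⟩
            map_add' := fun v v' => Subtype.ext ?_
            map_smul' := fun c v => Subtype.ext ?_ }, fun v vt' hvt' h i x hx => ?_,
    fun v i => hest h₀ N M hM _ (hvt v) _ (hpsi v) i⟩
  · exact (hE (v + v') _ (add_mem (hvt v) (hvt v')) ((hpsi v).add (hpsi v'))).trans
      (M.push_add _ _)
  · exact (hE (c • v) _ (Submodule.smul_mem _ c (hvt v)) ((hpsi v).smul c)).trans
      (M.push_smul c _)
  · exact (congrFun (hE v vt' hvt' h) _).trans (M.push_F i vt' hx)
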